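/- **Conventions.** For $n,m\ge 0$, $(\mathbb{G}_m^n)^{[m]}$ is the union of all algebraic subgroups of $\mathbb{G}_m^n$ of codimension $\ge m$, i.e. the set of points $x$ with $\prod_i x_i^{a_i}=1$ for all $a$ in some subgroup $\Lambda\subset\mathbb{Z}^n$ of rank $\ge m$. Let $R$ be a domain with fraction field $F$. A *geometrically irreducible curve* over $R$ is an integral separated $R$-scheme $X$ of finite type whose generic fibre $X_F$ is geometrically irreducible of dimension one. A morphism $f=(f_1,\dots,f_n):X\to\mathbb{G}_m^n$ is given by $f_i\in\mathcal{O}(X)^\times$. A *normal compactification* of the normalisation $\nu:\widetilde X\to X$ is a proper normal integral $R$-scheme $C$ containing $\widetilde X$ as an open $R$-subscheme. The support on $C$ of the divisor of $f_i$ is the set of points of $C$ near which $\nu^*f_i$ does not extend to an invertible function. For a ring $O$ contained in a field $L\supset R$, a point $z\in X(L)$ is *$O$-integral* if $z:\mathrm{Spec}\,L\to X$ extends to $\mathrm{Spec}\,O\to X$. *$X$ is not contained in a translate of a proper subgroup* means that $f(X)$ is not contained, over an algebraic closure of $F$, in a translate of a proper algebraic subgroup of $\mathbb{G}_m^n$.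 **Lemma.** (1) Let $p$ be a prime, $\mathbb{Z}_p^{\mathrm{nr}}$ the ring of integers of the maximal unramified extension $\mathbb{Q}_p^{\mathrm{nr}}$ of $\mathbb{Q}_p$, and $\overline{\mathbb{Z}}_p$ that of $\overline{\mathbb{Q}}_p$. Let $n\ge1$, let $X$ be a geometrically irreducible curve over $\mathbb{Z}_p^{\mathrm{nr}}$ with a morphism $f=(f_1,\dots,f_n):X\to\mathbb{G}_m^n$, and let $C$ be a normal compactification of the normalisation $\widetilde X$ of $X$. Suppose that $C\setminus\widetilde X$ is the union of the supports of the divisors of the $f_i$ on $C$, and that $C\setminus\widetilde X$, with its reduced structure, is étale over $\mathbb{Z}_p^{\mathrm{nr}}$. Then there are finitely many surjective homomorphisms of algebraic groups $\theta_j:\mathbb{G}_m^n\to\mathbb{G}_m^{n-1}$ such that, for $(L,R)=(\mathbb{Q}_p^{\mathrm{nr}},\mathbb{Z}_p^{\mathrm{nr}})$ and for $(L,R)=(\overline{\mathbb{Q}}_p,\overline{\mathbb{Z}}_p)$: if $z\in X(L)$ satisfies $f(z)\in(\mathbb{G}_m^n)^{[2]}$ and $f_i(z)\notin R^\times$ for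 some $i$, then for some $j$ the point $\theta_j(f(z))$ lies in $(\mathbb{G}_m^{n-1})^{[2]}$ and has all its coordinates in $R^\times$. Moreover, if $n=3$ and $X$ is not contained in a translate of a proper subgroup, then all but finitely many $z\in X(\overline{\mathbb{Q}}_p)$ with $f(z)\in(\mathbb{G}_m^3)^{[2]}$ are $\overline{\mathbb{Z}}_p$-integral. (2) Let $K$ be a number field, $S$ a finite set of primes of $K$, $X$ a geometrically irreducible curve over $\mathcal{O}_{K,S}$ and $f=(f_1,f_2,f_3):X\to\mathbb{G}_m^3$ an $\mathcal{O}_{K,S}$-morphism such that $X$ is not contained in a translate of a proper subgroup. For a set $T$ of primes let $\overline{\mathcal{O}}_{T}$ be the integral closure of $\mathcal{O}_{K,T}$ in $\overline K$. Then there is a finite set $T\supset S$ of primes of $K$ such that all but finitely many $z\in X(\overline K)$ with $f(z)\in(\mathbb{G}_m^3)^{[2]}$ are $T$-integral with respect to $f$, i.e. $f_i(z)\in\overline{\mathcal{O}}_{T}^{\times}$ for $i=1,2,3$. If moreover, as in (1), $C\setminus\widetilde{X_K}$ is the union of the supports of the divisors of the $f_i$, where $C$ is a normal compactification over $K$ of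 the normalisation $\widetilde{X_K}$ of $X_K$, then (for the same $T$) all but finitely many $z\in X(\overline K)$ with $f(z)\in(\mathbb{G}_m^3)^{[2]}$ are $\overline{\mathcal{O}}_{T}$-integral points of $X$. -/

import Mathlib

open AlgebraicGeometry CategoryTheory CategoryTheory.Limits

universe u

noncomputable section

namespace TorusCurve

/-! ### Split tori: subgroups, special points, homomorphisms -/

section Torus

variable {F : Type u} [Field F]

/-- The value at `x` of the character of `𝔾_m^n` with exponent vector `a`. -/
def character {n : ℕ} (a : Fin n → ℤ) (x : Fin n → Fˣ) : Fˣ := ∏ i, x i ^ a i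

/-- The `F`-points of the algebraic subgroup of `𝔾_m^n` cut out by a group `Λ ⊆ ℤ^n` of
characters: the common kernel of all characters in `Λ`. Every algebraic subgroup of `𝔾_m^n` (in
characteristic zero) is of this form for exactly one `Λ`, and its codimension is the rank
of `Λ`. -/
def algSubgroup {n : ℕ} (F : Type u) [Field F] (Λ : Submodule ℤ (Fin n → ℤ)) :
    Subgroup (Fin n → Fˣ) where
  carrier := {x | ∀ a ∈ Λ, character a x = 1}
  one_mem' := by
    intro a _
    simp [character]
  mul_mem' := by
    intro x y hx hy a ha
    have h1 := hx a ha
    have h2 := hy a ha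
    simp only [character] at h1 h2 ⊢
    simp only [Pi.mul_apply, mul_zpow, Finset.prod_mul_distrib, h1, h2, mul_one]
  inv_mem' := by
    intro x hx a ha
    have h1 := hx a ha
    simp only [character] at h1 ⊢
    simp only [Pi.inv_apply, inv_zpow, Finset.prod_inv_distrib, h1, inv_one]

/-- `(𝔾_m^n)^{[m]}`: the union of all algebraic subgroups of `𝔾_m^n` of codimension `≥ m`. -/
def special (F : Type u) [Field F] (n m : ℕ) : Set (Fin n → Fˣ) :=
  {x | ∃ Λ : Submodule ℤ (Fin n → ℤ), m ≤ Module.finrank ℤ Λ ∧ x ∈ algSubgroup F Λ}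

/-- The homomorphism `𝔾_m^n → 𝔾_m^m` of algebraic groups attached to an integer matrix
(row `j` is the exponent vector of the `j`-th component), on `F`-points. Every homomorphism of
algebraic groups `𝔾_m^n → 𝔾_m^m` is of this form. -/
def torusHom {n m : ℕ} (F : Type u) [Field F] (A : Matrix (Fin m) (Fin n) ℤ) :
    (Fin n → Fˣ) →* (Fin m → Fˣ) where
  toFun x := fun j => character (A j) x
  map_one' := by
    funext j
    simp [character]
  map_mul' := by
    intro x y
    funext j
    simp only [character, Pi.mul_apply, mul_zpow, Finset.prod_mul_distrib]

/-- The elements of `Fˣ` that are units of the subring `O` of `F`. -/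
def unitsOf (O : Subring F) : Subgroup Fˣ := (Units.map (O.subtype : O →* F)).range

end Torus

/-! ### Curves over a ring, points, integral points -/

section Curve

variable {R : Type u} [CommRing R] {X : Scheme.{u}}

/-- The fibre of an `R`-scheme over `Spec F`. -/
abbrev genericFibre (F : Type u) [Field F] [Algebra R F] (π : X ⟶ Spec (.of R)) : Scheme.{u} :=
  pullback π (Spec.map (CommRingCat.ofHom (algebraMap R F)))

/-- The structure morphism of the fibre over `Spec F`. -/
abbrev genericFibreMap (F : Type u) [Field F] [Algebra R F] (π : X ⟶ Spec (.of R)) :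
    genericFibre F π ⟶ Spec (.of F) :=
  pullback.snd π (Spec.map (CommRingCat.ofHom (algebraMap R F)))

/-- The projection from the fibre over `Spec F` to the total space. -/
abbrev genericFibreProj (F : Type u) [Field F] [Algebra R F] (π : X ⟶ Spec (.of R)) :
    genericFibre F π ⟶ X :=
  pullback.fst π (Spec.map (CommRingCat.ofHom (algebraMap R F)))

/-- `π : X ⟶ Spec R` is a geometrically irreducible curve over the domain `R`, whose fraction
field is `F`: an integral separated `R`-scheme of finite type whose generic fibre is
geometrically irreducible of dimension one. -/
structure IsGeomIrredCurve (F : Type u) [Field F] [Algebra R F] (π : X ⟶ Spec (.of R)) :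
    Prop where
  isIntegral : IsIntegral X
  isSeparated : IsSeparated π
  locallyOfFiniteType : LocallyOfFiniteType π
  quasiCompact : QuasiCompact π
  geometricallyIrreducible : GeometricallyIrreducible (genericFibreMap F π)
  dim_eq_one : topologicalKrullDim (genericFibre F π) = 1

/-- The points of `X` over `Spec R` with values in `F`. -/
def Point (F : Type u) [Field F] [Algebra R F] (π : X ⟶ Spec (.of R)) : Type u :=
  {z : Spec (.of F) ⟶ X // z ≫ π = Spec.map (CommRingCat.ofHom (algebraMap R F))}

variable {F : Type u} [Field F] [Algebra R F] {π : X ⟶ Spec (.of R)}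

/-- The image `(f_1(z), …, f_n(z))` of the point `z` under the morphism `X ⟶ 𝔾_m^n` given by the
invertible functions `f_1, …, f_n`. -/
def Point.coords (z : Point F π) {n : ℕ} (f : Fin n → Γ(X, ⊤)ˣ) : Fin n → Fˣ := fun i =>
  Units.map (((Scheme.ΓSpecIso (.of F)).hom.hom.comp z.1.appTop.hom : Γ(X, ⊤) →+* F) :
    Γ(X, ⊤) →* F) (f i)

/-- The point `z : Spec F ⟶ X` is integral with respect to a subring `O` of `F`:
it extends to a morphism `Spec O ⟶ X`. -/
def Point.IsIntegralOver (z : Point F π) (O : Subring F) : Prop :=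
  ∃ w : Spec (.of O) ⟶ X, Spec.map (CommRingCat.ofHom O.subtype) ≫ w = z.1

/-- The image of `X` under `(f_1, …, f_n)` is, over the field `F`, not contained in a translate of
a proper algebraic subgroup of `𝔾_m^n` (a subgroup is proper if some nontrivial character
vanishes on it). -/
def NotInTranslate (F : Type u) [Field F] [Algebra R F] (π : X ⟶ Spec (.of R)) {n : ℕ}
    (f : Fin n → Γ(X, ⊤)ˣ) : Prop :=
  ∀ Λ : Submodule ℤ (Fin n → ℤ), Λ ≠ ⊥ → ∀ c : Fin n → Fˣ,
    ∃ z : Point F π, c⁻¹ * z.coords f ∉ algSubgroup F Λ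

end Curve

/-! ### Normalisation, compactification, divisors -/

/-- A normal integral scheme: all local rings are integrally closed domains. -/
structure IsNormalIntegral (X : Scheme.{u}) : Prop where
  isIntegral : IsIntegral X
  isIntegrallyClosed : ∀ x : X, IsIntegrallyClosed (X.presheaf.stalk x)

/-- `ν : Xt ⟶ X` is the normalisation of the integral scheme `X`: `Xt` is normal and `ν` is
integral and birational. -/
structure IsNormalisation {Xt X : Scheme.{u}} (ν : Xt ⟶ X) : Prop where
  normal : IsNormalIntegral Xt
  integralHom : IsIntegralHom ν
  birational : ∃ U : X.Opens, (U : Set X).Nonempty ∧ IsIso (ν ∣_ U)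

/-- `j : Xt ⟶ C` exhibits `C`, proper over `S` and normal, as a compactification of the
normalisation `ν : Xt ⟶ X` of the `S`-scheme `X`. -/
structure IsNormalCompactification {S X Xt C : Scheme.{u}} (π : X ⟶ S) (ν : Xt ⟶ X)
    (j : Xt ⟶ C) (πC : C ⟶ S) : Prop where
  normalisation : IsNormalisation ν
  openImmersion : IsOpenImmersion j
  normal : IsNormalIntegral C
  proper : IsProper πC
  comp_eq : j ≫ πC = ν ≫ π

/-- Let `j : U ⟶ C` be a dense open subscheme of a normal scheme and `u` an invertible
function on `U`, viewed as a rational function on `C`. The support of the divisor of `u` on `C` is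
the set of points of `C` near which `u` does not extend to an invertible function. -/
def divSupport {U C : Scheme.{u}} (j : U ⟶ C) (u : Γ(U, ⊤)ˣ) : Set C :=
  {x | ¬ ∃ V : C.Opens, x ∈ V ∧ ∃ g : Γ(C, V)ˣ,
    (j.app V).hom (g : Γ(C, V)) =
      (U.presheaf.map (homOfLE (le_top : j ⁻¹ᵁ V ≤ ⊤)).op).hom (u : Γ(U, ⊤))}

/-- The complement of `Xt` in `C` is the union of (the supports of) the divisors of the
functions `f_1, …, f_n` on `X`, pulled back along `ν : Xt ⟶ X`. -/
def BoundaryEqDivisors {X Xt C : Scheme.{u}} (ν : Xt ⟶ X) (j : Xt ⟶ C) {n : ℕ}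
    (f : Fin n → Γ(X, ⊤)ˣ) : Prop :=
  (Set.range j)ᶜ = ⋃ i, divSupport j (Units.map (ν.appTop.hom : Γ(X, ⊤) →* Γ(Xt, ⊤)) (f i))

/-- The complement of `Xt` in `C` is étale over `S`: it is the underlying set of a closed
subscheme of `C` that is étale over `S` (which then is reduced if `S` is, hence is the complement
with its reduced structure). -/
def BoundaryEtale {S Xt C : Scheme.{u}} (j : Xt ⟶ C) (πC : C ⟶ S) : Prop :=
  ∃ (D : Scheme.{u}) (i : D ⟶ C), IsClosedImmersion i ∧ Set.range i = (Set.range j)ᶜ ∧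
    Etale (i ≫ πC)

/-! ### The rings -/

section Padic

variable (p : ℕ) [Fact p.Prime]

/-- `ℚ_p^nr`: the compositum of all finite extensions of `ℚ_p` in `ℚ̄_p` whose ring of integers is
unramified over `ℤ_p`. -/
def Qnr : IntermediateField ℚ_[p] (PadicAlgCl p) :=
  sSup {L | FiniteDimensional ℚ_[p] L ∧
    Algebra.FormallyUnramified ℤ_[p] (integralClosure ℤ_[p] L)}

/-- `ℤ_p^nr`: the ring of integers of `ℚ_p^nr`. -/
abbrev Znr : Subalgebra ℤ_[p] (Qnr p) := integralClosure ℤ_[p] (Qnr p)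

/-- `ℤ̄_p`: the ring of integers of `ℚ̄_p`. -/
abbrev Zbar : Subalgebra ℤ_[p] (PadicAlgCl p) := integralClosure ℤ_[p] (PadicAlgCl p)

end Padic

open NumberField IsDedekindDomain in
/-- The ring of `T`-integers of the algebraic closure of the number field `K`: the integral
closure of `𝓞_{K,T}`. -/
abbrev Tbar {K : Type u} [Field K] [NumberField K] (T : Set (HeightOneSpectrum (𝓞 K))) :
    Subalgebra (T.integer K) (AlgebraicClosure K) :=
  integralClosure (T.integer K) (AlgebraicClosure K)

end TorusCurve

end

noncomputable section

namespace TorusCurve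

/-! ### Linear relations between roots of unity -/

section RootsOfUnity

variable {Ω : Type*} [Field Ω] [CharZero Ω]

/-! Part (1). A point z over ℚ̄_p lifts to X̃ and extends, by properness of C, to Spec ℤ̄_p → C. If
the closed point lands in X̃, then z is integral. Otherwise it lands at a boundary point x of the
special fibre. Since the boundary is étale over the discrete valuation ring ℤ_p^nr, x has exactly
one proper generization η inside the boundary, and η lies in the generic fibre. The local ring at η
is a discrete valuation ring, so the order of f^a along η is a linear form w(a). It is nonzero
because η lies on the divisor of some f_i, and only finitely many η occur. If w(a) ≥ 0, then f^a is
regular at every proper generization of x, hence at x, because C is normal and x has codimension at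
least two. So f^a(z) is integral exactly when w(a) ≥ 0, and the characters with unit value at f(z)
form ker w (`exists_boundary_weights`, `exists_weights`). The map θ_w is given by a basis of ker w.
The relations satisfied by f(z) lie in ker w, so no codimension is lost
(`torusHom_mem_special_of_rows_basis_ker`).

For n = 3 this makes two independent characters torsion at f(z). Their values satisfy a fixed
polynomial relation, since X is a curve. Mann's theorem on relations between roots of unity then
puts the pair into finitely many cosets of proper subgroups. Each coset is met finitely often,
because X lies in no translate of a proper subgroup (`finite_setOf_isOfFinOrder_character`).

Part (2), unit coordinates. Fix polynomial relations Q_kl(f_k, f_l) = 0 and let T contain the primes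
dividing their coefficients. If some f_i(z) is not a T-unit, choose a valuation ring V containing
the T-integers in which it is not a unit. In Q_kl(f_k(z), f_l(z)) = 0 two terms of maximal valuation
balance, so some monomial in f_k, f_l from a fixed finite list has a V-unit value. As f(z) satisfies
relations of rank two, such a character is torsion at f(z). The three pairs (k, l) supply two
independent ones, and the finiteness above applies (`exists_finite_exceptional_set`).

Part (2), integral points. If the boundary is the union of the divisors, the functions f_i and f_i⁻¹
define a finite morphism from X_K to an affine scheme, so X_K is affine and its functions are
integral over K[f_i, f_i⁻¹]. The map X_K → X factors through a finitely generated algebra. The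
finitely many integral equations of its generators involve finitely many constants of K, and it
suffices to invert the primes in their denominators (`exists_finite_setOf_primes_isIntegralOver`).
-/

lemma sum_pow_eq_zero_of_coprime [IsAlgClosed Ω] {ι : Type*} (s : Finset ι) (q : ι → ℚ)
    (η : ι → Ω) {m a : ℕ} (hm : 0 < m) (hη : ∀ t ∈ s, η t ^ m = 1) (ha : a.Coprime m)
    (h0 : ∑ t ∈ s, (q t : Ω) * η t = 0) : ∑ t ∈ s, (q t : Ω) * η t ^ a = 0 := by
  have : NeZero (m : Ω) := ⟨by exact_mod_cast hm.ne'⟩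
  obtain ⟨ζ, hζ⟩ := HasEnoughRootsOfUnity.exists_primitiveRoot Ω m
  have : NeZero m := ⟨hm.ne'⟩
  have hk : ∀ t, ∃ k : ℕ, t ∈ s → ζ ^ k = η t := by
    intro t
    by_cases ht : t ∈ s
    · obtain ⟨i, -, hi⟩ := hζ.eq_pow_of_pow_eq_one (hη t ht)
      exact ⟨i, fun _ => hi⟩
    · exact ⟨0, fun h => absurd h ht⟩
  choose k hk using hk
  let g : Polynomial ℚ := ∑ t ∈ s, Polynomial.C (q t) * Polynomial.X ^ k t
  have hg : ∀ x : Ω, Polynomial.aeval x g = ∑ t ∈ s, (q t : Ω) * x ^ k t := by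
    intro x
    simp [g]
  have h1 : Polynomial.aeval ζ g = 0 := by
    rw [hg, ← h0]
    exact Finset.sum_congr rfl fun t ht => by rw [hk t ht]
  -- Galois conjugation ζ ↦ ζ ^ a in polynomial form: the cyclotomic polynomial is the minimal
  -- polynomial of both roots, so it carries the vanishing of `g` from one to the other.
  have h2 : minpoly ℚ ζ ∣ g := minpoly.dvd ℚ ζ h1
  rw [← Polynomial.cyclotomic_eq_minpoly_rat hζ hm] at h2
  have h3 : Polynomial.aeval (ζ ^ a) g = 0 := by
    obtain ⟨r, hr⟩ := h2
    have h4 : IsPrimitiveRoot (ζ ^ a) m := hζ.pow_of_coprime a ha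
    have h5 : Polynomial.aeval (ζ ^ a) (Polynomial.cyclotomic m ℚ) = 0 := by
      rw [Polynomial.cyclotomic_eq_minpoly_rat h4 hm, minpoly.aeval]
    rw [hr, map_mul, h5, zero_mul]
  rw [hg] at h3
  rw [← h3]
  refine Finset.sum_congr rfl fun t ht => ?_
  rw [← hk t ht, ← pow_mul, ← pow_mul, mul_comm a (k t)]

omit [CharZero Ω] in
lemma sum_range_pow_of_pow_eq_one {x : Ω} {p : ℕ} (hx : x ^ p = 1) [DecidableEq Ω] :
    ∑ j ∈ Finset.range p, x ^ j = if x = 1 then (p : Ω) else 0 := by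
  split_ifs with h
  · simp [h]
  · have := mul_geom_sum x p
    rw [hx, sub_self] at this
    exact (mul_eq_zero.mp this).resolve_left (sub_ne_zero.mpr h)

/-- A rational linear relation of minimal support between roots of unity, one of which is `1`:
the least common exponent is squarefree and all its prime factors are at most the length of the
relation. -/
lemma prime_dvd_exponent_of_minimal_relation [IsAlgClosed Ω] {ι : Type*} [DecidableEq ι]
    (s : Finset ι) (q : ι → ℚ)
    (η : ι → Ω) {u : ι} (hu : u ∈ s) (hu1 : η u = 1) {p m' : ℕ} (hp : p.Prime) (hm' : 0 < m')
    (hη : ∀ t ∈ s, η t ^ (p * m') = 1) (hmin : ∃ t ∈ s, η t ^ m' ≠ 1)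
    (h0 : ∑ t ∈ s, (q t : Ω) * η t = 0)
    (hs : ∀ s' ⊂ s, s'.Nonempty → ∑ t ∈ s', (q t : Ω) * η t ≠ 0) :
    ¬ p ∣ m' ∧ p ≤ s.card := by
  classical
  have hp0 : (p : Ω) ≠ 0 := by exact_mod_cast hp.ne_zero
  have hω : ∀ t ∈ s, (η t ^ m') ^ p = 1 := fun t ht => by rw [← pow_mul, mul_comm, hη t ht]
  -- the block of the terms with `η t ^ m' = 1` does not vanish
  have hblock : ∑ t ∈ s with η t ^ m' = 1, (q t : Ω) * η t ≠ 0 := by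
    apply hs
    · refine (Finset.filter_ssubset).mpr hmin
    · exact ⟨u, by simp [hu, hu1]⟩
  -- Exponents 1 + m'j are automatically prime to m', so only p has to be avoided. Such a
  -- conjugation multiplies the term t by a power of the p-th root of unity η_t ^ m'.
  have hconj : ∀ j : ℕ, (1 + m' * j).Coprime p →
      ∑ t ∈ s, (q t : Ω) * η t * (η t ^ m') ^ j = 0 := by
    intro j hj
    have hc : (1 + m' * j).Coprime (p * m') := by
      refine Nat.Coprime.mul_right hj ?_
      rw [Nat.coprime_add_mul_left_left]
      exact Nat.coprime_one_left m'
    have := sum_pow_eq_zero_of_coprime s q η (Nat.mul_pos hp.pos hm') hη hc h0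
    rw [← this]
    refine Finset.sum_congr rfl fun t ht => ?_
    rw [pow_add, pow_mul, pow_one, mul_assoc]
  -- orthogonality
  have horth : ∀ w : Ω, w ^ p = 1 →
      ∑ j ∈ Finset.range p, w⁻¹ ^ j * ∑ t ∈ s, (q t : Ω) * η t * (η t ^ m') ^ j =
        p * ∑ t ∈ s with η t ^ m' = w, (q t : Ω) * η t := by
    intro w hw
    have hw0 : w ≠ 0 := by
      rintro rfl
      rw [zero_pow hp.ne_zero] at hw
      exact zero_ne_one hw
    simp_rw [Finset.mul_sum]
    rw [Finset.sum_comm, Finset.sum_filter]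
    refine Finset.sum_congr rfl fun t ht => ?_
    have h1 : (w⁻¹ * η t ^ m') ^ p = 1 := by rw [mul_pow, inv_pow, hw, hω t ht, inv_one, one_mul]
    have h2 : ∀ j, w⁻¹ ^ j * ((q t : Ω) * η t * (η t ^ m') ^ j) =
        (q t : Ω) * η t * (w⁻¹ * η t ^ m') ^ j := by
      intro j
      rw [mul_pow]
      ring
    simp_rw [h2]
    rw [← Finset.mul_sum, sum_range_pow_of_pow_eq_one h1]
    have h3 : w⁻¹ * η t ^ m' = 1 ↔ η t ^ m' = w := by
      rw [inv_mul_eq_one₀ hw0, eq_comm]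
    simp only [h3]
    split_ifs <;> ring
  -- If p divided m', every j would be admissible, and averaging over all of them would isolate the
  -- block η_t ^ m' = 1 and make it vanish.
  have hndvd : ¬ p ∣ m' := by
    intro hdvd
    apply hblock
    have h1 := horth 1 (one_pow p)
    rw [Finset.sum_eq_zero] at h1
    · exact (mul_eq_zero.mp h1.symm).resolve_left hp0
    · intro j _
      rw [hconj j, mul_zero]
      rw [Nat.coprime_comm, Nat.Prime.coprime_iff_not_dvd hp,
        Nat.dvd_add_left (hdvd.mul_right j)]
      exact hp.one_lt.ne' ∘ Nat.dvd_one.mp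
  refine ⟨hndvd, ?_⟩
  by_contra hlt
  push Not at hlt
  -- the unique bad exponent
  obtain ⟨j₀, hj₀p, hj₀⟩ : ∃ j₀ < p, ∀ j < p, j ≠ j₀ → (1 + m' * j).Coprime p := by
    have : Fact p.Prime := ⟨hp⟩
    have hm0 : (m' : ZMod p) ≠ 0 := by rwa [Ne, ZMod.natCast_eq_zero_iff]
    refine ⟨(-(m' : ZMod p)⁻¹).val, ZMod.val_lt _, fun j hj hne => ?_⟩
    rw [Nat.coprime_comm, Nat.Prime.coprime_iff_not_dvd hp, ← ZMod.natCast_eq_zero_iff]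
    intro h
    apply hne
    push_cast at h
    have h1 : (j : ZMod p) = -(m' : ZMod p)⁻¹ := by
      field_simp
      linear_combination h
    rw [← h1, ZMod.val_natCast_of_lt hj]
  -- Only the bad exponent j₀ survives the averaging, so all blocks are nonzero multiples of one and
  -- the same sum.
  have hS : ∀ w : Ω, w ^ p = 1 →
      w⁻¹ ^ j₀ * ∑ t ∈ s, (q t : Ω) * η t * (η t ^ m') ^ j₀ =
        p * ∑ t ∈ s with η t ^ m' = w, (q t : Ω) * η t := by
    intro w hw
    rw [← horth w hw, Finset.sum_eq_single j₀]
    · intro j hj hne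
      rw [hconj j (hj₀ j (Finset.mem_range.mp hj) hne), mul_zero]
    · intro h
      exact absurd (Finset.mem_range.mpr hj₀p) h
  -- With more p-th roots of unity than terms, some block is empty. The common sum is then zero, and
  -- the block of 1 vanishes with it.
  obtain ⟨w, hw, hws⟩ : ∃ w : Ω, w ^ p = 1 ∧ ∀ t ∈ s, η t ^ m' ≠ w := by
    have : NeZero (p : Ω) := ⟨hp0⟩
    have : NeZero p := ⟨hp.ne_zero⟩
    obtain ⟨ζ, hζ⟩ := HasEnoughRootsOfUnity.exists_primitiveRoot Ω p
    have hcard : (s.image fun t => η t ^ m').card < (Polynomial.nthRootsFinset p (1 : Ω)).card := by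
      rw [hζ.card_nthRootsFinset]
      exact Finset.card_image_le.trans_lt hlt
    obtain ⟨w, hw1, hw2⟩ := Finset.exists_mem_notMem_of_card_lt_card hcard
    refine ⟨w, (Polynomial.mem_nthRootsFinset hp.pos (1 : Ω)).mp hw1, fun t ht h => hw2 ?_⟩
    exact Finset.mem_image.mpr ⟨t, ht, h⟩
  have h1 := hS w hw
  rw [Finset.filter_false_of_mem hws, Finset.sum_empty, mul_zero] at h1
  have hw0 : w ≠ 0 := by
    rintro rfl
    rw [zero_pow hp.ne_zero] at hw
    exact zero_ne_one hw
  have h2 := (mul_eq_zero.mp h1).resolve_left (pow_ne_zero _ (inv_ne_zero hw0))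
  have h3 := hS 1 (one_pow p)
  rw [h2, mul_zero] at h3
  exact hblock ((mul_eq_zero.mp h3.symm).resolve_left hp0)

/-- **Mann's theorem.** In a minimal vanishing rational linear combination of `N` roots of unity,
the quotients of the roots of unity are killed by `N!`. -/
theorem pow_factorial_card_eq_of_minimal_relation [IsAlgClosed Ω] {ι : Type*} (s : Finset ι)
    (q : ι → ℚ) (η : ι → Ω) (hη : ∀ t ∈ s, IsOfFinOrder (η t))
    (h0 : ∑ t ∈ s, (q t : Ω) * η t = 0)
    (hs : ∀ s' ⊂ s, s'.Nonempty → ∑ t ∈ s', (q t : Ω) * η t ≠ 0) {t u : ι} (ht : t ∈ s)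
    (hu : u ∈ s) : η t ^ s.card.factorial = η u ^ s.card.factorial := by
  classical
  have hu0 : η u ≠ 0 := by
    intro h
    have := (hη u hu).isUnit
    rw [h] at this
    exact not_isUnit_zero this
  let η' : ι → Ω := fun t => η t * (η u)⁻¹
  have hηu : (η u)⁻¹ * η u = 1 := inv_mul_cancel₀ hu0
  have hη' : ∀ t ∈ s, IsOfFinOrder (η' t) := fun t ht => by
    obtain ⟨a, ha, ha'⟩ := isOfFinOrder_iff_pow_eq_one.mp (hη t ht)
    obtain ⟨b, hb, hb'⟩ := isOfFinOrder_iff_pow_eq_one.mp (hη u hu)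
    refine isOfFinOrder_iff_pow_eq_one.mpr ⟨a * b, Nat.mul_pos ha hb, ?_⟩
    simp only [η']
    rw [mul_pow, inv_pow, pow_mul, ha', one_pow, mul_comm a b, pow_mul, hb', one_pow, inv_one,
      one_mul]
  have hsum : ∀ s' : Finset ι, ∑ t ∈ s', (q t : Ω) * η' t =
      (∑ t ∈ s', (q t : Ω) * η t) * (η u)⁻¹ := by
    intro s'
    rw [Finset.sum_mul]
    exact Finset.sum_congr rfl fun t _ => (mul_assoc _ _ _).symm
  -- After division by η u one of the roots is 1. The least common exponent m is squarefree with
  -- prime factors at most N, so it divides N!.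
  have hex : ∃ m, 0 < m ∧ ∀ t ∈ s, η' t ^ m = 1 := by
    refine ⟨∏ t ∈ s, orderOf (η' t), Finset.prod_pos fun t ht => (hη' t ht).orderOf_pos, ?_⟩
    intro t ht
    exact orderOf_dvd_iff_pow_eq_one.mp (Finset.dvd_prod_of_mem (fun t => orderOf (η' t)) ht)
  let m := Nat.find hex
  obtain ⟨hm0, hm⟩ : 0 < m ∧ ∀ t ∈ s, η' t ^ m = 1 := Nat.find_spec hex
  have hmin : ∀ p, p.Prime → ∀ m', m = p * m' → ¬ p ∣ m' ∧ p ≤ s.card := by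
    intro p hp m' hmm
    have hm'0 : 0 < m' := Nat.pos_of_ne_zero fun h => by simp [hmm, h] at hm0
    refine prime_dvd_exponent_of_minimal_relation s q η' hu (mul_inv_cancel₀ hu0) hp hm'0
      (fun t ht => hmm ▸ hm t ht) ?_ (by rw [hsum, h0, zero_mul]) ?_
    · by_contra hcon
      push Not at hcon
      have hlt : m' < m := by
        rw [hmm]
        exact (Nat.lt_mul_iff_one_lt_left hm'0).mpr hp.one_lt
      exact Nat.find_min hex hlt ⟨hm'0, hcon⟩
    · intro s' hs' hne
      rw [hsum]
      exact mul_ne_zero (hs s' hs' hne) (inv_ne_zero hu0)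
  have hsq : Squarefree m := by
    rw [Nat.squarefree_iff_prime_squarefree]
    rintro p hp ⟨c, hc⟩
    exact (hmin p hp (p * c) (by rw [hc, mul_assoc])).1 (dvd_mul_right p c)
  have hdvd : m ∣ s.card.factorial := by
    rw [← Nat.prod_primeFactors_of_squarefree hsq]
    refine Finset.prod_primes_dvd _ (fun p hp => (Nat.prime_of_mem_primeFactors hp).prime) ?_
    intro p hp
    have hpp := Nat.prime_of_mem_primeFactors hp
    obtain ⟨m', hm'⟩ := Nat.dvd_of_mem_primeFactors hp
    exact (Nat.Prime.dvd_factorial hpp).mpr (hmin p hpp m' hm').2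
  have h1 : η' t ^ s.card.factorial = 1 := by
    obtain ⟨c, hc⟩ := hdvd
    rw [hc, pow_mul, hm t ht, one_pow]
  simp only [η'] at h1
  rwa [mul_pow, inv_pow, mul_inv_eq_one₀ (pow_ne_zero _ hu0)] at h1

/-- A vanishing finite sum either has a minimal vanishing subsum that meets two fibres of `k`, or
its restriction to every fibre of `k` vanishes. -/
lemma exists_minimal_subsum_or_fibre_sums_eq_zero {ι κ M : Type*} [AddCommGroup M] [DecidableEq κ]
    (k : ι → κ) (v : ι → M) (T : Finset ι) (hT : ∑ t ∈ T, v t = 0) :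
    (∃ T₀ ⊆ T, ∑ t ∈ T₀, v t = 0 ∧ (∀ s' ⊂ T₀, s'.Nonempty → ∑ t ∈ s', v t ≠ 0) ∧
      ∃ t ∈ T₀, ∃ u ∈ T₀, k t ≠ k u) ∨ ∀ i, ∑ t ∈ T with k t = i, v t = 0 := by
  classical
  induction T using Finset.strongInduction with
  | H T ih =>
    rcases T.eq_empty_or_nonempty with rfl | hne
    · right
      simp
    obtain ⟨T₀, hT₀, hmin⟩ := (T.powerset.filter fun T' => T'.Nonempty ∧
      ∑ t ∈ T', v t = 0).exists_minimal ⟨T, by simp [hne, hT]⟩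
    simp only [Finset.mem_filter, Finset.mem_powerset] at hT₀ hmin
    obtain ⟨hT₀T, hT₀ne, hT₀0⟩ := hT₀
    by_cases htwo : ∃ t ∈ T₀, ∃ u ∈ T₀, k t ≠ k u
    · left
      refine ⟨T₀, hT₀T, hT₀0, fun s' hs' hne' h => ?_, htwo⟩
      exact hs'.2 (hmin ⟨hs'.1.trans hT₀T, hne', h⟩ hs'.1)
    -- The minimal vanishing subsum now lies in a single fibre. Removing it changes no fibre sum,
    -- and the induction hypothesis applies to the rest.
    push Not at htwo
    have hsdiff : ∑ t ∈ T \ T₀, v t = 0 := by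
      have := Finset.sum_sdiff (f := v) hT₀T
      rwa [hT₀0, add_zero, hT] at this
    rcases ih (T \ T₀) (Finset.sdiff_ssubset hT₀T hT₀ne) hsdiff with ⟨T₁, h1, h2⟩ | h
    · exact Or.inl ⟨T₁, h1.trans Finset.sdiff_subset, h2⟩
    · right
      intro i
      have h1 : ∑ t ∈ T₀ with k t = i, v t = 0 := by
        obtain ⟨t₀, ht₀⟩ := hT₀ne
        by_cases hi : k t₀ = i
        · rw [Finset.filter_true_of_mem fun t ht => (htwo t ht t₀ ht₀).trans hi, hT₀0]
        · rw [Finset.filter_false_of_mem fun t ht h => hi ((htwo t₀ ht₀ t ht).trans h),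
            Finset.sum_empty]
      rw [Finset.sum_filter] at h1 ⊢
      have h2 := h i
      rw [Finset.sum_filter] at h2
      rw [← Finset.sum_sdiff hT₀T, h1, h2, add_zero]

/-- Elements of the field generated by the roots of unity are rational linear combinations of
roots of unity. -/
lemma exists_sum_rat_mul_of_mem_adjoin {x : Ω}
    (hx : x ∈ IntermediateField.adjoin ℚ {w : Ω | IsOfFinOrder w}) :
    ∃ (n : ℕ) (q : Fin n → ℚ) (η : Fin n → Ω), (∀ i, IsOfFinOrder (η i)) ∧
      ∑ i, (q i : Ω) * η i = x := by
  have halg : ∀ w ∈ {w : Ω | IsOfFinOrder w}, IsAlgebraic ℚ w := by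
    intro w hw
    obtain ⟨n, hn, h⟩ := isOfFinOrder_iff_pow_eq_one.mp hw
    refine ⟨Polynomial.X ^ n - 1, Polynomial.X_pow_sub_C_ne_zero hn 1, by simp [h]⟩
  have h1 := IntermediateField.adjoin_toSubalgebra_of_isAlgebraic halg
  rw [← IntermediateField.mem_toSubalgebra, h1, ← Subalgebra.mem_toSubmodule,
    Algebra.adjoin_eq_span] at hx
  obtain ⟨n, q, g, hg⟩ := Submodule.mem_span_set'.mp hx
  refine ⟨n, q, fun i => g i, fun i => ?_, by simpa [Algebra.smul_def] using hg⟩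
  have h2 : Submonoid.closure {w : Ω | IsOfFinOrder w} ≤ CommMonoid.torsion Ω := by
    rw [Submonoid.closure_le]
    intro w hw
    exact hw
  exact h2 (g i).2

/-- A linear relation with fixed coefficients between roots of unity forces two of the roots to
have a quotient of bounded order. -/
theorem exists_pow_eq_of_sum_mul_eq_zero [IsAlgClosed Ω] {κ : Type*} (s : Finset κ) (c : κ → Ω)
    {k₀ : κ} (hk₀ : k₀ ∈ s) (hc : c k₀ ≠ 0) :
    ∃ B : ℕ, 0 < B ∧ ∀ ζ : κ → Ω, (∀ k ∈ s, IsOfFinOrder (ζ k)) → ∑ k ∈ s, c k * ζ k = 0 →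
      ∃ k ∈ s, ∃ l ∈ s, k ≠ l ∧ ζ k ^ B = ζ l ^ B := by
  classical
  let E := IntermediateField.adjoin ℚ {w : Ω | IsOfFinOrder w}
  -- All ζ k lie in the cyclotomic field E, so an E-linear form replaces the arbitrary coefficients
  -- c k by elements of E, which are rational combinations of roots of unity.
  obtain ⟨φ, hφ⟩ : ∃ φ : Module.Dual E Ω, φ (c k₀) ≠ 0 := by
    by_contra hcon
    push Not at hcon
    exact hc ((Module.forall_dual_apply_eq_zero_iff E _).mp hcon)
  choose n q η hη hsum using fun k => exists_sum_rat_mul_of_mem_adjoin (φ (c k)).2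
  let T : Finset (Σ k, Fin (n k)) := s.sigma fun _ => Finset.univ
  let e : ℕ := ∏ t ∈ T, orderOf (η t.1 t.2)
  have he0 : 0 < e := Finset.prod_pos fun t _ => (hη t.1 t.2).orderOf_pos
  have he : ∀ t ∈ T, η t.1 t.2 ^ e = 1 := fun t ht =>
    orderOf_dvd_iff_pow_eq_one.mp (Finset.dvd_prod_of_mem (fun t => orderOf (η t.1 t.2)) ht)
  -- Mann's theorem bounds the order of the quotients of the products η·ζ by a divisor of |T|!. The
  -- factor e then removes the fixed roots η.
  refine ⟨e * T.card.factorial, Nat.mul_pos he0 (Nat.factorial_pos _), fun ζ hζ h0 => ?_⟩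
  have h1 : ∑ k ∈ s, (φ (c k) : Ω) * ζ k = 0 := by
    have h2 : ∀ k : s, ζ k ∈ E := fun k => IntermediateField.subset_adjoin _ _ (hζ k k.2)
    have h3 : φ (∑ k ∈ s.attach, c k * ζ k) = ∑ k ∈ s.attach, (⟨ζ k, h2 k⟩ : E) * φ (c k) := by
      rw [map_sum]
      refine Finset.sum_congr rfl fun k _ => ?_
      rw [← smul_eq_mul (a := (⟨ζ k, h2 k⟩ : E)), ← map_smul]
      congr 1
      rw [mul_comm]
      rfl
    rw [Finset.sum_attach s fun k => c k * ζ k, h0, map_zero] at h3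
    have h4 := congrArg (fun x : E => (x : Ω)) h3
    simp only [ZeroMemClass.coe_zero, AddSubmonoidClass.coe_finsetSum, MulMemClass.coe_mul] at h4
    rw [Finset.sum_attach s fun k => ζ k * (φ (c k) : Ω)] at h4
    rw [h4]
    exact Finset.sum_congr rfl fun k _ => mul_comm _ _
  have hfib : ∀ k ∈ s, ∑ t ∈ T with t.1 = k, ((q t.1 t.2 : ℚ) : Ω) * (η t.1 t.2 * ζ t.1) =
      (φ (c k) : Ω) * ζ k := by
    intro k hk
    rw [Finset.sum_filter, Finset.sum_sigma, Finset.sum_eq_single k]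
    · simp only [if_true]
      rw [← hsum k, Finset.sum_mul]
      exact Finset.sum_congr rfl fun i _ => (mul_assoc _ _ _).symm
    · intro l _ hl
      simp [hl]
    · exact fun h => absurd hk h
  have hT : ∑ t ∈ T, ((q t.1 t.2 : ℚ) : Ω) * (η t.1 t.2 * ζ t.1) = 0 := by
    rw [← h1, ← Finset.sum_fiberwise_of_maps_to (t := s) (g := fun t => t.1)
      fun t ht => (Finset.mem_sigma.mp ht).1]
    exact Finset.sum_congr rfl hfib
  have hζ0 : ∀ k ∈ s, ζ k ≠ 0 := fun k hk h => by
    have := (hζ k hk).isUnit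
    rw [h] at this
    exact not_isUnit_zero this
  rcases exists_minimal_subsum_or_fibre_sums_eq_zero (fun t : Σ k, Fin (n k) => t.1) _ T hT with
    ⟨T₀, hT₀, hz, hmin, t, ht, u, hu, htu⟩ | h
  · have hts : t.1 ∈ s := (Finset.mem_sigma.mp (hT₀ ht)).1
    have hus : u.1 ∈ s := (Finset.mem_sigma.mp (hT₀ hu)).1
    refine ⟨t.1, hts, u.1, hus, htu, ?_⟩
    have h2 := pow_factorial_card_eq_of_minimal_relation T₀ (fun t => q t.1 t.2)
      (fun t => η t.1 t.2 * ζ t.1) (fun t ht => (hη t.1 t.2).mul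
        (hζ t.1 (Finset.mem_sigma.mp (hT₀ ht)).1)) hz hmin ht hu
    obtain ⟨d, hd⟩ := Nat.factorial_dvd_factorial (Finset.card_le_card hT₀)
    have h3 := congrArg (fun x => x ^ (d * e)) h2
    simp only [← pow_mul] at h3
    rw [show T₀.card.factorial * (d * e) = e * T.card.factorial by rw [hd]; ring, mul_pow,
      mul_pow, pow_mul, pow_mul, pow_mul, pow_mul, he t (hT₀ ht), he u (hT₀ hu)] at h3
    simpa [pow_mul] using h3
  -- If all fibre sums vanished, so would the one over k₀, which is φ(c k₀)·ζ k₀.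
  · exfalso
    have h2 := h k₀
    rw [hfib k₀ hk₀] at h2
    rcases mul_eq_zero.mp h2 with h3 | h3
    · exact hφ (Subtype.ext h3)
    · exact hζ0 k₀ hk₀ h3

end RootsOfUnity

/-! ### Characters and special points -/

section Characters

variable {F : Type u} [Field F] {n : ℕ}

lemma character_zero (x : Fin n → Fˣ) : character 0 x = 1 := by simp [character]

lemma character_add (a b : Fin n → ℤ) (x : Fin n → Fˣ) :
    character (a + b) x = character a x * character b x := by
  simp [character, zpow_add, Finset.prod_mul_distrib]

lemma character_smul (k : ℤ) (a : Fin n → ℤ) (x : Fin n → Fˣ) :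
    character (k • a) x = character a x ^ k := by
  simp [character, zpow_mul', Finset.prod_zpow]

lemma character_neg (a : Fin n → ℤ) (x : Fin n → Fˣ) :
    character (-a) x = (character a x)⁻¹ := by
  simp [character]

lemma character_single (i : Fin n) (x : Fin n → Fˣ) : character (Pi.single i 1) x = x i := by
  rw [character, Finset.prod_eq_single i]
  · simp
  · intro j _ hj
    simp [hj]
  · simp

lemma character_mul (a : Fin n → ℤ) (x y : Fin n → Fˣ) :
    character a (x * y) = character a x * character a y := by
  simp [character, mul_zpow, Finset.prod_mul_distrib]

lemma character_inv (a : Fin n → ℤ) (x : Fin n → Fˣ) :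
    character a x⁻¹ = (character a x)⁻¹ := by
  simp [character]

lemma character_map {E : Type*} [Field E] (φ : F →* E) (a : Fin n → ℤ) (x : Fin n → Fˣ) :
    character a (fun i => Units.map φ (x i)) = Units.map φ (character a x) := by
  simp [character, map_prod]

lemma character_sum {m : ℕ} (b : Fin m → ℤ) (A : Fin m → Fin n → ℤ) (x : Fin n → Fˣ) :
    character (∑ l, b l • A l) x = ∏ l, character (A l) x ^ b l := by
  simp only [character, Finset.sum_apply, Pi.smul_apply, smul_eq_mul, ← Finset.prod_zpow]
  rw [Finset.prod_comm]
  refine Finset.prod_congr rfl fun i _ => ?_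
  have := map_sum (zpowersHom Fˣ (x i)).toAdditiveRight (fun l => b l * A l i) Finset.univ
  change x i ^ (∑ l, b l * A l i) = ∏ l, x i ^ (b l * A l i) at this
  rw [this]
  exact Finset.prod_congr rfl fun l _ => by rw [mul_comm, zpow_mul]

lemma character_torusHom {m : ℕ} (A : Fin m → Fin n → ℤ) (b : Fin m → ℤ)
    (x : Fin n → Fˣ) :
    character b (torusHom F A x) = character (∑ l, b l • A l) x := by
  rw [character_sum]
  rfl

lemma map_mem_special_iff {E : Type u} [Field E] (φ : F →+* E) {m : ℕ} (x : Fin n → Fˣ) :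
    (fun i => Units.map (φ : F →* E) (x i)) ∈ special E n m ↔ x ∈ special F n m := by
  have hinj : Function.Injective (Units.map (φ : F →* E)) := Units.map_injective φ.injective
  refine exists_congr fun Λ => and_congr_right fun _ => forall₂_congr fun a _ => ?_
  rw [character_map, ← (Units.map (φ : F →* E)).map_one, hinj.eq_iff]

lemma torusHom_map {E : Type u} [Field E] (φ : F →+* E) {m : ℕ} (A : Matrix (Fin m) (Fin n) ℤ)
    (x : Fin n → Fˣ) :
    torusHom E A (fun i => Units.map (φ : F →* E) (x i)) =
      fun l => Units.map (φ : F →* E) (torusHom F A x l) :=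
  funext fun l => character_map (φ : F →* E) (A l) x

/-- Characters of `x` with values in the subgroup `G`. -/
def charactersInto (G : Subgroup Fˣ) (x : Fin n → Fˣ) : Submodule ℤ (Fin n → ℤ) :=
  AddSubgroup.toIntSubmodule
    { carrier := {a | character a x ∈ G}
      zero_mem' := by simp [character_zero]
      add_mem' := fun {a b} ha hb => by
        simp only [Set.mem_ofPred_eq, character_add] at ha hb ⊢
        exact G.mul_mem ha hb
      neg_mem' := fun {a} ha => by
        simp only [Set.mem_ofPred_eq, character_neg] at ha ⊢
        exact G.inv_mem ha }

lemma mem_charactersInto {G : Subgroup Fˣ} {x : Fin n → Fˣ} {a : Fin n → ℤ} :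
    a ∈ charactersInto G x ↔ character a x ∈ G := Iff.rfl

end Characters

/-! ### Sublattices of ℤ^n and surjectivity of monomial maps -/

section Lattice

variable {n : ℕ}

/-- The quotient of K by Λ has rank zero, so all its elements are torsion. -/
lemma exists_smul_mem_of_finrank_le {Λ K : Submodule ℤ (Fin n → ℤ)} (hle : Λ ≤ K)
    (h : Module.finrank ℤ K ≤ Module.finrank ℤ Λ) {a : Fin n → ℤ} (ha : a ∈ K) :
    ∃ N : ℤ, N ≠ 0 ∧ N • a ∈ Λ := by
  let Λ' : Submodule ℤ K := Λ.comap K.subtype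
  have h1 : Module.finrank ℤ Λ' = Module.finrank ℤ Λ :=
    LinearEquiv.finrank_eq (Submodule.comapSubtypeEquivOfLe hle)
  have h2 := Submodule.finrank_quotient_add_finrank Λ'
  have h3 : Module.finrank ℤ (K ⧸ Λ') = 0 := by omega
  have h4 : Module.rank ℤ (K ⧸ Λ') = 0 := by
    rw [← Module.finrank_eq_rank, h3, Nat.cast_zero]
  obtain ⟨N, hN, hNa⟩ := rank_eq_zero_iff.mp h4 (Submodule.Quotient.mk ⟨a, ha⟩)
  refine ⟨N, hN, ?_⟩
  rw [← Submodule.Quotient.mk_smul, Submodule.Quotient.mk_eq_zero] at hNa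
  exact hNa

/-- A matrix whose rows form a basis of the kernel of a nonzero linear form on `ℤ^n`. -/
lemma exists_matrix_rows_basis_ker (w : (Fin n → ℤ) →ₗ[ℤ] ℤ) (hw : w ≠ 0) :
    ∃ A : Fin (n - 1) → Fin n → ℤ, LinearIndependent ℤ A ∧
      ∀ a, w a = 0 ↔ ∃ b : Fin (n - 1) → ℤ, a = ∑ l, b l • A l := by
  have h1 := Submodule.finrank_quotient_add_finrank (LinearMap.ker w)
  rw [LinearEquiv.finrank_eq w.quotKerEquivRange] at h1
  have h2 : Module.finrank ℤ (LinearMap.range w) = 1 := by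
    have hne : LinearMap.range w ≠ ⊥ := fun h => hw (LinearMap.range_eq_bot.mp h)
    have hle := Submodule.finrank_le (LinearMap.range w)
    rw [Module.finrank_self] at hle
    refine le_antisymm hle ?_
    refine Nat.one_le_iff_ne_zero.mpr fun h => ?_
    have h0 := (Submodule.finrank_eq_zero (R := ℤ) (M := ℤ) (S := LinearMap.range w)).mp h
    exact hne h0
  have h3 : Module.finrank ℤ (LinearMap.ker w) = n - 1 := by
    rw [h2, Module.finrank_fin_fun] at h1
    omega
  let B : Module.Basis (Fin (n - 1)) ℤ (LinearMap.ker w) := Module.finBasisOfFinrankEq ℤ _ h3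
  have hB := B.linearIndependent.map' (LinearMap.ker w).subtype (Submodule.ker_subtype _)
  refine ⟨fun l => (B l : Fin n → ℤ), hB, ?_⟩
  intro a
  constructor
  · intro ha
    refine ⟨B.repr ⟨a, ha⟩, ?_⟩
    have := congrArg (LinearMap.ker w).subtype (B.sum_repr ⟨a, ha⟩)
    rw [map_sum] at this
    exact this.symm
  · rintro ⟨b, rfl⟩
    rw [map_sum]
    refine Finset.sum_eq_zero fun l _ => ?_
    rw [map_smul, LinearMap.mem_ker.mp (B l).2, smul_zero]

/-- An integer matrix of full row rank has a rational right inverse. Clearing denominators gives A·B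
= N, and applying B to N-th roots of the coordinates of a target point gives a preimage. -/
lemma torusHom_surjective_of_linearIndependent {F : Type u} [Field F] [IsAlgClosed F] {m : ℕ}
    (A : Fin m → Fin n → ℤ) (hA : LinearIndependent ℤ A) :
    Function.Surjective (torusHom F A) := by
  classical
  -- an integral right inverse up to a nonzero integer
  obtain ⟨N, hN, B, hB⟩ : ∃ N : ℕ, N ≠ 0 ∧ ∃ B : Fin n → Fin m → ℤ,
      Matrix.of A * Matrix.of B = Matrix.diagonal fun _ => (N : ℤ) := by
    let AQ : Matrix (Fin m) (Fin n) ℚ := (Matrix.of A).map (Int.cast : ℤ → ℚ)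
    have hAQ : LinearIndependent ℚ AQ.row := by
      have h1 : LinearIndependent ℤ AQ.row :=
        hA.map' ((algebraMap ℤ ℚ).toIntAlgHom.toLinearMap.compLeft (Fin n))
          (LinearMap.ker_eq_bot.mpr fun a b hab => funext fun i => by
            have := congrFun hab i
            simpa using this)
      exact (LinearIndependent.iff_fractionRing ℤ ℚ).mp h1
    have hrank : AQ.rank = m := by simpa using hAQ.rank_matrix
    have hsurj : Function.Surjective AQ.mulVec := by
      have h1 : LinearMap.range AQ.mulVecLin = ⊤ := by
        apply Submodule.eq_top_of_finrank_eq
        rw [Module.finrank_fin_fun]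
        exact hrank
      exact LinearMap.range_eq_top.mp h1
    obtain ⟨BQ, hBQ⟩ := Matrix.mulVec_surjective_iff_exists_right_inverse.mp hsurj
    let N : ℕ := ∏ ij : Fin n × Fin m, (BQ ij.1 ij.2).den
    have hNne : N ≠ 0 := Finset.prod_ne_zero_iff.mpr fun ij _ => (BQ ij.1 ij.2).den_ne_zero
    have hint : ∀ i j, ∃ b : ℤ, (b : ℚ) = N * BQ i j := by
      intro i j
      obtain ⟨d, hd⟩ : (BQ i j).den ∣ N :=
        Finset.dvd_prod_of_mem (fun ij : Fin n × Fin m => (BQ ij.1 ij.2).den) (Finset.mem_univ (i, j))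
      refine ⟨d * (BQ i j).num, ?_⟩
      rw [hd]
      push_cast
      rw [mul_comm ((BQ i j).den : ℚ), mul_assoc, mul_comm ((BQ i j).den : ℚ), Rat.mul_den_eq_num]
    choose b hb using hint
    refine ⟨N, hNne, b, ?_⟩
    ext i j
    have h1 := congrFun (congrFun hBQ i) j
    have h2 : (((Matrix.of A * Matrix.of b) i j : ℤ) : ℚ) = N * (AQ * BQ) i j := by
      simp only [Matrix.mul_apply, Matrix.of_apply, Int.cast_sum, Int.cast_mul, hb, Finset.mul_sum,
        AQ, Matrix.map_apply]
      exact Finset.sum_congr rfl fun k _ => by ring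
    rw [h1] at h2
    have h3 : (N : ℚ) * (1 : Matrix (Fin m) (Fin m) ℚ) i j =
        ((Matrix.diagonal fun _ => (N : ℤ) : Matrix (Fin m) (Fin m) ℤ) i j : ℤ) := by
      by_cases hij : i = j
      · subst hij
        simp
      · simp [hij]
    rw [h3] at h2
    exact_mod_cast h2
  intro y
  have hroot : ∀ l, ∃ u : Fˣ, u ^ N = y l := by
    intro l
    obtain ⟨v, hv⟩ := IsAlgClosed.exists_pow_nat_eq (y l : F) (Nat.pos_of_ne_zero hN)
    have hv0 : v ≠ 0 := by
      rintro rfl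
      rw [zero_pow hN] at hv
      exact (y l).ne_zero hv.symm
    exact ⟨Units.mk0 v hv0, Units.ext (by simpa using hv)⟩
  choose u hu using hroot
  refine ⟨torusHom F B u, funext fun l => ?_⟩
  change character (A l) (torusHom F B u) = y l
  have h1 : ∑ i, A l i • B i = Pi.single l (N : ℤ) := by
    funext j
    have h2 := congrFun (congrFun hB l) j
    rw [Matrix.mul_apply] at h2
    simp only [Finset.sum_apply, Pi.smul_apply, smul_eq_mul]
    refine h2.trans ?_
    rw [Matrix.diagonal_apply, Pi.single_apply]
    exact if_congr eq_comm rfl rfl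
  rw [character_torusHom B (A l) u, h1, ← hu l, show (Pi.single l (N : ℤ) : Fin m → ℤ) =
    (N : ℤ) • Pi.single l (1 : ℤ) by rw [← Pi.single_smul]; simp, character_smul, character_single,
    zpow_natCast]

end Lattice

/-! ### Special points and characters with values in a saturated subgroup -/

section Special

variable {F : Type u} [Field F] {n : ℕ}

/-- If `x` lies in an algebraic subgroup of codimension two of `𝔾_m^3` and has a coordinate outside
`G`, then all characters that map `x` into `G` take torsion values at `x`. -/
lemma isOfFinOrder_character_of_mem_special {G : Subgroup Fˣ}
    (hG : ∀ (u : Fˣ) (k : ℤ), k ≠ 0 → u ^ k ∈ G → u ∈ G) {x : Fin 3 → Fˣ}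
    (hx : x ∈ special F 3 2) {i : Fin 3} (hi : x i ∉ G) {a : Fin 3 → ℤ} (ha : character a x ∈ G) :
    IsOfFinOrder (character a x) := by
  obtain ⟨Λ, hΛ, hxΛ⟩ := hx
  have hle : Λ ≤ charactersInto G x := fun b hb => by
    rw [mem_charactersInto, hxΛ b hb]
    exact G.one_mem
  -- In rank 3 a nonzero multiple of the i-th coordinate character would take its value in G, and
  -- saturation of G would force x i ∈ G. Hence Λ has full rank in the lattice of characters into G.
  have h3 : Module.finrank ℤ (charactersInto G x) ≤ 2 := by
    by_contra hcon
    push Not at hcon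
    obtain ⟨N, hN, hNi⟩ := exists_smul_mem_of_finrank_le
      (Λ := charactersInto G x) (K := ⊤) le_top
      (by rw [finrank_top, Module.finrank_fin_fun]; exact hcon)
      (Submodule.mem_top (x := (Pi.single i 1 : Fin 3 → ℤ)))
    rw [mem_charactersInto, character_smul, character_single] at hNi
    exact hi (hG _ N hN hNi)
  obtain ⟨N, hN, hNa⟩ := exists_smul_mem_of_finrank_le hle (h3.trans hΛ) (mem_charactersInto.mpr ha)
  have h4 := hxΛ _ hNa
  rw [character_smul] at h4
  exact isOfFinOrder_iff_zpow_eq_one.mpr ⟨N, hN, h4⟩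

/-- The characters sending x into G form exactly ker w: one more character with w a ≠ 0 would give
full rank and, by saturation, put x i into G. So the relations Λ lie in ker w and can be rewritten
in the basis A without loss of rank. -/
lemma torusHom_mem_special_of_rows_basis_ker {G : Subgroup Fˣ}
    (hG : ∀ (u : Fˣ) (k : ℤ), k ≠ 0 → u ^ k ∈ G → u ∈ G) {x : Fin n → Fˣ} {m : ℕ}
    (hx : x ∈ special F n m) {i : Fin n} (hi : x i ∉ G) {w : (Fin n → ℤ) →ₗ[ℤ] ℤ}
    (hwG : ∀ a, w a = 0 → character a x ∈ G) {A : Fin (n - 1) → Fin n → ℤ}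
    (hA : LinearIndependent ℤ A)
    (hwA : ∀ a, w a = 0 ↔ ∃ b : Fin (n - 1) → ℤ, a = ∑ l, b l • A l) :
    torusHom F A x ∈ special F (n - 1) m ∧ ∀ l, torusHom F A x l ∈ G := by
  obtain ⟨Λ, hΛ, hxΛ⟩ := hx
  have hle : LinearMap.ker w ≤ charactersInto G x := fun a ha => hwG a ha
  have hw0 : ∀ a, character a x ∈ G → w a = 0 := by
    intro a ha
    by_contra hwa
    -- then the characters into `G` have full rank
    have h2 : ∀ b, w a • b - w b • a ∈ LinearMap.ker w := fun b => by
      rw [LinearMap.mem_ker, map_sub, map_smul, map_smul, smul_eq_mul, smul_eq_mul]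
      ring
    have h3 := (charactersInto G x).add_mem (hle (h2 (Pi.single i 1)))
      ((charactersInto G x).smul_mem (w (Pi.single i 1)) (mem_charactersInto.mpr ha))
    rw [sub_add_cancel, mem_charactersInto, character_smul, character_single] at h3
    exact hi (hG _ _ hwa h3)
  refine ⟨?_, fun l => hwG _ ((hwA (A l)).mpr ⟨Pi.single l 1, ?_⟩)⟩
  · let φ : (Fin (n - 1) → ℤ) →ₗ[ℤ] (Fin n → ℤ) := Fintype.linearCombination ℤ A
    have hφ : ∀ b, φ b = ∑ l, b l • A l := fun b => rfl
    refine ⟨Λ.comap φ, ?_, fun b hb => ?_⟩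
    · have hinj : Function.Injective φ := linearIndependent_iff_injective_fintypeLinearCombination.mp hA
      have hmap : (Λ.comap φ).map φ = Λ := by
        rw [Submodule.map_comap_eq_self]
        intro a ha
        obtain ⟨b, hb⟩ := (hwA a).mp (hw0 a (by rw [hxΛ a ha]; exact G.one_mem))
        exact ⟨b, hb.symm⟩
      rw [← hmap, LinearEquiv.finrank_eq (Submodule.equivMapOfInjective φ hinj _).symm] at hΛ
      exact hΛ
    · rw [character_torusHom]
      exact hxΛ _ hb
  · rw [Finset.sum_eq_single l]
    · simp
    · intro k _ hk
      simp [hk]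
    · simp

lemma mem_unitsOf_iff {O : Subring F} {w : Fˣ} :
    w ∈ unitsOf O ↔ (w : F) ∈ O ∧ ((w⁻¹ : Fˣ) : F) ∈ O := by
  constructor
  · rintro ⟨y, rfl⟩
    exact ⟨y.1.2, (y⁻¹).1.2⟩
  · rintro ⟨h1, h2⟩
    exact ⟨⟨⟨_, h1⟩, ⟨_, h2⟩, Subtype.ext (w.mul_inv), Subtype.ext (w.inv_mul)⟩, Units.ext rfl⟩

lemma zpow_mem_unitsOf {O : Subring F} (hO : ∀ y : F, ∀ k : ℕ, 0 < k → y ^ k ∈ O → y ∈ O)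
    (v : Fˣ) (k : ℤ) (hk : k ≠ 0) (h : v ^ k ∈ unitsOf O) : v ∈ unitsOf O := by
  wlog hpos : 0 < k generalizing v k
  · have := this v (-k) (neg_ne_zero.mpr hk) (by rw [zpow_neg]; exact inv_mem h) (by omega)
    exact this
  lift k to ℕ using hpos.le
  rw [zpow_natCast, mem_unitsOf_iff] at h
  rw [mem_unitsOf_iff]
  have hk' : 0 < k := by exact_mod_cast hpos
  refine ⟨hO _ k hk' (by simpa using h.1), hO _ k hk' ?_⟩
  rw [← Units.val_pow_eq_pow_val, inv_pow]
  exact h.2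

end Special

/-! ### Algebras of transcendence degree at most one -/

section TranscendenceDegree

open Polynomial Algebra

/-- Iterated polynomials, with a in the outer and b in the inner variable, allow a descent on the
outer degree and give the exponents as pairs. -/
lemma exists_bivariate_relation {R A : Type*} [CommRing R] [Nontrivial R] [CommRing A] [Algebra R A]
    (h : Algebra.trdeg R A ≤ 1) (a b : A) :
    ∃ Q : R[X][X], Q ≠ 0 ∧ Q.eval₂ (aeval b : R[X] →ₐ[R] A).toRingHom a = 0 := by
  have hdep : ¬ AlgebraicIndependent R ![a, b] := by
    intro hind
    have h1 := hind.lift_cardinalMk_le_trdeg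
    have h2 := (Cardinal.lift_le.{0}.mpr h)
    simp only [Cardinal.mk_fintype, Fintype.card_fin, Cardinal.lift_natCast] at h1
    have h3 : ((2 : ℕ) : Cardinal) ≤ 1 := h1.trans (by simpa using h)
    norm_cast at h3
  rw [algebraicIndependent_iff] at hdep
  push Not at hdep
  obtain ⟨P, hP0, hP⟩ := hdep
  let φ : MvPolynomial (Fin 2) R →ₐ[R] R[X][X] := MvPolynomial.aeval ![X, C X]
  let ψ : R[X][X] →+* MvPolynomial (Fin 2) R :=
    eval₂RingHom (aeval (MvPolynomial.X 1) : R[X] →ₐ[R] _).toRingHom (MvPolynomial.X 0)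
  have hψφ : ∀ P, ψ (φ P) = P := by
    intro P
    have : (ψ.comp φ.toRingHom) = RingHom.id _ := by
      refine MvPolynomial.ringHom_ext (fun r => ?_) fun i => ?_
      · simp [φ, ψ, MvPolynomial.algebraMap_eq, Polynomial.algebraMap_apply]
      · fin_cases i <;> simp [φ, ψ]
    exact RingHom.congr_fun this P
  refine ⟨φ P, fun h0 => hP (by rw [← hψφ P, h0, map_zero]), ?_⟩
  rw [← hP0]
  have : (eval₂RingHom (aeval b : R[X] →ₐ[R] A).toRingHom a).comp φ.toRingHom =
      (MvPolynomial.aeval ![a, b] : MvPolynomial (Fin 2) R →ₐ[R] A).toRingHom := by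
    refine MvPolynomial.ringHom_ext (fun r => ?_) fun i => ?_
    · simp [φ, Polynomial.algebraMap_apply]
    · fin_cases i <;> simp [φ]
  exact RingHom.congr_fun this P

/-- In an algebra of transcendence degree at most one, every element is algebraic modulo any
nonzero element. -/
lemma exists_dvd_aeval {R A : Type*} [CommRing R] [Nontrivial R] [CommRing A] [IsDomain A]
    [Algebra R A] (hA : Algebra.trdeg R A ≤ 1) {h : A} (h0 : h ≠ 0) (x : A) :
    ∃ q : R[X], q ≠ 0 ∧ h ∣ aeval x q := by
  classical
  -- Take a relation Q(h, x) = 0 of least degree in h. Its constant term Q(0, x) is divisible by h,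
  -- and Q(0, ·) is nonzero: otherwise a factor h ≠ 0 could be cancelled, lowering the degree.
  have hex : ∃ d, ∃ Q : R[X][X], Q ≠ 0 ∧
      Q.eval₂ (aeval x : R[X] →ₐ[R] A).toRingHom h = 0 ∧ Q.natDegree = d := by
    obtain ⟨Q, hQ, hQ0⟩ := exists_bivariate_relation hA h x
    exact ⟨_, Q, hQ, hQ0, rfl⟩
  obtain ⟨Q, hQ, hQ0, hd⟩ := Nat.find_spec hex
  have heval : Q.divX.eval₂ (aeval x : R[X] →ₐ[R] A).toRingHom h * h + aeval x (Q.coeff 0) = 0 := by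
    have h1 := hQ0
    rw [← divX_mul_X_add Q, eval₂_add, eval₂_mul, eval₂_X, eval₂_C] at h1
    exact h1
  refine ⟨Q.coeff 0, fun hc => ?_, ?_⟩
  · rw [hc, map_zero, add_zero] at heval
    have h2 := (mul_eq_zero.mp heval).resolve_right h0
    have hdiv : Q.divX * X = Q := by
      have := divX_mul_X_add Q
      rwa [hc, C_0, add_zero] at this
    have hne : Q.divX ≠ 0 := fun h3 => hQ (by rw [← hdiv, h3, zero_mul])
    have hlt : Q.divX.natDegree < Nat.find hex := by
      rw [← hd, natDegree_divX_eq_natDegree_tsub_one]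
      have : Q.natDegree ≠ 0 := by
        rw [← hdiv, natDegree_mul_X hne]
        omega
      omega
    exact Nat.find_min hex hlt ⟨Q.divX, hne, h2, rfl⟩
  · exact ⟨-Q.divX.eval₂ (aeval x : R[X] →ₐ[R] A).toRingHom h, by linear_combination heval⟩

/-- Each of the finitely many generators x satisfies h ∣ q_x(x) with q_x ≠ 0, so φ h = 0 makes φ x a
root of q_x and leaves finitely many choices. -/
lemma finite_setOf_algHom_eq_zero {R A Ω : Type*} [CommRing R] [IsDomain R] [CommRing A]
    [IsDomain A] [Algebra R A] [Algebra.FiniteType R A] [CommRing Ω] [IsDomain Ω] [Algebra R Ω]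
    [FaithfulSMul R Ω] (hA : Algebra.trdeg R A ≤ 1) {h : A} (h0 : h ≠ 0) :
    {φ : A →ₐ[R] Ω | φ h = 0}.Finite := by
  classical
  obtain ⟨s, hs⟩ := Algebra.FiniteType.out (R := R) (A := A)
  choose q hq hdvd using fun x => exists_dvd_aeval hA h0 x
  have hinj : Function.Injective (fun φ : A →ₐ[R] Ω => fun x : s => φ x) := by
    intro φ ψ hφψ
    refine AlgHom.ext_of_adjoin_eq_top hs fun x hx => congrFun hφψ ⟨x, hx⟩
  refine Set.Finite.of_finite_image (f := fun φ : A →ₐ[R] Ω => fun x : s => φ x) ?_ hinj.injOn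
  refine Set.Finite.subset
    (Set.Finite.pi' (t := fun x : s => ((q x).rootSet Ω : Set Ω))
      fun x => (q x).rootSet_finite Ω) ?_
  rintro _ ⟨φ, hφ, rfl⟩ x
  refine mem_rootSet.mpr ⟨hq x, ?_⟩
  obtain ⟨c, hc⟩ := hdvd (x : A)
  rw [aeval_algHom_apply, hc, map_mul]
  rw [Set.mem_ofPred_eq] at hφ
  rw [hφ, zero_mul]

/-- A noetherian integrally closed local domain of transcendence degree at most one over a ring
whose nonzero elements become units is a valuation ring. -/
lemma valuationRing_of_trdeg_le_one {R A : Type*} [CommRing R] [Nontrivial R] [CommRing A]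
    [IsDomain A] [IsLocalRing A] [IsNoetherianRing A] [IsIntegrallyClosed A] [Algebra R A]
    (hA : Algebra.trdeg R A ≤ 1) (hR : ∀ r : R, r ≠ 0 → IsUnit (algebraMap R A r)) :
    ValuationRing A := by
  suffices h : ∀ P : Ideal A, P ≠ ⊥ → P.IsPrime → P = IsLocalRing.maximalIdeal A by
    have h1 := (tfae_of_isNoetherianRing_of_isLocalRing_of_isDomain A).out 3 1
    exact h1.mp ⟨inferInstance, h⟩
  intro P hP hPp
  obtain ⟨t, htP, ht0⟩ := Submodule.exists_mem_ne_zero_of_ne_bot hP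
  refine le_antisymm (IsLocalRing.le_maximalIdeal hPp.ne_top) fun s hs => ?_
  -- Write q = X ^ k · q' with q'(0) ≠ 0. Then q'(s) is a unit, being a unit constant plus an
  -- element of the maximal ideal, so s ^ k ∈ P.
  obtain ⟨q, hq0, hq⟩ := exists_dvd_aeval hA ht0 s
  have hqP : aeval s q ∈ P := P.mem_of_dvd hq htP
  -- split off the largest power of `X`
  obtain ⟨k, q', hq', hc⟩ : ∃ k, ∃ q' : R[X], q = X ^ k * q' ∧ q'.coeff 0 ≠ 0 := by
    obtain ⟨q', hq', hX⟩ := exists_eq_pow_rootMultiplicity_mul_and_not_dvd q hq0 0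
    rw [C_0, sub_zero] at hq' hX
    exact ⟨_, q', hq', fun h => hX (X_dvd_iff.mpr h)⟩
  rw [hq', map_mul, map_pow, aeval_X] at hqP
  refine hPp.mem_of_pow_mem k ((hPp.mem_or_mem hqP).resolve_right fun h => hPp.ne_top ?_)
  refine P.eq_top_of_isUnit_mem h ?_
  rw [← divX_mul_X_add q', map_add, map_mul, aeval_X, aeval_C]
  by_contra hcon
  have h1 : algebraMap R A (q'.coeff 0) ∈ IsLocalRing.maximalIdeal A := by
    have h2 := (IsLocalRing.maximalIdeal A).sub_mem ((IsLocalRing.mem_maximalIdeal _).mpr hcon)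
      ((IsLocalRing.maximalIdeal A).mul_mem_left (aeval s q'.divX) hs)
    rwa [add_sub_cancel_left] at h2
  exact (IsLocalRing.mem_maximalIdeal _).mp h1 (hR _ hc)

/-- A finitely generated domain over a field of Krull dimension at most one has transcendence degree
at most one. -/
lemma trdeg_le_one_of_krullDimLE_one {F A : Type u} [Field F] [CommRing A] [IsDomain A] [Algebra F A]
    [Algebra.FiniteType F A] (h : Ring.KrullDimLE 1 A) : Algebra.trdeg F A ≤ 1 := by
  classical
  obtain ⟨s, g, hg, hint⟩ := exists_integral_inj_algHom_of_fg F A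
  -- With two variables in the Noether normalisation, the prime (X_i) would lie under a nonzero,
  -- hence maximal, prime of A. It would then be maximal itself, but X_j is not invertible modulo
  -- it.
  have hs : s ≤ 1 := by
    by_contra hcon
    push Not at hcon
    let i : Fin s := ⟨0, by omega⟩
    let j : Fin s := ⟨1, hcon⟩
    let _ : Algebra (MvPolynomial (Fin s) F) A := g.toRingHom.toAlgebra
    have hint' : Algebra.IsIntegral (MvPolynomial (Fin s) F) A := ⟨hint⟩
    let p : Ideal (MvPolynomial (Fin s) F) := Ideal.span {MvPolynomial.X i}
    have hp : p.IsPrime := by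
      rw [Ideal.span_singleton_prime (MvPolynomial.X_ne_zero i)]
      exact MvPolynomial.X_prime
    obtain ⟨P, -, hPp, hP⟩ := Ideal.exists_ideal_over_prime_of_isIntegral (S := A) p ⊥ (by
      intro x hx
      rw [Ideal.mem_comap, Ideal.mem_bot] at hx
      rw [(injective_iff_map_eq_zero g.toRingHom).mp hg x hx]
      exact p.zero_mem)
    have hPne : P ≠ ⊥ := by
      rintro rfl
      have h1 : MvPolynomial.X i ∈ p := Ideal.mem_span_singleton_self _
      rw [← hP, Ideal.mem_comap, Ideal.mem_bot] at h1
      exact MvPolynomial.X_ne_zero i ((injective_iff_map_eq_zero g.toRingHom).mp hg _ h1)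
    have hPmax : P.IsMaximal := Ideal.IsPrime.isMaximal_of_ne_bot hPp hPne
    have hpmax : p.IsMaximal := hP ▸ Ideal.isMaximal_comap_of_isIntegral_of_isMaximal P
    let φ : MvPolynomial (Fin s) F →ₐ[F] F[X] := MvPolynomial.aeval fun k => if k = i then 0 else X
    have hφp : ∀ x ∈ p, φ x = 0 := by
      intro x hx
      obtain ⟨c, rfl⟩ := Ideal.mem_span_singleton.mp hx
      simp [φ]
    have hφj : φ (MvPolynomial.X j) = X := by
      simp [φ, i, j]
    obtain ⟨y, z, hz, hyz⟩ := hpmax.exists_inv (x := MvPolynomial.X j) fun hj =>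
      X_ne_zero (hφj.symm.trans (hφp _ hj))
    have h1 := congrArg φ hyz
    rw [map_add, map_mul, hφp z hz, hφj, add_zero, map_one] at h1
    exact not_isUnit_X (IsUnit.of_mul_eq_one_right _ h1)
  let _ : Algebra (MvPolynomial (Fin s) F) A := g.toRingHom.toAlgebra
  have hint' : Algebra.IsIntegral (MvPolynomial (Fin s) F) A := ⟨hint⟩
  have : IsScalarTower F (MvPolynomial (Fin s) F) A := IsScalarTower.of_algebraMap_eq
    fun r => (g.commutes r).symm
  have : FaithfulSMul (MvPolynomial (Fin s) F) A :=
    (faithfulSMul_iff_algebraMap_injective _ _).mpr hg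
  rw [← trdeg_add_eq F (MvPolynomial (Fin s) F) (A := A), MvPolynomial.trdeg_of_isDomain,
    trdeg_eq_zero, add_zero]
  simpa using hs

lemma trdeg_le_one_of_injective {R A B : Type u} [CommRing R] [CommRing A] [CommRing B]
    [Algebra R A] [Algebra R B] (f : A →+* B)
    (hfR : ∀ r, f (algebraMap R A r) = algebraMap R B r) (hf : Function.Injective f)
    (h : Algebra.trdeg R B ≤ 1) : Algebra.trdeg R A ≤ 1 :=
  (trdeg_le_of_injective { f with commutes' := hfR } hf).trans h

lemma trdeg_le_one_of_isAlgebraic {R A B : Type u} [CommRing R] [Nontrivial R] [CommRing A]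
    [CommRing B] [NoZeroDivisors B] [Algebra R A] [Algebra R B] [Algebra A B] [IsScalarTower R A B]
    [FaithfulSMul A B] [Algebra.IsAlgebraic A B] (h : Algebra.trdeg R A ≤ 1) :
    Algebra.trdeg R B ≤ 1 := by
  by_cases hR : Function.Injective (algebraMap R A)
  · have : FaithfulSMul R A := (faithfulSMul_iff_algebraMap_injective _ _).mpr hR
    rwa [← trdeg_add_eq R A (A := B), trdeg_eq_zero (R := A) (A := B), add_zero]
  · rw [trdeg_eq_zero_of_not_injective]
    · exact zero_le_one
    · intro hB
      rw [IsScalarTower.algebraMap_eq R A B] at hB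
      exact hR (Function.Injective.of_comp hB)

lemma trdeg_le_one_of_fractionRing_base {R F B : Type u} [CommRing R] [IsDomain R] [Field F]
    [CommRing B] [NoZeroDivisors B] [Nontrivial B] [Algebra R F] [IsFractionRing R F] [Algebra R B]
    [Algebra F B] [IsScalarTower R F B] (h : Algebra.trdeg F B ≤ 1) : Algebra.trdeg R B ≤ 1 := by
  have : FaithfulSMul R F := (faithfulSMul_iff_algebraMap_injective _ _).mpr
    (IsFractionRing.injective R F)
  have : Algebra.IsAlgebraic R F := IsLocalization.isAlgebraic F (nonZeroDivisors R)
  rwa [← trdeg_add_eq R F (A := B), trdeg_eq_zero (R := R) (A := F), zero_add]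

end TranscendenceDegree

/-! ### Local algebra -/

section LocalAlgebra

open IsLocalRing

/-- A rational function on the spectrum of a noetherian normal local domain that is regular off the
closed point is regular, unless the maximal ideal has height one. -/
lemma mem_range_algebraMap_of_forall_mul_mem {A M : Type*} [CommRing A] [IsDomain A] [IsLocalRing A]
    [IsNoetherianRing A] [IsIntegrallyClosed A] [Field M] [Algebra A M] [IsFractionRing A M]
    {P : Ideal A} (hP : P.IsPrime) (hP0 : P ≠ ⊥) (hPm : P ≠ maximalIdeal A) (h : M)
    (hreg : ∀ q : Ideal A, q.IsPrime → q ≠ maximalIdeal A →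
      ∃ s ∉ q, algebraMap A M s * h ∈ (algebraMap A M).range) :
    h ∈ (algebraMap A M).range := by
  classical
  -- the ideal of denominators
  let I : Ideal A :=
    { carrier := {s | algebraMap A M s * h ∈ (algebraMap A M).range}
      zero_mem' := by simp
      add_mem' := fun {a b} ha hb => by
        simp only [Set.mem_ofPred_eq, map_add, add_mul] at ha hb ⊢
        exact add_mem ha hb
      smul_mem' := fun c {a} ha => by
        simp only [Set.mem_ofPred_eq, smul_eq_mul, map_mul, mul_assoc] at ha ⊢
        exact mul_mem ⟨c, rfl⟩ ha }
  have hI : ∀ s, s ∈ I ↔ algebraMap A M s * h ∈ (algebraMap A M).range := fun s => Iff.rfl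
  by_contra hh
  have hItop : I ≠ ⊤ := fun ht => hh (by
    have h1 : (1 : A) ∈ I := ht ▸ Submodule.mem_top
    rwa [hI, map_one, one_mul] at h1)
  -- No prime other than the maximal ideal contains the denominators, so I contains a power of the
  -- maximal ideal.
  have hrad : maximalIdeal A ≤ I.radical := by
    rw [Ideal.radical_eq_sInf]
    refine le_sInf fun q hq => ?_
    by_cases hqm : q = maximalIdeal A
    · exact hqm.ge
    · obtain ⟨s, hs, hs'⟩ := hreg q hq.2 hqm
      exact absurd (hq.1 ((hI s).mpr hs')) hs
  have hex : ∃ k, maximalIdeal A ^ k ≤ I := Ideal.exists_pow_le_of_le_radical_of_fg hrad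
    (IsNoetherian.noetherian _)
  have hk0 : Nat.find hex ≠ 0 := fun h0 => hItop (top_le_iff.mp (by
    have := Nat.find_spec hex
    rwa [h0, pow_zero, Ideal.one_eq_top] at this))
  obtain ⟨k, hk⟩ := Nat.exists_eq_succ_of_ne_zero hk0
  obtain ⟨y, hy, hyI⟩ := Set.not_subset.mp (Nat.find_min hex (m := k) (by omega))
  have hspec : maximalIdeal A ^ (k + 1) ≤ I := by
    have := Nat.find_spec hex
    rwa [hk] at this
  -- By minimality of the exponent, g is not regular although the maximal ideal multiplies it into
  -- A. Either g preserves the maximal ideal, or it takes some t to a unit.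
  let g : M := algebraMap A M y * h
  have hg : g ∉ (algebraMap A M).range := fun hgr => hyI ((hI y).mpr hgr)
  have hmg : ∀ a ∈ maximalIdeal A, ∃ b : A, algebraMap A M b = algebraMap A M a * g := by
    intro a ha
    have h1 : y * a ∈ I := hspec (by rw [pow_succ]; exact Ideal.mul_mem_mul hy ha)
    rw [hI, map_mul] at h1
    obtain ⟨b, hb⟩ := h1
    exact ⟨b, by rw [hb]; ring⟩
  by_cases hcase : ∀ a ∈ maximalIdeal A, ∃ b ∈ maximalIdeal A,
      algebraMap A M b = algebraMap A M a * g
  · -- `g` is integral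
    let N : Submodule A M := Submodule.map (Algebra.linearMap A M) (maximalIdeal A)
    have hN : N.FG := (IsNoetherian.noetherian (maximalIdeal A)).map _
    have hN0 : N ≠ ⊥ := by
      intro hN0
      obtain ⟨a, haP, ha0⟩ := Submodule.exists_mem_ne_zero_of_ne_bot hP0
      have h1 : algebraMap A M a ∈ N := ⟨a, le_maximalIdeal hP.ne_top haP, rfl⟩
      rw [hN0, Submodule.mem_bot] at h1
      exact ha0 ((injective_iff_map_eq_zero _).mp (IsFractionRing.injective A M) a h1)
    have hint : IsIntegral A g := by
      refine isIntegral_of_smul_mem_submodule N hN0 hN g ?_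
      rintro _ ⟨a, ha, rfl⟩
      obtain ⟨b, hb, hb'⟩ := hcase a ha
      exact ⟨b, hb, by simpa [mul_comm] using hb'⟩
    obtain ⟨b, hb⟩ := IsIntegrallyClosed.isIntegral_iff.mp hint
    exact hg ⟨b, hb⟩
  · -- the maximal ideal is principal
    push Not at hcase
    obtain ⟨t, ht, htb⟩ := hcase
    obtain ⟨b, hb⟩ := hmg t ht
    have hbu : IsUnit b := by
      by_contra hbu
      exact htb b ((mem_maximalIdeal b).mpr hbu) hb
    have ht0 : t ≠ 0 := by
      rintro rfl
      rw [map_zero, zero_mul] at hb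
      exact htb 0 (Ideal.zero_mem _) (by simp)
    have hprin : ∀ a ∈ maximalIdeal A, t ∣ a := by
      intro a ha
      obtain ⟨c, hc⟩ := hmg a ha
      obtain ⟨u, rfl⟩ := hbu
      refine ⟨c * (u⁻¹ : Aˣ), IsFractionRing.injective A M ?_⟩
      have ht0' : algebraMap A M t ≠ 0 := fun h0 =>
        ht0 ((injective_iff_map_eq_zero _).mp (IsFractionRing.injective A M) t h0)
      have hu : algebraMap A M (u : A) * algebraMap A M ((u⁻¹ : Aˣ) : A) = 1 := by
        rw [← map_mul, Units.mul_inv, map_one]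
      rw [map_mul, map_mul, hc]
      linear_combination -(algebraMap A M a) * hu +
        algebraMap A M a * algebraMap A M ((u⁻¹ : Aˣ) : A) * hb
    have htP : t ∉ P := fun htP => hPm (le_antisymm (le_maximalIdeal hP.ne_top) fun a ha =>
      P.mem_of_dvd (hprin a ha) htP)
    -- Nakayama: t generates the maximal ideal and lies outside P, so P = tP and P = 0.
    have hPle : P ≤ Ideal.span {t} • P := by
      intro a ha
      obtain ⟨c, rfl⟩ := hprin a (le_maximalIdeal hP.ne_top ha)
      exact Ideal.mul_mem_mul (Ideal.mem_span_singleton_self t)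
        ((hP.mem_or_mem ha).resolve_left htP)
    refine hP0 (Submodule.eq_bot_of_le_smul_of_le_jacobson_bot _ P
      (IsNoetherian.noetherian P) hPle ?_)
    rw [jacobson_eq_maximalIdeal ⊥ bot_ne_top, Ideal.span_singleton_le_iff_mem]
    exact ht

/-- In a noetherian local ring whose maximal ideal is principal, every prime ideal is
either zero or maximal. -/
lemma prime_eq_bot_or_eq_maximalIdeal {B : Type*} [CommRing B] [IsLocalRing B] [IsNoetherianRing B]
    {t : B} (hm : maximalIdeal B = Ideal.span {t})
    (q : Ideal B) (hq : q.IsPrime) : q = ⊥ ∨ q = maximalIdeal B := by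
  rw [or_iff_not_imp_right]
  intro hqm
  have htq : t ∉ q := fun h => hqm (le_antisymm (le_maximalIdeal hq.ne_top) (by
    rw [hm, Ideal.span_singleton_le_iff_mem]
    exact h))
  have hle : q ≤ Ideal.span {t} • q := by
    intro a ha
    have h1 := le_maximalIdeal hq.ne_top ha
    rw [hm] at h1
    obtain ⟨c, rfl⟩ := Ideal.mem_span_singleton.mp h1
    exact Ideal.mul_mem_mul (Ideal.mem_span_singleton_self t) ((hq.mem_or_mem ha).resolve_left htq)
  refine Submodule.eq_bot_of_le_smul_of_le_jacobson_bot _ q (IsNoetherian.noetherian q) hle ?_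
  rw [jacobson_eq_maximalIdeal ⊥ bot_ne_top, hm]

end LocalAlgebra

/-! ### Newton polygons: cancelling terms and differences of exponents -/

section Tropical

/-- Ultrametric inequality: if the maximal valuation were attained only once, the sum would have
that valuation and could not vanish. -/
lemma exists_valuation_eq_of_sum_eq_zero {Ω Γ : Type*} [Field Ω] [LinearOrderedCommGroupWithZero Γ]
    (v : Valuation Ω Γ) {ι : Type*} (s : Finset ι) (hs : s.Nonempty) (x : ι → Ω)
    (hx : ∀ t ∈ s, x t ≠ 0) (h0 : ∑ t ∈ s, x t = 0) :
    ∃ t ∈ s, ∃ r ∈ s, t ≠ r ∧ v (x t) = v (x r) := by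
  classical
  obtain ⟨t, ht, hmax⟩ := s.exists_max_image (fun t => v (x t)) hs
  by_contra hcon
  push Not at hcon
  have hlt : v (∑ r ∈ s.erase t, x r) < v (x t) := by
    refine v.map_sum_lt ((v.ne_zero_iff).mpr (hx t ht)) fun r hr => ?_
    rw [Finset.mem_erase] at hr
    exact lt_of_le_of_ne (hmax r hr.2) (hcon r hr.2 t ht hr.1)
  rw [← Finset.add_sum_erase s x ht] at h0
  rw [eq_neg_of_add_eq_zero_right h0, Valuation.map_neg] at hlt
  exact lt_irrefl _ hlt

open Polynomial

variable {R : Type*} [CommRing R]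

/-- The exponents of the monomials of a polynomial in two variables. -/
def exponents (Q : R[X][X]) : Finset (ℕ × ℕ) := by
  classical
  exact {t ∈ Q.support ×ˢ Q.support.biUnion fun i => (Q.coeff i).support |
    (Q.coeff t.1).coeff t.2 ≠ 0}

lemma mem_exponents {Q : R[X][X]} {t : ℕ × ℕ} : t ∈ exponents Q ↔ (Q.coeff t.1).coeff t.2 ≠ 0 := by
  classical
  simp only [exponents, Finset.mem_filter, Finset.mem_product, and_iff_right_iff_imp]
  intro h
  have h1 : t.1 ∈ Q.support := mem_support_iff.mpr fun h0 => h (by rw [h0, coeff_zero])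
  exact ⟨h1, Finset.mem_biUnion.mpr ⟨t.1, h1, mem_support_iff.mpr h⟩⟩

lemma exponents_nonempty {Q : R[X][X]} (hQ : Q ≠ 0) : (exponents Q).Nonempty := by
  obtain ⟨i, hi⟩ := Polynomial.support_nonempty.mpr hQ
  obtain ⟨j, hj⟩ := Polynomial.support_nonempty.mpr (mem_support_iff.mp hi)
  exact ⟨(i, j), mem_exponents.mpr (mem_support_iff.mp hj)⟩

lemma eval₂_aeval_eq_sum_exponents {A : Type*} [CommRing A] [Algebra R A] (Q : R[X][X]) (x y : A) :
    Q.eval₂ (aeval y : R[X] →ₐ[R] A).toRingHom x =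
      ∑ t ∈ exponents Q, algebraMap R A ((Q.coeff t.1).coeff t.2) * (x ^ t.1 * y ^ t.2) := by
  classical
  rw [exponents, Finset.sum_filter_of_ne, Finset.sum_product, eval₂_eq_sum, sum_def]
  · refine Finset.sum_congr rfl fun i hi => ?_
    change aeval y (Q.coeff i) * x ^ i = _
    rw [aeval_eq_sum_range' (n := ((Q.support.biUnion fun i => (Q.coeff i).support).sup id) + 1),
      Finset.sum_mul]
    · symm
      refine Finset.sum_subset_zero_on_sdiff (fun j hj => ?_) (fun j hj => ?_) fun j hj => ?_
      · exact Finset.mem_range.mpr (Nat.lt_succ_of_le (Finset.le_sup (f := id) hj))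
      · have h1 : (Q.coeff i).coeff j = 0 := by
          by_contra h0
          exact (Finset.mem_sdiff.mp hj).2
            (Finset.mem_biUnion.mpr ⟨i, hi, mem_support_iff.mpr h0⟩)
        rw [h1, zero_smul, zero_mul]
      · rw [Algebra.smul_def]
        ring
    · refine Nat.lt_succ_of_le ?_
      by_cases h0 : Q.coeff i = 0
      · simp [h0]
      · exact Finset.le_sup (f := id) (Finset.mem_biUnion.mpr ⟨i, hi, natDegree_mem_support_of_nonzero h0⟩)
  · intro t _ ht h0
    rw [h0, map_zero, zero_mul] at ht
    exact ht rfl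

/-- The nonzero differences of exponents of a polynomial in two variables. -/
def exponentDifferences (Q : R[X][X]) : Finset (ℤ × ℤ) := by
  classical
  exact ((exponents Q ×ˢ exponents Q).image
    fun tr => ((tr.1.1 : ℤ) - tr.2.1, (tr.1.2 : ℤ) - tr.2.2)).erase 0

lemma mem_exponentDifferences {Q : R[X][X]} {t r : ℕ × ℕ} (ht : t ∈ exponents Q)
    (hr : r ∈ exponents Q) (htr : t ≠ r) :
    ((t.1 : ℤ) - r.1, (t.2 : ℤ) - r.2) ∈ exponentDifferences Q := by
  classical
  refine Finset.mem_erase.mpr ⟨fun h => htr ?_, Finset.mem_image.mpr ⟨(t, r), by simp [ht, hr], rfl⟩⟩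
  simp only [Prod.mk_eq_zero, sub_eq_zero, Nat.cast_inj] at h
  exact Prod.ext h.1 h.2

lemma ne_zero_of_mem_exponentDifferences {Q : R[X][X]} {e : ℤ × ℤ}
    (he : e ∈ exponentDifferences Q) : e ≠ 0 := by
  classical
  exact (Finset.mem_erase.mp he).1

variable {Ω : Type*} [Field Ω] [Algebra R Ω]

/-- A point of a plane curve all of whose nonzero coefficients are units of a valuation ring:
its valuation vector is orthogonal to some difference of exponents. -/
lemma exists_exponentDifference_mem_valuationSubring (V : ValuationSubring Ω) {Q : R[X][X]}
    (hQ : Q ≠ 0)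
    (hV : ∀ t ∈ exponents Q, V.valuation (algebraMap R Ω ((Q.coeff t.1).coeff t.2)) = 1)
    (x y : Ωˣ) (h0 : Q.eval₂ (aeval (y : Ω) : R[X] →ₐ[R] Ω).toRingHom (x : Ω) = 0) :
    ∃ e ∈ exponentDifferences Q, V.valuation ((x ^ e.1 * y ^ e.2 : Ωˣ) : Ω) = 1 := by
  rw [eval₂_aeval_eq_sum_exponents] at h0
  have hxy : ∀ t : ℕ × ℕ, (x : Ω) ^ t.1 * (y : Ω) ^ t.2 = ((x ^ t.1 * y ^ t.2 : Ωˣ) : Ω) :=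
    fun t => by simp
  obtain ⟨t, ht, r, hr, htr, hv⟩ := exists_valuation_eq_of_sum_eq_zero V.valuation (exponents Q)
    (exponents_nonempty hQ) _ (fun t ht => by
      refine mul_ne_zero (fun h => ?_) (by rw [hxy]; exact Units.ne_zero _)
      have := hV t ht
      rw [h, map_zero] at this
      exact zero_ne_one this) h0
  refine ⟨_, mem_exponentDifferences ht hr htr, ?_⟩
  rw [map_mul V.valuation (algebraMap R Ω _), map_mul V.valuation (algebraMap R Ω _), hV t ht,
    hV r hr, one_mul, one_mul, hxy, hxy] at hv
  have h1 : (x ^ ((t.1 : ℤ) - r.1) * y ^ ((t.2 : ℤ) - r.2) : Ωˣ) =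
      (x ^ t.1 * y ^ t.2) * (x ^ r.1 * y ^ r.2)⁻¹ := by
    rw [zpow_sub, zpow_sub, zpow_natCast, zpow_natCast, zpow_natCast, zpow_natCast, mul_inv]
    exact mul_mul_mul_comm _ _ _ _
  rw [h1, Units.val_mul, map_mul, hv, Units.val_inv_eq_inv_val, map_inv₀]
  exact mul_inv_cancel₀ ((_root_.map_ne_zero _).mpr (Units.ne_zero _))

/-- The torsion points on a plane curve in `𝔾_m^2` lie in finitely many proper subgroups. -/
theorem exists_exponentDifference_zpow_eq_one [CharZero Ω] [IsAlgClosed Ω]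
    (hR : Function.Injective (algebraMap R Ω)) {Q : R[X][X]} (hQ : Q ≠ 0) :
    ∃ B : ℕ, 0 < B ∧ ∀ x y : Ωˣ, IsOfFinOrder x → IsOfFinOrder y →
      Q.eval₂ (aeval (y : Ω) : R[X] →ₐ[R] Ω).toRingHom (x : Ω) = 0 →
      ∃ e ∈ exponentDifferences Q, (x ^ e.1 * y ^ e.2) ^ B = 1 := by
  obtain ⟨t₀, ht₀⟩ := exponents_nonempty hQ
  obtain ⟨B, hB, h⟩ := exists_pow_eq_of_sum_mul_eq_zero (exponents Q)
    (fun t => algebraMap R Ω ((Q.coeff t.1).coeff t.2)) ht₀ (fun h0 => mem_exponents.mp ht₀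
      ((injective_iff_map_eq_zero _).mp hR _ h0))
  refine ⟨B, hB, fun x y hx hy h0 => ?_⟩
  rw [eval₂_aeval_eq_sum_exponents] at h0
  have hxy : ∀ t : ℕ × ℕ, (x : Ω) ^ t.1 * (y : Ω) ^ t.2 = ((x ^ t.1 * y ^ t.2 : Ωˣ) : Ω) :=
    fun t => by simp
  obtain ⟨t, ht, r, hr, htr, hv⟩ := h (fun t => (x : Ω) ^ t.1 * (y : Ω) ^ t.2) (fun t _ => by
    have h1 := ((hx.pow (n := t.1)).mul (hy.pow (n := t.2)))
    have h2 := (Units.coeHom Ω).isOfFinOrder h1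
    simpa using h2) h0
  refine ⟨_, mem_exponentDifferences ht hr htr, ?_⟩
  have h1 : (x ^ ((t.1 : ℤ) - r.1) * y ^ ((t.2 : ℤ) - r.2) : Ωˣ) =
      (x ^ t.1 * y ^ t.2) * (x ^ r.1 * y ^ r.2)⁻¹ := by
    rw [zpow_sub, zpow_sub, zpow_natCast, zpow_natCast, zpow_natCast, zpow_natCast, mul_inv]
    exact mul_mul_mul_comm _ _ _ _
  replace hv : (x ^ t.1 * y ^ t.2) ^ B = (x ^ r.1 * y ^ r.2) ^ B := Units.ext (by simpa using hv)
  rw [h1, mul_pow, hv, inv_pow, mul_inv_cancel]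

end Tropical

/-! ### Unramified extensions of the `p`-adic integers -/

section Unramified

variable (p : ℕ) [Fact p.Prime]

local instance : Algebra.IsAlgebraic ℚ_[p] (PadicAlgCl p) := PadicAlgCl.isAlgebraic p

instance isScalarTower_intermediateField (L : IntermediateField ℚ_[p] (PadicAlgCl p)) :
    IsScalarTower ℤ_[p] L (PadicAlgCl p) := IsScalarTower.of_algebraMap_eq fun _ => rfl

variable {p}

lemma algebraMap_padicInt_injective :
    Function.Injective (algebraMap ℤ_[p] (PadicAlgCl p)) :=
  (algebraMap ℚ_[p] (PadicAlgCl p)).injective.comp (IsFractionRing.injective ℤ_[p] ℚ_[p])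

/-- The norm is the spectral norm, which is at most 1 exactly when all coefficients of the minimal
polynomial are. As ℤ_p is integrally closed, this is integrality. -/
lemma isIntegral_iff_norm_le_one (x : PadicAlgCl p) : IsIntegral ℤ_[p] x ↔ ‖x‖ ≤ 1 := by
  have hx : IsIntegral ℚ_[p] x := (Algebra.IsAlgebraic.isAlgebraic x).isIntegral
  rw [← PadicAlgCl.spectralNorm_eq, spectralNorm, spectralValue_le_one_iff (minpoly.monic hx)]
  constructor
  · intro h n
    rw [minpoly.isIntegrallyClosed_eq_field_fractions' ℚ_[p] h, Polynomial.coeff_map]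
    exact PadicInt.norm_le_one _
  · intro h
    have hlift : minpoly ℚ_[p] x ∈ Polynomial.lifts (algebraMap ℤ_[p] ℚ_[p]) := by
      rw [Polynomial.lifts_iff_coeff_lifts]
      exact fun n => ⟨⟨_, h n⟩, rfl⟩
    obtain ⟨q, hq, -, hqm⟩ := Polynomial.lifts_and_natDegree_eq_and_monic hlift (minpoly.monic hx)
    refine ⟨q, hqm, ?_⟩
    rw [IsScalarTower.algebraMap_eq ℤ_[p] ℚ_[p] (PadicAlgCl p), ← Polynomial.eval₂_map, hq]
    exact minpoly.aeval _ _

lemma norm_natCast_prime : ‖(p : PadicAlgCl p)‖ = (p : ℝ)⁻¹ := by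
  have h := PadicAlgCl.norm_extends p (p : ℚ_[p])
  rw [Padic.norm_p, map_natCast] at h
  exact h

lemma norm_natCast_prime_pos : 0 < ‖(p : PadicAlgCl p)‖ := by
  rw [norm_natCast_prime]
  have := (Fact.out : p.Prime).pos
  positivity

lemma norm_natCast_prime_lt_one : ‖(p : PadicAlgCl p)‖ < 1 := by
  rw [norm_natCast_prime]
  exact inv_lt_one_of_one_lt₀ (by exact_mod_cast (Fact.out : p.Prime).one_lt)

lemma natCast_prime_ne_zero : (p : PadicAlgCl p) ≠ 0 := norm_pos_iff.mp norm_natCast_prime_pos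

lemma exists_isIntegral_pow_mul (x : PadicAlgCl p) : ∃ N : ℕ, IsIntegral ℤ_[p] ((p : PadicAlgCl p) ^ N * x) := by
  obtain ⟨N, hN⟩ := exists_pow_lt_of_lt_one (y := ‖(p : PadicAlgCl p)‖)
    (show 0 < (‖x‖ + 1)⁻¹ by positivity) norm_natCast_prime_lt_one
  refine ⟨N, (isIntegral_iff_norm_le_one _).mpr ?_⟩
  rw [norm_mul, norm_pow]
  calc ‖(p : PadicAlgCl p)‖ ^ N * ‖x‖ ≤ (‖x‖ + 1)⁻¹ * (‖x‖ + 1) := by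
        gcongr
        linarith
    _ = 1 := inv_mul_cancel₀ (by positivity)

/-- In a finite unramified subalgebra of `ℚ̄_p` every nonzero element is a power of `p` times a
unit. -/
lemma exists_eq_pow_mul_of_formallyUnramified (B : Subalgebra ℤ_[p] (PadicAlgCl p))
    [Module.Finite ℤ_[p] B] [Algebra.FormallyUnramified ℤ_[p] B] {x : PadicAlgCl p} (hx : x ∈ B)
    (hx0 : x ≠ 0) : ∃ (k : ℕ) (u : PadicAlgCl p), u ∈ B ∧ ‖u‖ = 1 ∧ x = (p : PadicAlgCl p) ^ k * u := by
  have hle : ∀ y ∈ B, ‖y‖ ≤ 1 := fun y hy => by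
    have h1 : IsIntegral ℤ_[p] (⟨y, hy⟩ : B) := Algebra.IsIntegral.isIntegral _
    exact (isIntegral_iff_norm_le_one y).mp (h1.map B.val)
  have hunit : ∀ y : B, IsUnit y ↔ ‖(y : PadicAlgCl p)‖ = 1 := by
    intro y
    constructor
    · rintro ⟨u, rfl⟩
      have h1 : ‖((u : B) : PadicAlgCl p)‖ * ‖(((u⁻¹ : Bˣ) : B) : PadicAlgCl p)‖ = 1 := by
        rw [← norm_mul, ← Subalgebra.coe_mul, Units.mul_inv, Subalgebra.coe_one, norm_one]
      have h2 := hle _ (u : B).2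
      have h3 := hle _ ((u⁻¹ : Bˣ) : B).2
      nlinarith [norm_nonneg ((u : B) : PadicAlgCl p)]
    · intro hy
      have hy0 : (y : PadicAlgCl p) ≠ 0 := norm_ne_zero_iff.mp (by rw [hy]; exact one_ne_zero)
      have hint : IsIntegral B (y : PadicAlgCl p)⁻¹ := by
        have : IsIntegral ℤ_[p] (y : PadicAlgCl p)⁻¹ :=
          (isIntegral_iff_norm_le_one _).mpr (by rw [norm_inv, hy, inv_one])
        exact this.tower_top
      have hu : IsUnit (algebraMap B (integralClosure B (PadicAlgCl p)) y) :=
        IsUnit.of_mul_eq_one ⟨_, hint⟩ (Subtype.ext (mul_inv_cancel₀ hy0))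
      have hfaith : FaithfulSMul B (integralClosure B (PadicAlgCl p)) :=
        (faithfulSMul_iff_algebraMap_injective _ _).mpr fun a b hab =>
          Subtype.ext (congrArg (fun z : integralClosure B (PadicAlgCl p) => (z : PadicAlgCl p)) hab)
      have hloc : IsLocalHom (algebraMap B (integralClosure B (PadicAlgCl p))) :=
        Algebra.IsIntegral.isLocalHom _ _
      exact isUnit_of_map_unit _ _ hu
  have hlocal : IsLocalRing B := IsLocalRing.of_nonunits_add fun a b ha hb => by
    rw [mem_nonunits_iff, hunit] at ha hb ⊢
    have h1 := lt_of_le_of_ne (hle _ a.2) ha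
    have h2 := lt_of_le_of_ne (hle _ b.2) hb
    exact ((PadicAlgCl.isNonarchimedean p _ _).trans_lt (max_lt h1 h2)).ne
  have hfaith : FaithfulSMul ℤ_[p] B := (faithfulSMul_iff_algebraMap_injective _ _).mpr
    fun a b hab => algebraMap_padicInt_injective
      (congrArg (fun z : B => (z : PadicAlgCl p)) hab)
  have hmax := Algebra.FormallyUnramified.map_maximalIdeal (R := ℤ_[p]) (S := B)
  rw [PadicInt.maximalIdeal_eq_span_p, Ideal.map_span, Set.image_singleton, map_natCast] at hmax
  have hdiv : ∀ y ∈ B, ‖y‖ ≠ 1 → ∃ z ∈ B, y = p * z := by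
    intro y hy hy1
    have h1 : (⟨y, hy⟩ : B) ∈ IsLocalRing.maximalIdeal B := by
      rw [IsLocalRing.mem_maximalIdeal, mem_nonunits_iff, hunit]
      exact hy1
    rw [← hmax] at h1
    obtain ⟨z, hz⟩ := Ideal.mem_span_singleton.mp h1
    exact ⟨z, z.2, congrArg Subtype.val hz⟩
  -- Unramifiedness says that p generates the maximal ideal of B, so p can be divided out until a
  -- unit is left. The lower bound ‖p‖ ^ n ≤ ‖y‖ limits the number of divisions.
  have key : ∀ (n : ℕ), ∀ y ∈ B, ‖(p : PadicAlgCl p)‖ ^ n ≤ ‖y‖ →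
      ∃ (k : ℕ) (u : PadicAlgCl p), u ∈ B ∧ ‖u‖ = 1 ∧ y = (p : PadicAlgCl p) ^ k * u := by
    intro n
    induction n with
    | zero =>
      intro y hy h
      rw [pow_zero] at h
      exact ⟨0, y, hy, le_antisymm (hle y hy) h, by rw [pow_zero, one_mul]⟩
    | succ n ih =>
      intro y hy h
      by_cases hy1 : ‖y‖ = 1
      · exact ⟨0, y, hy, hy1, by rw [pow_zero, one_mul]⟩
      · obtain ⟨z, hz, rfl⟩ := hdiv y hy hy1
        rw [norm_mul, pow_succ'] at h
        obtain ⟨k, u, hu, hu1, rfl⟩ := ih z hz (le_of_mul_le_mul_left h norm_natCast_prime_pos)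
        exact ⟨k + 1, u, hu, hu1, by rw [pow_succ', mul_assoc]⟩
  obtain ⟨n, hn⟩ := exists_pow_lt_of_lt_one (norm_pos_iff.mpr hx0)
    (norm_natCast_prime_lt_one (p := p))
  exact key n x hx hn.le

/-- A finite unramified subalgebra is the ring of integers of its field of fractions. -/
lemma formallyUnramified_integralClosure (B : Subalgebra ℤ_[p] (PadicAlgCl p))
    [Module.Finite ℤ_[p] B] [Algebra.FormallyUnramified ℤ_[p] B]
    (L : IntermediateField ℚ_[p] (PadicAlgCl p)) (hBL : ∀ x ∈ B, x ∈ L)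
    (hLB : ∀ x ∈ L, ∃ N : ℕ, (p : PadicAlgCl p) ^ N * x ∈ B) :
    Algebra.FormallyUnramified ℤ_[p] (integralClosure ℤ_[p] L) := by
  have hint : ∀ y : L, IsIntegral ℤ_[p] y ↔ IsIntegral ℤ_[p] (y : PadicAlgCl p) := fun y =>
    (isIntegral_algebraMap_iff (A := L) (algebraMap L (PadicAlgCl p)).injective).symm
  have hB : ∀ y ∈ B, IsIntegral ℤ_[p] y := fun y hy => by
    have h1 : IsIntegral ℤ_[p] (⟨y, hy⟩ : B) := Algebra.IsIntegral.isIntegral _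
    exact h1.map B.val
  let f : B →ₐ[ℤ_[p]] integralClosure ℤ_[p] L :=
    { toFun := fun y => ⟨⟨y, hBL y y.2⟩, (hint _).mpr (hB y y.2)⟩
      map_one' := rfl
      map_mul' := fun _ _ => rfl
      map_zero' := rfl
      map_add' := fun _ _ => rfl
      commutes' := fun _ => rfl }
  have hf : Function.Bijective f := by
    constructor
    · intro a b hab
      have := congrArg (fun z : integralClosure ℤ_[p] L => ((z : L) : PadicAlgCl p)) hab
      exact Subtype.ext this
    · rintro ⟨⟨y, hyL⟩, hy⟩
      suffices h : y ∈ B from ⟨⟨y, h⟩, rfl⟩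
      by_cases hy0 : y = 0
      · rw [hy0]
        exact B.zero_mem
      have hy1 := (isIntegral_iff_norm_le_one y).mp ((hint ⟨y, hyL⟩).mp hy)
      -- Here p ^ N · y = p ^ k · u with u ∈ B of norm 1. Integrality of y forces N ≤ k, so y = p ^
      -- (k - N) · u lies in B.
      obtain ⟨N, hN⟩ := hLB y hyL
      obtain ⟨k, u, hu, hu1, hk⟩ := exists_eq_pow_mul_of_formallyUnramified B hN
        (mul_ne_zero (pow_ne_zero _ natCast_prime_ne_zero) hy0)
      have hNk : N ≤ k := by
        by_contra hlt
        push Not at hlt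
        have h1 := congrArg norm hk
        rw [norm_mul, norm_mul, norm_pow, norm_pow, hu1, mul_one] at h1
        have h2 : ‖(p : PadicAlgCl p)‖ ^ N < ‖(p : PadicAlgCl p)‖ ^ k :=
          pow_lt_pow_right_of_lt_one₀ norm_natCast_prime_pos norm_natCast_prime_lt_one hlt
        nlinarith [pow_pos (norm_natCast_prime_pos (p := p)) N]
      obtain ⟨d, rfl⟩ := Nat.exists_eq_add_of_le hNk
      have h1 : y = (p : PadicAlgCl p) ^ d * u := by
        rw [pow_add, mul_assoc] at hk
        exact mul_left_cancel₀ (pow_ne_zero _ natCast_prime_ne_zero) hk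
      rw [h1]
      exact B.mul_mem (B.pow_mem (B.natCast_mem p) d) hu
  exact Algebra.FormallyUnramified.of_equiv (AlgEquiv.ofBijective f hf)

variable (p) in
/-- The finite unramified extensions of `ℚ_p` in `ℚ̄_p`. -/
def unramifiedExtensions : Set (IntermediateField ℚ_[p] (PadicAlgCl p)) :=
  {L | FiniteDimensional ℚ_[p] L ∧ Algebra.FormallyUnramified ℤ_[p] (integralClosure ℤ_[p] L)}

/-- Moves rings of integers into the common field ℚ̄_p, where those of two extensions can be
multiplied. -/
lemma exists_subalgebra_of_mem_unramifiedExtensions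
    {L : IntermediateField ℚ_[p] (PadicAlgCl p)} (hL : L ∈ unramifiedExtensions p) :
    ∃ B : Subalgebra ℤ_[p] (PadicAlgCl p), Module.Finite ℤ_[p] B ∧
      Algebra.FormallyUnramified ℤ_[p] B ∧ ∀ x, x ∈ B ↔ x ∈ L ∧ IsIntegral ℤ_[p] x := by
  obtain ⟨hfin, hunr⟩ := hL
  let g : integralClosure ℤ_[p] L →ₐ[ℤ_[p]] PadicAlgCl p :=
    (IsScalarTower.toAlgHom ℤ_[p] L (PadicAlgCl p)).comp (integralClosure ℤ_[p] L).val
  have hfinO : Module.Finite ℤ_[p] (integralClosure ℤ_[p] L) :=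
    IsIntegralClosure.finite ℤ_[p] ℚ_[p] L _
  refine ⟨g.range, ?_, ?_, fun x => ?_⟩
  · exact Module.Finite.of_surjective g.rangeRestrict.toLinearMap g.rangeRestrict_surjective
  · exact Algebra.FormallyUnramified.of_surjective g.rangeRestrict g.rangeRestrict_surjective
  · constructor
    · rintro ⟨y, rfl⟩
      exact ⟨(y : L).2, y.2.map (IsScalarTower.toAlgHom ℤ_[p] L (PadicAlgCl p))⟩
    · rintro ⟨hxL, hx⟩
      refine ⟨⟨⟨x, hxL⟩, ?_⟩, rfl⟩
      exact (isIntegral_algebraMap_iff (A := L) (x := ⟨x, hxL⟩)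
        (algebraMap L (PadicAlgCl p)).injective).mp hx

lemma bot_mem_unramifiedExtensions : ⊥ ∈ unramifiedExtensions p := by
  refine ⟨inferInstance, ?_⟩
  let g := Algebra.ofId ℤ_[p] (PadicAlgCl p)
  have h1 : Module.Finite ℤ_[p] g.range :=
    Module.Finite.of_surjective g.rangeRestrict.toLinearMap g.rangeRestrict_surjective
  have h2 : Algebra.FormallyUnramified ℤ_[p] g.range :=
    Algebra.FormallyUnramified.of_surjective g.rangeRestrict g.rangeRestrict_surjective
  refine formallyUnramified_integralClosure g.range ⊥ ?_ ?_
  · rintro _ ⟨y, rfl⟩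
    exact IntermediateField.algebraMap_mem ⊥ (y : ℚ_[p])
  · intro x hx
    obtain ⟨y, rfl⟩ := IntermediateField.mem_bot.mp hx
    obtain ⟨N, hN⟩ := exists_isIntegral_pow_mul (algebraMap ℚ_[p] (PadicAlgCl p) y)
    refine ⟨N, ?_⟩
    have h3 := (isIntegral_iff_norm_le_one _).mp hN
    have h4 : (p : PadicAlgCl p) ^ N * algebraMap ℚ_[p] (PadicAlgCl p) y =
        algebraMap ℚ_[p] (PadicAlgCl p) ((p : ℚ_[p]) ^ N * y) := by
      rw [map_mul, map_pow, map_natCast]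
    rw [h4] at h3 ⊢
    have h5 := PadicAlgCl.norm_extends p ((p : ℚ_[p]) ^ N * y)
    exact ⟨⟨_, h5.symm.trans_le h3⟩, rfl⟩

/-- The tensor product of the two rings of integers is unramified, hence so is its image B₁B₂. Up to
powers of p this image exhausts L₁L₂, so it is the full ring of integers by
`formallyUnramified_integralClosure`. -/
lemma sup_mem_unramifiedExtensions {L₁ L₂ : IntermediateField ℚ_[p] (PadicAlgCl p)}
    (h₁ : L₁ ∈ unramifiedExtensions p) (h₂ : L₂ ∈ unramifiedExtensions p) :
    L₁ ⊔ L₂ ∈ unramifiedExtensions p := by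
  obtain ⟨B₁, hf₁, hu₁, hB₁⟩ := exists_subalgebra_of_mem_unramifiedExtensions h₁
  obtain ⟨B₂, hf₂, hu₂, hB₂⟩ := exists_subalgebra_of_mem_unramifiedExtensions h₂
  have := h₁.1
  have := h₂.1
  refine ⟨inferInstance, ?_⟩
  let g := Algebra.TensorProduct.productMap B₁.val B₂.val
  have hu : Algebra.FormallyUnramified ℤ_[p] (TensorProduct ℤ_[p] B₁ B₂) :=
    Algebra.FormallyUnramified.comp ℤ_[p] B₁ _
  have h1 : Module.Finite ℤ_[p] g.range :=
    Module.Finite.of_surjective g.rangeRestrict.toLinearMap g.rangeRestrict_surjective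
  have h2 : Algebra.FormallyUnramified ℤ_[p] g.range :=
    Algebra.FormallyUnramified.of_surjective g.rangeRestrict g.rangeRestrict_surjective
  have hrange : g.range = B₁ ⊔ B₂ := by
    rw [Algebra.TensorProduct.productMap_range, Subalgebra.range_val, Subalgebra.range_val]
  refine formallyUnramified_integralClosure g.range _ ?_ ?_
  · rw [hrange]
    intro x hx
    have hle : B₁ ⊔ B₂ ≤ ((L₁ ⊔ L₂ : IntermediateField ℚ_[p] (PadicAlgCl p)).toSubalgebra.restrictScalars ℤ_[p]) :=
      sup_le (fun y hy => (le_sup_left : L₁ ≤ L₁ ⊔ L₂) ((hB₁ y).mp hy).1)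
        (fun y hy => (le_sup_right : L₂ ≤ L₁ ⊔ L₂) ((hB₂ y).mp hy).1)
    exact hle hx
  · rw [hrange]
    have hpow : ∀ (N : ℕ), (p : PadicAlgCl p) ^ N ∈ B₁ ⊔ B₂ := fun N =>
      pow_mem ((B₁ ⊔ B₂).natCast_mem p) N
    let T : Subalgebra ℚ_[p] (PadicAlgCl p) :=
      { carrier := {x | ∃ N : ℕ, (p : PadicAlgCl p) ^ N * x ∈ B₁ ⊔ B₂}
        mul_mem' := by
          rintro a b ⟨N, hN⟩ ⟨M, hM⟩
          refine ⟨N + M, ?_⟩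
          rw [pow_add, mul_mul_mul_comm]
          exact mul_mem hN hM
        add_mem' := by
          rintro a b ⟨N, hN⟩ ⟨M, hM⟩
          refine ⟨N + M, ?_⟩
          have : (p : PadicAlgCl p) ^ (N + M) * (a + b) =
              p ^ M * (p ^ N * a) + p ^ N * (p ^ M * b) := by ring
          rw [this]
          exact add_mem (mul_mem (hpow M) hN) (mul_mem (hpow N) hM)
        algebraMap_mem' := fun y => by
          obtain ⟨N, hN⟩ := exists_isIntegral_pow_mul (algebraMap ℚ_[p] (PadicAlgCl p) y)
          refine ⟨N, (le_sup_left : B₁ ≤ B₁ ⊔ B₂) ((hB₁ _).mpr ⟨?_, hN⟩)⟩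
          exact L₁.mul_mem (pow_mem (natCast_mem L₁ p) N) (L₁.algebraMap_mem y) }
    have hT : (L₁ ⊔ L₂).toSubalgebra ≤ T := by
      rw [IntermediateField.sup_toSubalgebra_of_left]
      refine sup_le ?_ ?_
      · intro x hx
        obtain ⟨N, hN⟩ := exists_isIntegral_pow_mul x
        exact ⟨N, (le_sup_left : B₁ ≤ B₁ ⊔ B₂)
          ((hB₁ _).mpr ⟨L₁.mul_mem (pow_mem (natCast_mem L₁ p) N) hx, hN⟩)⟩
      · intro x hx
        obtain ⟨N, hN⟩ := exists_isIntegral_pow_mul x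
        exact ⟨N, (le_sup_right : B₂ ≤ B₁ ⊔ B₂)
          ((hB₂ _).mpr ⟨L₂.mul_mem (pow_mem (natCast_mem L₂ p) N) hx, hN⟩)⟩
    intro x hx
    exact hT hx

/-- The unramified extensions are closed under finite composita, so their compositum is just their
union. -/
lemma exists_mem_unramifiedExtensions {x : PadicAlgCl p} (hx : x ∈ Qnr p) :
    ∃ L ∈ unramifiedExtensions p, x ∈ L := by
  classical
  have hx' : x ∈ ⨆ L : unramifiedExtensions p, (L : IntermediateField ℚ_[p] (PadicAlgCl p)) := by
    rw [← sSup_eq_iSup']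
    exact hx
  obtain ⟨s, hs⟩ := IntermediateField.exists_finset_of_mem_iSup hx'
  refine ⟨_, ?_, hs⟩
  clear hs
  induction s using Finset.induction_on with
  | empty => simpa using bot_mem_unramifiedExtensions
  | insert a s _ ih =>
    rw [Finset.iSup_insert]
    exact sup_mem_unramifiedExtensions a.2 ih

/-- The value group does not grow in ℚ_p^nr; this is what makes ℤ_p^nr discrete. -/
lemma exists_norm_eq_pow {x : PadicAlgCl p} (hx : x ∈ Qnr p) (hx0 : x ≠ 0)
    (hint : IsIntegral ℤ_[p] x) : ∃ k : ℕ, ‖x‖ = ‖(p : PadicAlgCl p)‖ ^ k := by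
  obtain ⟨L, hL, hxL⟩ := exists_mem_unramifiedExtensions hx
  obtain ⟨B, hf, hu, hB⟩ := exists_subalgebra_of_mem_unramifiedExtensions hL
  obtain ⟨k, u, -, hu1, rfl⟩ := exists_eq_pow_mul_of_formallyUnramified B ((hB x).mpr ⟨hxL, hint⟩) hx0
  exact ⟨k, by rw [norm_mul, norm_pow, hu1, mul_one]⟩

lemma mem_Znr_iff (x : Qnr p) : x ∈ Znr p ↔ ‖(x : PadicAlgCl p)‖ ≤ 1 := by
  rw [← isIntegral_iff_norm_le_one]
  exact (isIntegral_algebraMap_iff (A := Qnr p) (algebraMap (Qnr p) (PadicAlgCl p)).injective).symm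

lemma mem_Zbar_iff (x : PadicAlgCl p) : x ∈ Zbar p ↔ ‖x‖ ≤ 1 := isIntegral_iff_norm_le_one x

lemma isUnit_Znr_iff (x : Znr p) : IsUnit x ↔ ‖((x : Qnr p) : PadicAlgCl p)‖ = 1 := by
  constructor
  · rintro ⟨u, rfl⟩
    have h1 : ‖(((u : Znr p) : Qnr p) : PadicAlgCl p)‖ *
        ‖((((u⁻¹ : (Znr p)ˣ) : Znr p) : Qnr p) : PadicAlgCl p)‖ = 1 := by
      rw [← norm_mul, ← MulMemClass.coe_mul, ← MulMemClass.coe_mul, Units.mul_inv]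
      exact norm_one
    have h2 := (mem_Znr_iff _).mp (u : Znr p).2
    have h3 := (mem_Znr_iff _).mp ((u⁻¹ : (Znr p)ˣ) : Znr p).2
    nlinarith [norm_nonneg (((u : Znr p) : Qnr p) : PadicAlgCl p)]
  · intro h
    have h0 : (x : Qnr p) ≠ 0 := fun h0 => by
      rw [h0, ZeroMemClass.coe_zero, norm_zero] at h
      exact zero_ne_one h
    refine IsUnit.of_mul_eq_one ⟨(x : Qnr p)⁻¹, (mem_Znr_iff _).mpr ?_⟩
      (Subtype.ext (mul_inv_cancel₀ h0))
    rw [IntermediateField.coe_inv, norm_inv, h, inv_one]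

variable (p) in
/-- `ℤ_p^nr` is a discrete valuation ring. -/
lemma isDiscreteValuationRing_Znr : IsDiscreteValuationRing (Znr p) := by
  have hp : (((p : Znr p) : Qnr p) : PadicAlgCl p) = p := by push_cast; rfl
  refine IsDiscreteValuationRing.ofHasUnitMulPowIrreducibleFactorization ⟨p, ?_, ?_⟩
  · constructor
    · rw [isUnit_Znr_iff, hp]
      exact norm_natCast_prime_lt_one.ne
    · intro a b hab
      rw [isUnit_Znr_iff, isUnit_Znr_iff]
      have h1 : (((a : Qnr p) : PadicAlgCl p)) * ((b : Qnr p) : PadicAlgCl p) = p := by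
        rw [← hp, hab]
        rfl
      have ha0 : ((a : Qnr p) : PadicAlgCl p) ≠ 0 := fun h => natCast_prime_ne_zero (p := p)
        (by rw [← h1, h, zero_mul])
      have hb0 : ((b : Qnr p) : PadicAlgCl p) ≠ 0 := fun h => natCast_prime_ne_zero (p := p)
        (by rw [← h1, h, mul_zero])
      obtain ⟨k, hk⟩ := exists_norm_eq_pow (a : Qnr p).2 ha0
        ((isIntegral_iff_norm_le_one _).mpr ((mem_Znr_iff _).mp a.2))
      obtain ⟨l, hl⟩ := exists_norm_eq_pow (b : Qnr p).2 hb0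
        ((isIntegral_iff_norm_le_one _).mpr ((mem_Znr_iff _).mp b.2))
      have h2 := congrArg norm h1
      rw [norm_mul, hk, hl, ← pow_add] at h2
      have h3 : k + l = 1 := by
        have := (pow_right_injective₀ norm_natCast_prime_pos (norm_natCast_prime_lt_one (p := p)).ne)
          (h2.trans (pow_one _).symm)
        exact this
      rw [hk, hl]
      rcases Nat.eq_zero_or_pos k with rfl | hk0
      · left
        rw [pow_zero]
      · right
        rw [show l = 0 by omega, pow_zero]
  · intro x hx
    have hx0 : ((x : Qnr p) : PadicAlgCl p) ≠ 0 := fun h => hx (Subtype.ext (Subtype.ext h))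
    obtain ⟨k, hk⟩ := exists_norm_eq_pow (x : Qnr p).2 hx0
      ((isIntegral_iff_norm_le_one _).mpr ((mem_Znr_iff _).mp x.2))
    refine ⟨k, ?_⟩
    have hpQ : (p : Qnr p) ≠ 0 := fun h => natCast_prime_ne_zero (p := p) (by
      have := congrArg (fun y : Qnr p => (y : PadicAlgCl p)) h
      simpa using this)
    let y : Qnr p := (x : Qnr p) * ((p : Qnr p) ^ k)⁻¹
    have hy : ‖(y : PadicAlgCl p)‖ = 1 := by
      simp only [y, MulMemClass.coe_mul, IntermediateField.coe_inv, norm_mul, norm_inv, hk,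
        SubmonoidClass.coe_pow, norm_pow, SubringClass.coe_natCast]
      exact mul_inv_cancel₀ (pow_ne_zero _ norm_natCast_prime_pos.ne')
    let y' : Znr p := ⟨y, (mem_Znr_iff y).mpr hy.le⟩
    obtain ⟨v, hv⟩ := (isUnit_Znr_iff y').mpr hy
    refine ⟨v, ?_⟩
    rw [hv]
    refine Subtype.ext ?_
    change ((p : Znr p) ^ k : Qnr p) * ((x : Qnr p) * ((p : Qnr p) ^ k)⁻¹) = x
    have : (((p : Znr p) : Qnr p)) = p := rfl
    rw [this, mul_left_comm, mul_inv_cancel₀ (pow_ne_zero _ hpQ), mul_one]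

variable (p) in
lemma isFractionRing_Znr : IsFractionRing (Znr p) (Qnr p) :=
  have : Algebra.IsAlgebraic ℤ_[p] (Qnr p) :=
    (IsFractionRing.comap_isAlgebraic_iff (A := ℤ_[p]) (K := ℚ_[p]) (C := Qnr p)).mpr inferInstance
  integralClosure.isFractionRing_of_algebraic fun _ hx =>
    algebraMap_padicInt_injective
      ((congrArg (fun z : Qnr p => (z : PadicAlgCl p)) hx).trans (map_zero _).symm)

variable (p) in
lemma isFractionRing_Zbar : IsFractionRing (Zbar p) (PadicAlgCl p) :=
  have : Algebra.IsAlgebraic ℤ_[p] (PadicAlgCl p) :=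
    (IsFractionRing.comap_isAlgebraic_iff (A := ℤ_[p]) (K := ℚ_[p]) (C := PadicAlgCl p)).mpr
      inferInstance
  integralClosure.isFractionRing_of_algebraic fun _ hx =>
    algebraMap_padicInt_injective (hx.trans (map_zero _).symm)

variable (p) in
lemma valuationRing_Zbar : ValuationRing (Zbar p) := by
  have := isFractionRing_Zbar p
  refine (ValuationRing.iff_isInteger_or_isInteger (Zbar p) (PadicAlgCl p)).mpr fun x => ?_
  rcases le_total ‖x‖ 1 with h | h
  · exact Or.inl ⟨⟨x, (mem_Zbar_iff x).mpr h⟩, rfl⟩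
  · refine Or.inr ⟨⟨x⁻¹, (mem_Zbar_iff _).mpr ?_⟩, rfl⟩
    rw [norm_inv]
    exact inv_le_one_of_one_le₀ h

end Unramified

/-! ### Evaluating global functions at points -/

section Evaluation

variable {X Y : Scheme.{u}}

/-- The evaluation of global functions on `X` along a morphism `Spec B ⟶ X`. -/
def evalTop {B : CommRingCat.{u}} (w : Spec B ⟶ X) : Γ(X, ⊤) →+* B :=
  (Scheme.ΓSpecIso B).hom.hom.comp w.appTop.hom

lemma evalTop_comp {B : CommRingCat.{u}} (w : Spec B ⟶ Y) (h : Y ⟶ X) (g : Γ(X, ⊤)) :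
    evalTop (w ≫ h) g = evalTop w (h.appTop.hom g) := by
  simp only [evalTop, Scheme.Hom.comp_appTop, CommRingCat.hom_comp, RingHom.comp_apply]

lemma evalTop_SpecMap_comp {B B' : CommRingCat.{u}} (φ : B ⟶ B') (w : Spec B ⟶ X) (g : Γ(X, ⊤)) :
    evalTop (Spec.map φ ≫ w) g = φ.hom (evalTop w g) := by
  have h := Scheme.ΓSpecIso_naturality φ
  have h2 := congrArg (fun q => q.hom (w.appTop.hom g)) h
  simp only [evalTop, Scheme.Hom.comp_appTop, CommRingCat.hom_comp, RingHom.comp_apply] at h2 ⊢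
  exact h2

/-- Restriction of functions to a smaller open subset. -/
abbrev resOpen {U V : X.Opens} (h : U ≤ V) : Γ(X, V) →+* Γ(X, U) :=
  (X.presheaf.map (homOfLE h).op).hom

lemma evalTop_SpecMap_fromSpec {U : X.Opens} (hU : IsAffineOpen U) {B : CommRingCat.{u}}
    (φ : Γ(X, U) ⟶ B) (g : Γ(X, ⊤)) :
    evalTop (Spec.map φ ≫ hU.fromSpec) g = φ.hom (resOpen le_top g) := by
  rw [evalTop_SpecMap_comp]
  congr 1
  have h : hU.fromSpec.appTop ≫ (Scheme.ΓSpecIso _).hom = X.presheaf.map (homOfLE le_top).op := by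
    have h1 := congrArg Scheme.Hom.appTop hU.fromSpec_toSpecΓ
    rw [Scheme.Hom.comp_appTop, Scheme.toSpecΓ_appTop] at h1
    rw [← cancel_epi (Scheme.ΓSpecIso Γ(X, ⊤)).hom, ← Category.assoc, h1,
      Scheme.ΓSpecIso_naturality]
  exact congrArg (fun q => q.hom g) h

lemma exists_eq_SpecMap_fromSpec {U : X.Opens} (hU : IsAffineOpen U) {B : CommRingCat.{u}}
    (w : Spec B ⟶ X) (h : Set.range w ⊆ U) :
    ∃ φ : Γ(X, U) ⟶ B, w = Spec.map φ ≫ hU.fromSpec := by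
  refine ⟨Spec.preimage (IsOpenImmersion.lift hU.fromSpec w (by rwa [hU.range_fromSpec])), ?_⟩
  rw [Spec.map_preimage, IsOpenImmersion.lift_fac]

lemma range_subset_of_closedPoint_mem {B : CommRingCat.{u}} [IsLocalRing B] (w : Spec B ⟶ X)
    (U : X.Opens) (h : w (IsLocalRing.closedPoint B) ∈ U) : Set.range w ⊆ U := by
  rintro _ ⟨y, rfl⟩
  have h1 : (IsLocalRing.closedPoint B) ∈ w ⁻¹ᵁ U := h
  exact ((IsLocalRing.specializes_closedPoint y).mem_open (w ⁻¹ᵁ U).isOpen h1 :)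

lemma exists_eq_SpecMap_fromSpec_of_isLocalRing {U : X.Opens} (hU : IsAffineOpen U)
    {B : CommRingCat.{u}} [IsLocalRing B] (w : Spec B ⟶ X)
    (h : w (IsLocalRing.closedPoint B) ∈ U) :
    ∃ φ : Γ(X, U) ⟶ B, w = Spec.map φ ≫ hU.fromSpec :=
  exists_eq_SpecMap_fromSpec hU w (range_subset_of_closedPoint_mem w U h)

lemma Point.coe_coords {R : Type u} [CommRing R] {F : Type u} [Field F] [Algebra R F]
    {π : X ⟶ Spec (.of R)} (z : Point F π) {n : ℕ} (f : Fin n → Γ(X, ⊤)ˣ) (i : Fin n) :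
    ((z.coords f i : Fˣ) : F) = evalTop z.1 (f i : Γ(X, ⊤)) := rfl

end Evaluation

/-! ### Structure maps of schemes over an affine base -/

section StructureMap

variable {X : Scheme.{u}} {R : Type u} [CommRing R] (π : X ⟶ Spec (.of R))

/-- The structure map `R → Γ(X, U)` for an open subset `U` of an `R`-scheme `X`. -/
def structureMap (U : X.Opens) : R →+* Γ(X, U) :=
  ((Scheme.ΓSpecIso (.of R)).inv ≫ π.appLE ⊤ U (show U ≤ π ⁻¹ᵁ ⊤ from le_top)).hom

lemma resOpen_structureMap {U V : X.Opens} (h : U ≤ V) (r : R) :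
    resOpen h (structureMap π V r) = structureMap π U r := by
  simp only [structureMap, resOpen, CommRingCat.hom_comp, RingHom.comp_apply]
  rw [← RingHom.comp_apply, ← CommRingCat.hom_comp, Scheme.Hom.appLE_map]

lemma fromSpec_comp_eq {U : X.Opens} (hU : IsAffineOpen U) :
    hU.fromSpec ≫ π = Spec.map (CommRingCat.ofHom (structureMap π U)) := by
  have h := (isAffineOpen_top (Spec (.of R))).SpecMap_appLE_fromSpec π hU (i := le_top)
  rw [← h, IsAffineOpen.fromSpec_top, structureMap, CommRingCat.ofHom_hom, Spec.map_comp,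
    Scheme.isoSpec_Spec_inv]

lemma comp_structureMap {U : X.Opens} (hU : IsAffineOpen U) {B : CommRingCat.{u}}
    (φ : Γ(X, U) ⟶ B) (ρ : R →+* B)
    (h : (Spec.map φ ≫ hU.fromSpec) ≫ π = Spec.map (CommRingCat.ofHom ρ)) :
    φ.hom.comp (structureMap π U) = ρ := by
  rw [Category.assoc, fromSpec_comp_eq, ← Spec.map_comp] at h
  have := Spec.map_injective h
  simpa using congrArg CommRingCat.Hom.hom this

lemma structureMap_top (r : R) :
    structureMap π ⊤ r = π.appTop.hom ((Scheme.ΓSpecIso (.of R)).inv.hom r) := by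
  have h2 : π.appLE ⊤ ⊤ (show ⊤ ≤ π ⁻¹ᵁ ⊤ from le_top) = π.appTop := by
    rw [Scheme.Hom.appTop, Scheme.Hom.app_eq_appLE]; rfl
  simp only [structureMap, CommRingCat.hom_comp, RingHom.comp_apply, h2]

lemma appTop_structureMap_of_comp_eq {Y : Scheme.{u}} {R' : Type u} [CommRing R'] (ρ : R →+* R')
    (t : Y ⟶ X) (q : Y ⟶ Spec (.of R')) (h : t ≫ π = q ≫ Spec.map (CommRingCat.ofHom ρ)) (r : R) :
    t.appTop.hom (structureMap π ⊤ r) = structureMap q ⊤ (ρ r) := by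
  rw [structureMap_top, structureMap_top, ← RingHom.comp_apply, ← CommRingCat.hom_comp,
    ← Scheme.Hom.comp_appTop, h, Scheme.Hom.comp_appTop, CommRingCat.hom_comp, RingHom.comp_apply]
  congr 1
  exact (congrArg (fun q => q.hom r) (Scheme.ΓSpecIso_inv_naturality (CommRingCat.ofHom ρ))).symm

lemma evalTop_structureMap {B : CommRingCat.{u}} (w : Spec B ⟶ X) (ρ : R →+* B)
    (h : w ≫ π = Spec.map (CommRingCat.ofHom ρ)) (r : R) :
    evalTop w (structureMap π ⊤ r) = ρ r := by
  rw [structureMap_top, ← evalTop_comp, h]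
  have h2 := evalTop_SpecMap_comp (CommRingCat.ofHom ρ) (𝟙 _)
    ((Scheme.ΓSpecIso (.of R)).inv.hom r)
  simp only [Category.comp_id] at h2
  rw [h2]
  simp [evalTop]

lemma finiteType_structureMap [LocallyOfFiniteType π] {U : X.Opens} (hU : IsAffineOpen U) :
    (structureMap π U).FiniteType := by
  have h : LocallyOfFiniteType (hU.fromSpec ≫ π) := inferInstance
  rw [fromSpec_comp_eq] at h
  exact (HasRingHomProperty.Spec_iff (P := @LocallyOfFiniteType)).mp h

end StructureMap

/-! ### Functions on a curve: algebraic dependence, zeros and level sets -/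

section Dimension

open TensorProduct

variable {X : Scheme.{u}} {R : Type u} [CommRing R]

/-- The generic fibre of an affine open subscheme is an open subscheme of the generic fibre. -/
lemma exists_isOpenImmersion_genericFibre (F : Type u) [Field F] [Algebra R F]
    (π : X ⟶ Spec (.of R)) {U : X.Opens} (hU : IsAffineOpen U) [Algebra R Γ(X, U)]
    (he : algebraMap R Γ(X, U) = structureMap π U) :
    ∃ g : Spec (.of (F ⊗[R] Γ(X, U))) ⟶ genericFibre F π, IsOpenImmersion g ∧
      g ≫ genericFibreMap F π =
        Spec.map (CommRingCat.ofHom (algebraMap F (F ⊗[R] Γ(X, U)))) := by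
  have h1 := (IsPullback.of_hasPullback (hU.fromSpec) (genericFibreProj F π))
  have h2 := h1.paste_vert (IsPullback.of_hasPullback π _)
  have h3 := isPullback_SpecMap_of_isPushout _ _ _ _
    (CommRingCat.isPushout_tensorProduct R F Γ(X, U))
  rw [fromSpec_comp_eq, ← he] at h2
  refine ⟨(h3.isoIsPullback _ _ h2.flip).hom ≫ pullback.snd _ _, inferInstance, ?_⟩
  rw [Category.assoc]
  exact h3.isoIsPullback_hom_fst _ _ h2.flip

/-- When R embeds in Γ(X, U), the base change F ⊗ Γ(X, U) is a localisation of Γ(X, U), so it is a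
domain containing it. Its spectrum is open in the one-dimensional generic fibre, which bounds the
transcendence degree. -/
lemma trdeg_le_one_of_isAffineOpen [IsDomain R] {F : Type u} [Field F] [Algebra R F]
    [IsFractionRing R F] {π : X ⟶ Spec (.of R)} (hX : IsGeomIrredCurve F π) {U : X.Opens}
    (hU : IsAffineOpen U) [Nonempty U] [Algebra R Γ(X, U)]
    (he : algebraMap R Γ(X, U) = structureMap π U) : Algebra.trdeg R Γ(X, U) ≤ 1 := by
  have := hX.isIntegral
  have := hX.locallyOfFiniteType
  by_cases hinj : Function.Injective (algebraMap R Γ(X, U))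
  swap
  -- If the structure map is not injective, the generic fibre gives no information, but `trdeg` is
  -- then 0 by convention.
  · rw [trdeg_eq_zero_of_not_injective hinj]
    exact zero_le_one
  obtain ⟨g, hg, hgF⟩ := exists_isOpenImmersion_genericFibre F π hU he
  let B := F ⊗[R] Γ(X, U)
  let : Algebra Γ(X, U) B := Algebra.TensorProduct.rightAlgebra
  have hloc : IsLocalization (Algebra.algebraMapSubmonoid Γ(X, U) (nonZeroDivisors R)) B :=
    inferInstance
  have hle : Algebra.algebraMapSubmonoid Γ(X, U) (nonZeroDivisors R) ≤ nonZeroDivisors Γ(X, U) := by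
    rintro _ ⟨r, hr, rfl⟩
    rw [mem_nonZeroDivisors_iff_ne_zero]
    exact (map_ne_zero_iff _ hinj).mpr (nonZeroDivisors.ne_zero hr)
  have : IsDomain B := IsLocalization.isDomain_of_le_nonZeroDivisors _ hle
  have : Algebra.FiniteType R Γ(X, U) := by
    have := finiteType_structureMap π hU
    rwa [← he, RingHom.finiteType_algebraMap] at this
  have : Algebra.FiniteType F B := inferInstance
  have hdim : Ring.KrullDimLE 1 B := by
    have h1 := g.isOpenEmbedding.isInducing.topologicalKrullDim_le
    rw [hX.dim_eq_one] at h1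
    rw [Ring.krullDimLE_iff, ← PrimeSpectrum.topologicalKrullDim_eq_ringKrullDim]
    exact h1
  have h3 : Algebra.trdeg R B ≤ 1 :=
    trdeg_le_one_of_fractionRing_base (F := F) (trdeg_le_one_of_krullDimLE_one hdim)
  exact trdeg_le_one_of_injective (algebraMap Γ(X, U) B) (fun r => by
    change (1 : F) ⊗ₜ[R] algebraMap R Γ(X, U) r = algebraMap R F r ⊗ₜ[R] 1
    rw [Algebra.algebraMap_eq_smul_one, Algebra.algebraMap_eq_smul_one, TensorProduct.smul_tmul])
    (IsLocalization.injective _ hle) h3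

lemma exists_isAffineOpen_mem (x : X) : ∃ U : X.Opens, IsAffineOpen U ∧ x ∈ U := by
  obtain ⟨_, ⟨U, hU, rfl⟩, hxU, -⟩ := X.isBasis_affineOpens.exists_subset_of_mem_open
    (Set.mem_univ x) isOpen_univ
  exact ⟨U, hU, hxU⟩

lemma exists_finset_affineOpens_cover (X : Scheme.{u}) [CompactSpace X] :
    ∃ s : Finset X.affineOpens, ∀ x : X, ∃ U ∈ s, x ∈ U.1 := by
  obtain ⟨s, hs, hcov⟩ := (isCompact_iff_finite_and_eq_biUnion_affineOpens (X := X) (U := ⊤)).mp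
    isCompact_univ
  refine ⟨hs.toFinset, fun x => ?_⟩
  have hx : x ∈ (⊤ : X.Opens) := trivial
  rw [hcov] at hx
  simpa [TopologicalSpace.Opens.mem_iSup] using hx

lemma resOpen_injective [IsIntegral X] {U V : X.Opens} (h : U ≤ V) [Nonempty U] :
    Function.Injective (resOpen h) :=
  map_injective_of_isIntegral X _

open Polynomial in
/-- Two functions on a curve are algebraically dependent over the base. -/
lemma exists_relation [IsDomain R] {F : Type u} [Field F] [Algebra R F]
    [IsFractionRing R F] {π : X ⟶ Spec (.of R)} (hX : IsGeomIrredCurve F π) (g₁ g₂ : Γ(X, ⊤)) :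
    ∃ Q : R[X][X], Q ≠ 0 ∧ ∀ (B : Type u) [CommRing B] [Algebra R B] (w : Spec (.of B) ⟶ X),
      w ≫ π = Spec.map (CommRingCat.ofHom (algebraMap R B)) →
      Q.eval₂ (aeval (R := R) (evalTop w g₂ : B)).toRingHom (evalTop w g₁ : B) = 0 := by
  have := hX.isIntegral
  obtain ⟨U, hU, hxU⟩ := exists_isAffineOpen_mem (genericPoint X)
  have : Nonempty U := ⟨⟨_, hxU⟩⟩
  let : Algebra R Γ(X, U) := (structureMap π U).toAlgebra
  let : Algebra R Γ(X, ⊤) := (structureMap π ⊤).toAlgebra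
  obtain ⟨Q, hQ, hQ0⟩ := exists_bivariate_relation (trdeg_le_one_of_isAffineOpen hX hU rfl)
    (resOpen le_top g₁) (resOpen le_top g₂)
  refine ⟨Q, hQ, fun B _ _ w hw => ?_⟩
  let r : Γ(X, ⊤) →ₐ[R] Γ(X, U) :=
    { resOpen le_top with commutes' := resOpen_structureMap π le_top }
  let e : Γ(X, ⊤) →ₐ[R] B :=
    { evalTop w with commutes' := evalTop_structureMap π w _ hw }
  have h1 : Q.eval₂ (aeval g₂ : R[X] →ₐ[R] Γ(X, ⊤)).toRingHom g₁ = 0 := by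
    apply resOpen_injective (le_top : U ≤ ⊤)
    rw [map_zero, ← hQ0]
    change r.toRingHom _ = _
    rw [hom_eval₂]
    congr 1
    exact congrArg AlgHom.toRingHom (aeval_algHom r g₂).symm
  have h2 := congrArg e.toRingHom h1
  rw [hom_eval₂, map_zero] at h2
  rw [← h2]
  congr 1
  exact congrArg AlgHom.toRingHom (aeval_algHom e g₂)

/-- A nonzero function on a curve has finitely many zeros. -/
lemma finite_setOf_evalTop_eq_zero [IsDomain R] {F : Type u} [Field F] [Algebra R F]
    [IsFractionRing R F] {π : X ⟶ Spec (.of R)} (hX : IsGeomIrredCurve F π) {g : Γ(X, ⊤)}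
    (hg : g ≠ 0) (Ω : Type u) [Field Ω] [Algebra R Ω] [FaithfulSMul R Ω] :
    {z : Point Ω π | evalTop z.1 g = 0}.Finite := by
  have := hX.isIntegral
  have := hX.locallyOfFiniteType
  have := hX.quasiCompact
  have hc : CompactSpace X := QuasiCompact.compactSpace_of_compactSpace π
  obtain ⟨s, hs⟩ := exists_finset_affineOpens_cover X
  have hfin : ∀ U ∈ s, {z : Point Ω π | evalTop z.1 g = 0 ∧
      z.1 (IsLocalRing.closedPoint Ω) ∈ U.1}.Finite := by
    rintro ⟨U, hU'⟩ -
    have hU : IsAffineOpen U := hU'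
    by_cases hne : Nonempty U
    swap
    · exact Set.Finite.subset Set.finite_empty fun z hz => hne ⟨⟨_, hz.2⟩⟩
    let : Algebra R Γ(X, U) := (structureMap π U).toAlgebra
    have : Algebra.FiniteType R Γ(X, U) := finiteType_structureMap π hU
    have h0 : resOpen (le_top : U ≤ ⊤) g ≠ 0 := by
      rw [← map_zero (resOpen (le_top : U ≤ ⊤))]
      exact fun h => hg (resOpen_injective le_top h)
    have h1 := finite_setOf_algHom_eq_zero (Ω := Ω) (trdeg_le_one_of_isAffineOpen hX hU rfl) h0
    let P : (Γ(X, U) →ₐ[R] Ω) → Point Ω π := fun φ =>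
      ⟨Spec.map (CommRingCat.ofHom φ.toRingHom) ≫ hU.fromSpec, by
        rw [Category.assoc, fromSpec_comp_eq, ← Spec.map_comp, ← CommRingCat.ofHom_comp]
        exact congrArg (fun q => Spec.map (CommRingCat.ofHom q)) φ.comp_algebraMap⟩
    refine (h1.image P).subset ?_
    rintro ⟨z, hzπ⟩ ⟨hz0, hzU⟩
    obtain ⟨φ, rfl⟩ := exists_eq_SpecMap_fromSpec_of_isLocalRing hU (B := .of Ω) z hzU
    have h2 := comp_structureMap π hU φ _ hzπ
    refine ⟨{ φ.hom with commutes' := fun r => DFunLike.congr_fun h2 r }, ?_, rfl⟩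
    rw [evalTop_SpecMap_fromSpec] at hz0
    exact hz0
  refine (s.finite_toSet.biUnion (fun U hU => hfin U hU)).subset fun z hz => ?_
  obtain ⟨U, hU, hzU⟩ := hs (z.1 (IsLocalRing.closedPoint Ω))
  exact Set.mem_biUnion hU ⟨hz, hzU⟩

lemma evalTop_eq_zero_of_basicOpen_eq_bot {Ω : Type u} [Field Ω] (w : Spec (.of Ω) ⟶ X)
    (h : Γ(X, ⊤)) (h0 : X.basicOpen h = ⊥) : evalTop w h = 0 := by
  have h1 : (Spec (.of Ω)).basicOpen (w.appTop.hom h) = ⊥ := by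
    have h2 := w.preimage_basicOpen (U := ⊤) h
    rw [h0] at h2
    exact h2.symm
  rw [basicOpen_eq_bot_iff] at h1
  change (Scheme.ΓSpecIso (.of Ω)).hom.hom (w.appTop.hom h) = 0
  rw [h1, map_zero]

/-- For the geometric fibre only irreducibility is assumed, not reducedness. Hence a function with
empty nonvanishing locus takes the place of the zero function. -/
lemma exists_basicOpen_eq_bot_of_prod [IrreducibleSpace X] (s : Multiset Γ(X, ⊤))
    (h0 : X.basicOpen s.prod = ⊥) : ∃ h ∈ s, X.basicOpen h = ⊥ := by
  induction s using Multiset.induction with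
  | empty =>
    rw [Multiset.prod_zero, Scheme.basicOpen_of_isUnit _ isUnit_one] at h0
    exact absurd h0 top_ne_bot
  | cons a s ih =>
    rw [Multiset.prod_cons, Scheme.basicOpen_mul] at h0
    by_cases ha : X.basicOpen a = ⊥
    · exact ⟨a, Multiset.mem_cons_self _ _, ha⟩
    by_cases hs : X.basicOpen s.prod = ⊥
    · obtain ⟨h, hh, h1⟩ := ih hs
      exact ⟨h, Multiset.mem_cons_of_mem hh, h1⟩
    rw [← ne_eq, TopologicalSpace.Opens.ne_bot_iff_nonempty] at ha hs
    have := nonempty_preirreducible_inter (X.basicOpen a).isOpen (X.basicOpen s.prod).isOpen ha hs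
    rw [← TopologicalSpace.Opens.coe_inf, h0] at this
    exact absurd this Set.not_nonempty_empty

open Polynomial in
/-- A function on a curve that is algebraic over the base is constant. -/
lemma exists_forall_evalTop_eq_of_aeval_eq_zero {F : Type u} [Field F] [Algebra R F]
    {π : X ⟶ Spec (.of R)} (hX : IsGeomIrredCurve F π) {Ω : Type u} [Field Ω]
    [Algebra R Ω] [Algebra F Ω] [IsScalarTower R F Ω] [IsAlgClosed Ω]
    (hRΩ : Function.Injective (algebraMap R Ω)) (g : Γ(X, ⊤)) {μ : R[X]} (hμ : μ ≠ 0)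
    (hμg : μ.eval₂ (structureMap π ⊤) g = 0) :
    ∃ c : Ω, ∀ z : Point Ω π, evalTop z.1 g = c := by
  have hgi := hX.geometricallyIrreducible
  let Y := pullback (genericFibreMap F π) (Spec.map (CommRingCat.ofHom (algebraMap F Ω)))
  have hY : IrreducibleSpace Y := GeometricallyIrreducible.irreducibleSpace_of_subsingleton
    (f := pullback.snd (genericFibreMap F π) (Spec.map (CommRingCat.ofHom (algebraMap F Ω))))
  let q : Y ⟶ Spec (.of Ω) := pullback.snd _ _
  let t : Y ⟶ X := pullback.fst _ _ ≫ genericFibreProj F π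
  have htq : t ≫ π = q ≫ Spec.map (CommRingCat.ofHom (algebraMap R Ω)) := by
    rw [IsScalarTower.algebraMap_eq R F Ω, CommRingCat.ofHom_comp, Spec.map_comp,
      ← Category.assoc q, ← pullback.condition, Category.assoc, Category.assoc, pullback.condition]
  let : Algebra Ω Γ(Y, ⊤) := (structureMap q ⊤).toAlgebra
  have h1 : aeval (t.appTop.hom g) (μ.map (algebraMap R Ω)) = 0 := by
    have h2 := congrArg t.appTop.hom hμg
    rw [map_zero, hom_eval₂] at h2
    rw [aeval_def, eval₂_map, ← h2]
    congr 1
    ext r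
    exact (appTop_structureMap_of_comp_eq π (algebraMap R Ω) t q htq r).symm
  -- On the irreducible base change to Ω, μ(g) = 0 splits into factors g - c'. One of them has empty
  -- nonvanishing locus, so g has the value c' at every Ω-point.
  have hsp := IsAlgClosed.splits (μ.map (algebraMap R Ω))
  have hlead : (μ.map (algebraMap R Ω)).leadingCoeff ≠ 0 :=
    leadingCoeff_ne_zero.mpr ((Polynomial.map_ne_zero_iff hRΩ).mpr hμ)
  rw [hsp.eq_prod_roots, map_mul, aeval_C, (hlead.isUnit.map _).mul_right_eq_zero,
    map_multiset_prod, Multiset.map_map] at h1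
  obtain ⟨h, hh, hbot⟩ := exists_basicOpen_eq_bot_of_prod _ (h1 ▸ Y.basicOpen_zero ⊤)
  obtain ⟨c', -, rfl⟩ := Multiset.mem_map.mp hh
  refine ⟨c', fun z => ?_⟩
  let w : Spec (.of Ω) ⟶ Y := pullback.lift (pullback.lift z.1
    (Spec.map (CommRingCat.ofHom (algebraMap F Ω))) (by
      rw [z.2, ← Spec.map_comp, ← CommRingCat.ofHom_comp, ← IsScalarTower.algebraMap_eq]))
    (𝟙 _) ((pullback.lift_snd _ _ _).trans (Category.id_comp _).symm)
  have hwt : w ≫ t = z.1 := by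
    rw [← Category.assoc, pullback.lift_fst]
    exact pullback.lift_fst _ _ _
  have hwq : w ≫ q = Spec.map (CommRingCat.ofHom (RingHom.id Ω)) := by
    rw [CommRingCat.ofHom_id, Spec.map_id]
    exact pullback.lift_snd _ _ _
  have h3 := evalTop_eq_zero_of_basicOpen_eq_bot w _ hbot
  rw [Function.comp_apply, map_sub, aeval_X, aeval_C, map_sub, ← evalTop_comp, hwt] at h3
  change _ - evalTop w (structureMap q ⊤ c') = 0 at h3
  rwa [evalTop_structureMap q w _ hwq, sub_eq_zero] at h3

open Polynomial in
/-- A function on a curve that is not constantly equal to `c` takes the value `c` finitely often. -/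
lemma finite_setOf_evalTop_eq [IsDomain R] {F : Type u} [Field F] [Algebra R F]
    [IsFractionRing R F] {π : X ⟶ Spec (.of R)} (hX : IsGeomIrredCurve F π) {Ω : Type u} [Field Ω]
    [Algebra R Ω] [Algebra F Ω] [IsScalarTower R F Ω] [IsAlgClosed Ω] [Algebra.IsAlgebraic F Ω]
    (g : Γ(X, ⊤)) (c : Ω) (h0 : ∃ z : Point Ω π, evalTop z.1 g ≠ c) :
    {z : Point Ω π | evalTop z.1 g = c}.Finite := by
  have hRF := IsFractionRing.injective R F
  have : FaithfulSMul R F := (faithfulSMul_iff_algebraMap_injective _ _).mpr hRF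
  have hRΩ : Function.Injective (algebraMap R Ω) := by
    rw [IsScalarTower.algebraMap_eq R F Ω]
    exact (algebraMap F Ω).injective.comp hRF
  have : FaithfulSMul R Ω := (faithfulSMul_iff_algebraMap_injective _ _).mpr hRΩ
  have : Algebra.IsAlgebraic R F := IsLocalization.isAlgebraic F (nonZeroDivisors R)
  have : Algebra.IsAlgebraic R Ω := Algebra.IsAlgebraic.trans R F Ω
  obtain ⟨μ, hμ, hμc⟩ := Algebra.IsAlgebraic.isAlgebraic (R := R) c
  let : Algebra R Γ(X, ⊤) := (structureMap π ⊤).toAlgebra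
  have hev : ∀ z : Point Ω π, evalTop z.1 (aeval g μ) = aeval (evalTop z.1 g : Ω) μ := by
    intro z
    let e : Γ(X, ⊤) →ₐ[R] Ω :=
      { evalTop z.1 with commutes' := evalTop_structureMap π z.1 _ z.2 }
    exact (aeval_algHom_apply e g μ).symm
  -- Here μ is a nonzero polynomial over R killing c. If μ(g) ≠ 0, the level set lies in its finite
  -- zero set. Otherwise g is constant, and its constant value is not c.
  by_cases hμg : aeval g μ = 0
  swap
  · refine (finite_setOf_evalTop_eq_zero hX hμg Ω).subset fun z hz => ?_
    have hz' : evalTop z.1 g = c := hz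
    change evalTop z.1 (aeval g μ) = 0
    rw [hev, hz']
    exact hμc
  obtain ⟨c', hconst⟩ := exists_forall_evalTop_eq_of_aeval_eq_zero hX hRΩ g hμ hμg
  obtain ⟨z₀, hz₀⟩ := h0
  refine Set.finite_empty.subset fun z hz => hz₀ ?_
  rw [hconst, ← hconst z]
  exact hz

end Dimension

/-! ### Monomials in the coordinate functions -/

section Monomial

variable {X : Scheme.{u}} {n : ℕ}

/-- The monomial with exponent vector `a` in the invertible functions `f_1, …, f_n`. -/
def monomial (f : Fin n → Γ(X, ⊤)ˣ) (a : Fin n → ℤ) : Γ(X, ⊤)ˣ := ∏ i, f i ^ a i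

lemma evalTop_monomial {R : Type u} [CommRing R] {F : Type u} [Field F] [Algebra R F]
    {π : X ⟶ Spec (.of R)} (z : Point F π) (f : Fin n → Γ(X, ⊤)ˣ) (a : Fin n → ℤ) :
    evalTop z.1 (monomial f a : Γ(X, ⊤)) = ((character a (z.coords f) : Fˣ) : F) := by
  have h : Units.map ((evalTop z.1 : Γ(X, ⊤) →+* F) : Γ(X, ⊤) →* F) (monomial f a) =
      character a (z.coords f) := by
    rw [monomial, map_prod, character]
    exact Finset.prod_congr rfl fun i _ => map_zpow _ _ _
  exact congrArg Units.val h

end Monomial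

/-! ### Finiteness of torsion on the curve and the exceptional set -/

section Finiteness

variable {X : Scheme.{u}} {R : Type u} [CommRing R] {π : X ⟶ Spec (.of R)} {n : ℕ}
  {Ω : Type u} [Field Ω] [Algebra R Ω] {f : Fin n → Γ(X, ⊤)ˣ}

lemma NotInTranslate.exists_character_ne [IsAlgClosed Ω] (h : NotInTranslate Ω π f) {a : Fin n → ℤ} (ha : a ≠ 0)
    (c : Ωˣ) : ∃ z : Point Ω π, character a (z.coords f) ≠ c := by
  have hli : LinearIndependent ℤ (fun _ : Fin 1 => a) := by
    rw [linearIndependent_unique_iff]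
    exact ha
  obtain ⟨y, hy⟩ := torusHom_surjective_of_linearIndependent _ hli (fun _ => c)
  have hy0 : character a y = c := congrFun hy 0
  obtain ⟨z, hz⟩ := h (Submodule.span ℤ {a}) (by simpa using ha) y
  refine ⟨z, fun hza => hz ?_⟩
  intro b hb
  obtain ⟨k, rfl⟩ := Submodule.mem_span_singleton.mp hb
  rw [character_smul, character_mul, character_inv, hy0, hza, inv_mul_cancel, one_zpow]

/-- On a curve not contained in a translate of a proper subgroup, two independent characters are
simultaneously torsion at finitely many points. -/
lemma finite_setOf_isOfFinOrder_character [IsAlgClosed Ω] [IsDomain R] {F : Type u} [Field F] [Algebra R F]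
    [IsFractionRing R F] (hX : IsGeomIrredCurve F π) [Algebra F Ω] [IsScalarTower R F Ω]
    [Algebra.IsAlgebraic F Ω] [CharZero Ω] (h : NotInTranslate Ω π f) {a b : Fin n → ℤ}
    (hab : LinearIndependent ℤ ![a, b]) :
    {z : Point Ω π | IsOfFinOrder (character a (z.coords f)) ∧
      IsOfFinOrder (character b (z.coords f))}.Finite := by
  have hRΩ : Function.Injective (algebraMap R Ω) := by
    rw [IsScalarTower.algebraMap_eq R F Ω]
    exact (algebraMap F Ω).injective.comp (IsFractionRing.injective R F)
  obtain ⟨Q, hQ, hQ0⟩ := exists_relation hX (monomial f a : Γ(X, ⊤)) (monomial f b : Γ(X, ⊤))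
  obtain ⟨B, hB, hBQ⟩ := exists_exponentDifference_zpow_eq_one hRΩ hQ
  have : NeZero B := ⟨hB.ne'⟩
  -- A fixed relation Q links f^a and f^b. At torsion values Mann's theorem makes some monomial in
  -- them a B-th root of unity; its exponent vector e.1 • a + e.2 • b is nonzero by independence, so
  -- each level set is finite.
  have hfin : (⋃ e ∈ exponentDifferences Q, ⋃ c : rootsOfUnity B Ω,
      {z : Point Ω π | evalTop z.1 (monomial f (e.1 • a + e.2 • b) : Γ(X, ⊤)) =
        ((c : Ωˣ) : Ω)}).Finite := by
    refine (exponentDifferences Q).finite_toSet.biUnion fun e he => Set.finite_iUnion fun c => ?_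
    refine finite_setOf_evalTop_eq hX _ _ ?_
    have hne : e.1 • a + e.2 • b ≠ 0 := by
      intro h0
      have := LinearIndependent.pair_iff.mp hab _ _ h0
      exact ne_zero_of_mem_exponentDifferences he (Prod.ext this.1 this.2)
    obtain ⟨z, hz⟩ := h.exists_character_ne hne c
    exact ⟨z, fun h1 => hz (Units.ext (by rw [← evalTop_monomial, h1]))⟩
  refine hfin.subset ?_
  rintro z ⟨hza, hzb⟩
  have h0 := hQ0 Ω z.1 z.2
  rw [evalTop_monomial, evalTop_monomial] at h0
  obtain ⟨e, he, heB⟩ := hBQ _ _ hza hzb h0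
  refine Set.mem_biUnion he (Set.mem_iUnion.mpr ⟨⟨_, (mem_rootsOfUnity B _).mpr heB⟩, ?_⟩)
  change evalTop z.1 (monomial f (e.1 • a + e.2 • b) : Γ(X, ⊤)) = _
  rw [evalTop_monomial, character_add, character_smul, character_smul]

lemma mem_unitsOf_valuationSubring {V : ValuationSubring Ω} {u : Ωˣ} :
    u ∈ unitsOf V.toSubring ↔ V.valuation (u : Ω) = 1 := by
  rw [mem_unitsOf_iff]
  change (u : Ω) ∈ V ∧ ((u⁻¹ : Ωˣ) : Ω) ∈ V ↔ _
  rw [← V.valuation_le_one_iff, ← V.valuation_le_one_iff, Units.val_inv_eq_inv_val, map_inv₀]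
  have h0 : V.valuation (u : Ω) ≠ 0 := (map_ne_zero _).mpr u.ne_zero
  rw [inv_le_one₀ (zero_lt_iff.mpr h0)]
  exact le_antisymm_iff.symm

lemma zpow_mem_unitsOf_valuationSubring (V : ValuationSubring Ω) (u : Ωˣ) (k : ℤ) (hk : k ≠ 0)
    (h : u ^ k ∈ unitsOf V.toSubring) : u ∈ unitsOf V.toSubring := by
  refine zpow_mem_unitsOf (fun y k hk h => ?_) u k hk h
  change y ∈ V
  change y ^ k ∈ V at h
  rw [← V.valuation_le_one_iff, map_pow] at h
  rw [← V.valuation_le_one_iff]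
  exact (pow_le_one_iff hk.ne').mp h

/-- Away from finitely many bad coefficients and finitely many points, the coordinates of a point
of a curve in a subgroup of codimension two are units. -/
theorem exists_finite_exceptional_set [IsAlgClosed Ω] [IsDomain R] {F : Type u} [Field F] [Algebra R F]
    [IsFractionRing R F] (hX : IsGeomIrredCurve F π) [Algebra F Ω] [IsScalarTower R F Ω]
    [Algebra.IsAlgebraic F Ω] [CharZero Ω] {f : Fin 3 → Γ(X, ⊤)ˣ} (h : NotInTranslate Ω π f) :
    ∃ (D : Finset R) (Z : Set (Point Ω π)), Z.Finite ∧ (∀ d ∈ D, d ≠ 0) ∧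
      ∀ V : ValuationSubring Ω, (∀ d ∈ D, V.valuation (algebraMap R Ω d) = 1) →
        ∀ z : Point Ω π, z.coords f ∈ special Ω 3 2 → ∀ i, z.coords f i ∉ unitsOf V.toSubring →
          z ∈ Z := by
  classical
  choose Q hQ hQ0 using fun i j => exists_relation hX (f i : Γ(X, ⊤)) (f j : Γ(X, ⊤))
  -- D collects the coefficients that have to be units, E the characters that can then become
  -- torsion, and Z the points where two independent members of E are torsion.
  let D : Finset R := Finset.univ.biUnion fun ij : Fin 3 × Fin 3 =>
    (exponents (Q ij.1 ij.2)).image fun t => ((Q ij.1 ij.2).coeff t.1).coeff t.2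
  let vec : Fin 3 → Fin 3 → ℤ × ℤ → Fin 3 → ℤ := fun i j e => Pi.single i e.1 + Pi.single j e.2
  let E : Finset (Fin 3 → ℤ) := Finset.univ.biUnion fun ij : Fin 3 × Fin 3 =>
    (exponentDifferences (Q ij.1 ij.2)).image (vec ij.1 ij.2)
  let Z : Set (Point Ω π) := ⋃ ab ∈ {ab ∈ E ×ˢ E | LinearIndependent ℤ ![ab.1, ab.2]},
    {z : Point Ω π | IsOfFinOrder (character ab.1 (z.coords f)) ∧
      IsOfFinOrder (character ab.2 (z.coords f))}
  refine ⟨D, Z, ?_, ?_, ?_⟩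
  · exact Set.Finite.biUnion (Finset.finite_toSet _) fun ab hab =>
      finite_setOf_isOfFinOrder_character hX h (Finset.mem_filter.mp hab).2
  · intro d hd
    obtain ⟨ij, -, hd⟩ := Finset.mem_biUnion.mp hd
    obtain ⟨t, ht, rfl⟩ := Finset.mem_image.mp hd
    exact mem_exponents.mp ht
  intro V hV z hz i hi
  have key : ∀ k l, ∃ e : ℤ × ℤ, e ≠ 0 ∧ vec k l e ∈ E ∧
      IsOfFinOrder (character (vec k l e) (z.coords f)) := by
    intro k l
    obtain ⟨e, he, hev⟩ := exists_exponentDifference_mem_valuationSubring V (hQ k l)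
      (fun t ht => hV _ (Finset.mem_biUnion.mpr ⟨(k, l), Finset.mem_univ _,
        Finset.mem_image.mpr ⟨t, ht, rfl⟩⟩)) (z.coords f k) (z.coords f l) (hQ0 k l Ω z.1 z.2)
    refine ⟨e, ne_zero_of_mem_exponentDifferences he, Finset.mem_biUnion.mpr
      ⟨(k, l), Finset.mem_univ _, Finset.mem_image.mpr ⟨e, he, rfl⟩⟩, ?_⟩
    refine isOfFinOrder_character_of_mem_special (zpow_mem_unitsOf_valuationSubring V) hz hi ?_
    rw [mem_unitsOf_valuationSubring, ← hev, character_add,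
      show (Pi.single k e.1 : Fin 3 → ℤ) = e.1 • Pi.single k 1 by simp [← Pi.single_smul],
      show (Pi.single l e.2 : Fin 3 → ℤ) = e.2 • Pi.single l 1 by simp [← Pi.single_smul],
      character_smul, character_smul, character_single, character_single]
  have conclude : ∀ a b : Fin 3 → ℤ, a ∈ E → b ∈ E → LinearIndependent ℤ ![a, b] →
      IsOfFinOrder (character a (z.coords f)) → IsOfFinOrder (character b (z.coords f)) →
      z ∈ Z := fun a b ha hb hab hza hzb =>
    Set.mem_biUnion (x := (a, b)) (Finset.mem_filter.mpr ⟨Finset.mem_product.mpr ⟨ha, hb⟩, hab⟩)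
      ⟨hza, hzb⟩
  obtain ⟨e, he0, heE, he⟩ := key 0 1
  obtain ⟨e', he0', heE', he'⟩ := key 0 2
  obtain ⟨e'', he0'', heE'', he''⟩ := key 1 2
  have h1 : ∀ e : ℤ × ℤ, e ≠ 0 → e.1 ≠ 0 ∨ e.2 ≠ 0 := fun e he => by
    by_contra! hc
    exact he (Prod.ext hc.1 hc.2)
  -- The vectors from the pairs (0,1) and (0,2) are dependent only if both are multiples of the
  -- first basis vector. In that case the vector from (1,2), which does not involve coordinate 0,
  -- replaces the second one.
  by_cases hc : e.2 = 0 ∧ e'.2 = 0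
  · refine conclude _ _ heE heE'' (LinearIndependent.pair_iff.mpr fun s t hst => ?_) he he''
    have e0 := congrFun hst 0
    have e1 := congrFun hst 1
    have e2 := congrFun hst 2
    simp [vec, hc.1] at e0 e1 e2
    have h2 := h1 e he0
    have h3 := h1 e'' he0''
    clear * - hc e0 e1 e2 h2 h3
    have hs : s = 0 := by tauto
    exact ⟨hs, by tauto⟩
  · refine conclude _ _ heE heE' (LinearIndependent.pair_iff.mpr fun s t hst => ?_) he he'
    have e0 := congrFun hst 0
    have e1 := congrFun hst 1
    have e2 := congrFun hst 2
    simp [vec] at e0 e1 e2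
    have h2 := h1 e he0
    have h3 := h1 e' he0'
    clear * - hc e0 e1 e2 h2 h3
    rcases e1 with rfl | e1
    · simp only [zero_mul, zero_add, mul_eq_zero] at e0
      exact ⟨rfl, by tauto⟩
    · have ht : t = 0 := by tauto
      simp only [ht, zero_mul, add_zero, mul_eq_zero] at e0
      exact ⟨by tauto, ht⟩

end Finiteness

/-! ### Number fields: points with T-unit coordinates -/

section NumberField

open NumberField IsDedekindDomain

variable {K : Type u} [Field K] [NumberField K]

lemma isFractionRing_integer (S : Set (HeightOneSpectrum (𝓞 K))) :
    IsFractionRing (S.integer K) K := by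
  refine IsFractionRing.of_field _ _ fun z => ?_
  obtain ⟨x, y, -, rfl⟩ := IsFractionRing.div_surjective (A := 𝓞 K) z
  exact ⟨algebraMap (𝓞 K) (S.integer K) x, algebraMap (𝓞 K) (S.integer K) y, rfl⟩

lemma algebraMap_mem_Tbar {T : Set (HeightOneSpectrum (𝓞 K))} {x : K} (hx : x ∈ T.integer K) :
    algebraMap K (AlgebraicClosure K) x ∈ Tbar T :=
  (Tbar T).algebraMap_mem ⟨x, hx⟩

instance isIntegrallyClosedIn_Tbar (T : Set (HeightOneSpectrum (𝓞 K))) :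
    IsIntegrallyClosedIn (Tbar T).toSubring (AlgebraicClosure K) :=
  inferInstanceAs (IsIntegrallyClosedIn (Tbar T) (AlgebraicClosure K))

/-- An integrally closed subring of a field is the intersection of the valuation rings containing
it; apply this to y or to its inverse. -/
lemma exists_valuationSubring_of_notMem_unitsOf_Tbar {T : Set (HeightOneSpectrum (𝓞 K))}
    {y : (AlgebraicClosure K)ˣ} (hy : y ∉ unitsOf (Tbar T).toSubring) :
    ∃ V : ValuationSubring (AlgebraicClosure K),
      (Tbar T).toSubring ≤ V.toSubring ∧ y ∉ unitsOf V.toSubring := by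
  rw [mem_unitsOf_iff, not_and_or] at hy
  rcases hy with hy | hy <;>
  obtain ⟨V, hV, hyV⟩ := Subring.exists_le_valuationSubring_of_isIntegrallyClosedIn hy
  · exact ⟨V, hV, fun h => hyV (mem_unitsOf_iff.mp h).1⟩
  · exact ⟨V, hV, fun h => hyV (mem_unitsOf_iff.mp h).2⟩

/-- All but finitely many points of a curve lying in a subgroup of codimension two have unit
coordinates outside of a finite set of primes. -/
theorem exists_finite_setOf_primes {S : Set (HeightOneSpectrum (𝓞 K))} (hS : S.Finite)
    {X : Scheme.{u}} {π : X ⟶ Spec (.of (S.integer K))} {f : Fin 3 → Γ(X, ⊤)ˣ}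
    (hX : IsGeomIrredCurve K π) (h : NotInTranslate (AlgebraicClosure K) π f) :
    ∃ T₁ : Set (HeightOneSpectrum (𝓞 K)), T₁.Finite ∧ S ⊆ T₁ ∧
      ∃ Z : Set (Point (AlgebraicClosure K) π), Z.Finite ∧ ∀ T, T₁ ⊆ T →
        ∀ z : Point (AlgebraicClosure K) π, z.coords f ∈ special (AlgebraicClosure K) 3 2 →
          (∃ i, z.coords f i ∉ unitsOf (Tbar T).toSubring) → z ∈ Z := by
  have := isFractionRing_integer S
  obtain ⟨D, Z, hZ, hD, hDZ⟩ := exists_finite_exceptional_set hX h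
  -- At primes outside `bad d` both d and d⁻¹ are integral, so d becomes a unit of every valuation
  -- ring containing the T-integers once T contains `bad d`.
  let bad : S.integer K → Set (HeightOneSpectrum (𝓞 K)) := fun d =>
    HeightOneSpectrum.Support (𝓞 K) (d : K) ∪ HeightOneSpectrum.Support (𝓞 K) (d : K)⁻¹
  refine ⟨S ∪ ⋃ d ∈ D, bad d, hS.union (D.finite_toSet.biUnion fun d _ =>
    (HeightOneSpectrum.Support.finite _ _).union (HeightOneSpectrum.Support.finite _ _)),
    Set.subset_union_left, Z, hZ, ?_⟩
  rintro T hT z hz ⟨i, hi⟩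
  obtain ⟨V, hV, hiV⟩ := exists_valuationSubring_of_notMem_unitsOf_Tbar hi
  refine hDZ V (fun d hd => ?_) z hz i hiV
  have hd0 : (d : K) ≠ 0 := fun h0 => hD d hd (Subtype.ext h0)
  have hmem : ∀ x : K, HeightOneSpectrum.Support (𝓞 K) x ⊆ T →
      algebraMap K (AlgebraicClosure K) x ∈ V := fun x hx =>
    hV (algebraMap_mem_Tbar fun v hv => not_lt.mp fun hlt => hv (hx hlt))
  have hbad : bad d ⊆ T := (Set.subset_biUnion_of_mem (u := bad) hd).trans
    (Set.subset_union_right.trans hT)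
  have h1 := hmem _ (Set.subset_union_left.trans hbad)
  have h2 := hmem _ (Set.subset_union_right.trans hbad)
  rw [map_inv₀] at h2
  have hne : algebraMap K (AlgebraicClosure K) (d : K) ≠ 0 := (map_ne_zero _).mpr hd0
  have h3 : Units.mk0 _ hne ∈ unitsOf V.toSubring := mem_unitsOf_iff.mpr ⟨h1, h2⟩
  exact mem_unitsOf_valuationSubring.mp h3

end NumberField

/-! ### Local rings inside the function field and extension in codimension two -/

section Stalks

variable {C : Scheme.{u}}

lemma genericPoint_mem [IrreducibleSpace C] {V : C.Opens} {y : C} (hy : y ∈ V) :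
    genericPoint C ∈ V :=
  ((genericPoint_spec C).mem_open_set_iff V.isOpen).mpr ⟨y, trivial, hy⟩

/-- The local ring of an integral scheme at a point, as a subring of the function field. -/
abbrev stalkRange [IsIntegral C] (y : C) : Subring C.functionField :=
  (algebraMap (C.presheaf.stalk y) C.functionField).range

lemma mem_stalkRange_iff [IsIntegral C] {y : C} {h : C.functionField} :
    h ∈ stalkRange y ↔ ∃ (V : C.Opens) (_ : IsAffineOpen V) (hy : y ∈ V) (g : Γ(C, V)),
      (C.presheaf.germ V (genericPoint C) (genericPoint_mem hy)).hom g = h := by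
  constructor
  · rintro ⟨t, rfl⟩
    obtain ⟨W, hyW, g, rfl⟩ := C.presheaf.exists_germ_eq t
    obtain ⟨_, ⟨V, hV, rfl⟩, hyV, hVW⟩ :=
      C.isBasis_affineOpens.exists_subset_of_mem_open hyW W.isOpen
    refine ⟨V, hV, hyV, resOpen hVW g, ?_⟩
    have : Nonempty W := ⟨⟨y, hyW⟩⟩
    have h1 := Scheme.algebraMap_germ_eq_germToFunctionField C hyW g
    rw [h1]
    exact C.presheaf.germ_res_apply (homOfLE hVW) _ _ g
  · rintro ⟨V, -, hy, g, rfl⟩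
    have : Nonempty V := ⟨⟨y, hy⟩⟩
    exact ⟨C.presheaf.germ V y hy g, Scheme.algebraMap_germ_eq_germToFunctionField C hy g⟩

lemma exists_fromSpecStalk_eq {x y : C} (h : y ⤳ x) : ∃ q, C.fromSpecStalk x q = y := by
  have : y ∈ Set.range (C.fromSpecStalk x) := by
    rw [Scheme.range_fromSpecStalk]; exact h
  exact this

lemma fromSpecStalk_specializes (x : C) (q) : C.fromSpecStalk x q ⤳ x := by
  have : C.fromSpecStalk x q ∈ Set.range (C.fromSpecStalk x) := ⟨q, rfl⟩
  rwa [Scheme.range_fromSpecStalk] at this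

/-- The local ring at a generization of x is the localisation of the one at x at the corresponding
prime, so h is a fraction with denominator outside that prime. -/
lemma exists_notMem_mul_mem_stalkRange [IsIntegral C] {x : C}
    (q : PrimeSpectrum (C.presheaf.stalk x)) {h : C.functionField}
    (hh : h ∈ stalkRange (C.fromSpecStalk x q)) :
    ∃ s ∉ q.asIdeal, algebraMap _ C.functionField s * h ∈ stalkRange x := by
  obtain ⟨V, hV, hxV⟩ := exists_isAffineOpen_mem x
  set y := C.fromSpecStalk x q with hy
  have hyV : y ∈ V := (fromSpecStalk_specializes x q).mem_open V.isOpen hxV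
  have : Nonempty V := ⟨⟨x, hxV⟩⟩
  obtain ⟨t, rfl⟩ := hh
  let := TopCat.Presheaf.algebra_section_stalk C.presheaf (⟨y, hyV⟩ : V)
  have hloc : IsLocalization.AtPrime (C.presheaf.stalk y) (hV.primeIdealOf ⟨y, hyV⟩).asIdeal :=
    hV.isLocalization_stalk ⟨y, hyV⟩
  obtain ⟨⟨a, s⟩, hs⟩ := IsLocalization.surj (hV.primeIdealOf ⟨y, hyV⟩).asIdeal.primeCompl t
  change t * C.presheaf.germ V y hyV s.1 = C.presheaf.germ V y hyV a at hs
  refine ⟨C.presheaf.germ V x hxV s.1, ?_, ⟨C.presheaf.germ V x hxV a, ?_⟩⟩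
  · have hu : IsUnit (C.presheaf.germ V y hyV s.1) :=
      IsLocalization.map_units (C.presheaf.stalk y) s
    have hyb : y ∈ C.basicOpen s.1 := (C.mem_basicOpen s.1 y hyV).mpr hu
    have h1 : (Spec.map (C.presheaf.germ V x hxV) q) ∈ hV.fromSpec ⁻¹ᵁ C.basicOpen s.1 := by
      change hV.fromSpecStalk hxV q ∈ C.basicOpen s.1
      rw [hV.fromSpecStalk_eq_fromSpecStalk hxV]
      exact hyb
    rw [hV.fromSpec_preimage_basicOpen] at h1
    exact h1
  · have h1 := congrArg (algebraMap _ C.functionField) hs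
    rw [map_mul, Scheme.algebraMap_germ_eq_germToFunctionField,
      Scheme.algebraMap_germ_eq_germToFunctionField] at h1
    rw [Scheme.algebraMap_germ_eq_germToFunctionField,
      Scheme.algebraMap_germ_eq_germToFunctionField, ← h1, mul_comm]

lemma eq_genericPoint_of_fromSpecStalk_bot [IsIntegral C] (x : C) :
    C.fromSpecStalk x (⊥ : PrimeSpectrum (C.presheaf.stalk x)) = genericPoint C := by
  obtain ⟨q, hq⟩ := exists_fromSpecStalk_eq ((genericPoint_spec C).specializes (Set.mem_univ x))
  have h1 : (⊥ : PrimeSpectrum (C.presheaf.stalk x)) ⤳ q :=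
    (PrimeSpectrum.le_iff_specializes _ _).mp bot_le
  have h2 := h1.map (C.fromSpecStalk x).continuous
  rw [hq] at h2
  exact h2.antisymm ((genericPoint_spec C).specializes (Set.mem_univ _)) |>.eq

/-- A rational function on a normal scheme, regular at all proper generizations of a point of
codimension at least two, is regular at that point. -/
lemma mem_stalkRange_of_forall_specializes [IsIntegral C] [IsLocallyNoetherian C] {x η : C}
    [IsIntegrallyClosed (C.presheaf.stalk x)] (hη : η ⤳ x) (hηx : η ≠ x)
    (hη0 : η ≠ genericPoint C) {h : C.functionField}
    (hh : ∀ y, y ⤳ x → y ≠ x → h ∈ stalkRange y) : h ∈ stalkRange x := by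
  obtain ⟨P, hP⟩ := exists_fromSpecStalk_eq hη
  have hcl : C.fromSpecStalk x (IsLocalRing.closedPoint _) = x := Scheme.fromSpecStalk_closedPoint
  refine mem_range_algebraMap_of_forall_mul_mem P.2 ?_ ?_ h ?_
  · intro h0
    refine hη0 ?_
    rw [← hP, ← eq_genericPoint_of_fromSpecStalk_bot x]
    congr 1
    exact PrimeSpectrum.ext h0
  · intro h0
    refine hηx ?_
    have h1 : P = IsLocalRing.closedPoint (C.presheaf.stalk x) := PrimeSpectrum.ext h0
    rw [← hP, h1, hcl]
  · intro q hqp hq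
    obtain ⟨s, hs, hsh⟩ := exists_notMem_mul_mem_stalkRange ⟨q, hqp⟩
      (hh (C.fromSpecStalk x ⟨q, hqp⟩) (fromSpecStalk_specializes x _) fun h0 => hq (by
        have h1 : (⟨q, hqp⟩ : PrimeSpectrum _) = IsLocalRing.closedPoint _ :=
          (C.fromSpecStalk x).isEmbedding.injective (h0.trans hcl.symm)
        exact congrArg PrimeSpectrum.asIdeal h1))
    exact ⟨s, hs, hsh⟩

end Stalks

/-! ### Evaluating functions defined on open subsets -/

section LocalEvaluation

variable {X Y : Scheme.{u}}

/-- Evaluation of a function on an open subset `V` along a morphism `Spec B ⟶ X` with image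
in `V`. -/
def evalOn {B : CommRingCat.{u}} (w : Spec B ⟶ X) (V : X.Opens) (h : ⊤ ≤ w ⁻¹ᵁ V) :
    Γ(X, V) →+* B :=
  (w.appLE V ⊤ h ≫ (Scheme.ΓSpecIso B).hom).hom

lemma evalOn_res {B : CommRingCat.{u}} (w : Spec B ⟶ X) {U V : X.Opens} (hUV : U ≤ V)
    (h : ⊤ ≤ w ⁻¹ᵁ U) (g : Γ(X, V)) :
    evalOn w U h (resOpen hUV g) = evalOn w V (h.trans (w.preimage_mono hUV)) g := by
  have h1 := w.map_appLE h (homOfLE hUV).op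
  exact congrArg (fun q => (Scheme.ΓSpecIso B).hom.hom (q.hom g)) h1

lemma evalOn_comp {B : CommRingCat.{u}} (w : Spec B ⟶ Y) (k : Y ⟶ X) {V : X.Opens}
    (h : ⊤ ≤ (w ≫ k) ⁻¹ᵁ V) (g : Γ(X, V)) :
    evalOn (w ≫ k) V h g = evalOn w (k ⁻¹ᵁ V) h ((k.app V).hom g) := by
  have h1 := Scheme.Hom.comp_appLE w k V ⊤ h
  exact congrArg (fun q => (Scheme.ΓSpecIso B).hom.hom (q.hom g)) h1

lemma evalOn_top {B : CommRingCat.{u}} (w : Spec B ⟶ X) (h) (g : Γ(X, ⊤)) :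
    evalOn w ⊤ h g = evalTop w g := by
  have h1 : w.appLE ⊤ ⊤ h = w.appTop := (w.app_eq_appLE (U := ⊤)).symm
  exact congrArg (fun q => (Scheme.ΓSpecIso B).hom.hom (q.hom g)) h1

lemma evalOn_SpecMap_comp {B B' : CommRingCat.{u}} (φ : B ⟶ B') (w : Spec B ⟶ X) {V : X.Opens}
    (h : ⊤ ≤ w ⁻¹ᵁ V) (h') (g : Γ(X, V)) :
    evalOn (Spec.map φ ≫ w) V h' g = φ.hom (evalOn w V h g) := by
  have h1 := Scheme.Hom.appLE_comp_appLE (Spec.map φ) w V ⊤ ⊤ h le_top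
  have h2 : (Spec.map φ).appLE ⊤ ⊤ le_top = (Spec.map φ).appTop :=
    ((Spec.map φ).app_eq_appLE (U := ⊤)).symm
  rw [h2] at h1
  have h3 := congrArg (fun q => w.appLE V ⊤ h ≫ q) (Scheme.ΓSpecIso_naturality φ)
  simp only [← Category.assoc] at h3
  rw [h1] at h3
  exact congrArg (fun q => q.hom g) h3

lemma evalOn_eq_of_germ_eq [IsIntegral X] {B : CommRingCat.{u}} [Nonempty (Spec B)]
    (w : Spec B ⟶ X) {V V' : X.Opens}
    (h : ⊤ ≤ w ⁻¹ᵁ V) (h' : ⊤ ≤ w ⁻¹ᵁ V') {g : Γ(X, V)} {g' : Γ(X, V')} (hx hx')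
    (hg : (X.presheaf.germ V (genericPoint X) hx).hom g =
      (X.presheaf.germ V' (genericPoint X) hx').hom g') :
    evalOn w V h g = evalOn w V' h' g' := by
  have hxx : genericPoint X ∈ V ⊓ V' := ⟨hx, hx'⟩
  have h1 : resOpen (inf_le_left : V ⊓ V' ≤ V) g = resOpen (inf_le_right : V ⊓ V' ≤ V') g' := by
    apply germ_injective_of_isIntegral X _ hxx
    erw [X.presheaf.germ_res_apply (homOfLE inf_le_left) _ hxx g,
      X.presheaf.germ_res_apply (homOfLE inf_le_right) _ hxx g']
    exact hg
  have h2 : ⊤ ≤ w ⁻¹ᵁ (V ⊓ V') := le_inf h h'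
  rw [← evalOn_res w inf_le_left h2, h1, evalOn_res]

lemma isUnit_evalOn_iff {B : CommRingCat.{u}} [IsLocalRing B] (w : Spec B ⟶ X) {V : X.Opens}
    (h : ⊤ ≤ w ⁻¹ᵁ V) (g : Γ(X, V)) :
    IsUnit (evalOn w V h g) ↔ w (IsLocalRing.closedPoint B) ∈ X.basicOpen g := by
  have h1 : (Spec B).basicOpen (w.appLE V ⊤ h g) = ⊤ ⊓ w ⁻¹ᵁ X.basicOpen g :=
    Scheme.basicOpen_appLE w ⊤ V h g
  rw [basicOpen_eq_of_affine', top_inf_eq] at h1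
  have h2 : w (IsLocalRing.closedPoint B) ∈ X.basicOpen g ↔
      IsLocalRing.closedPoint B ∈ PrimeSpectrum.basicOpen (evalOn w V h g) := by
    change IsLocalRing.closedPoint B ∈ w ⁻¹ᵁ X.basicOpen g ↔ _
    rw [← h1]
    rfl
  rw [h2]
  exact (not_iff_comm.mp (IsLocalRing.mem_maximalIdeal _).symm).symm

end LocalEvaluation

/-! ### Étale schemes over a principal ideal domain -/

section EtaleOverPID

variable {R : Type u} [CommRing R] {D : Scheme.{u}} (q : D ⟶ Spec (.of R))

instance [Etale q] : LocallyQuasiFinite q where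
  quasiFinite_appLE {U} hU {V} hV e := by
    have h1 := FormallyUnramified.formallyUnramified_appLE (f := q) hU hV e
    have h2 := LocallyOfFiniteType.finiteType_appLE (f := q) hU hV e
    algebraize [(q.appLE U V e).hom]
    exact inferInstanceAs (Algebra.QuasiFinite _ _)

lemma exists_maximalIdeal_eq_span_of_isLocalization {R A : Type*} [CommRing R] [CommRing A]
    [Algebra R A] [IsPrincipalIdealRing R] [IsLocalRing A] (P : Ideal R) [P.IsPrime]
    [IsLocalization.AtPrime A P] : ∃ t, IsLocalRing.maximalIdeal A = Ideal.span {t} := by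
  obtain ⟨t, ht⟩ := (IsPrincipalIdealRing.principal P).principal
  refine ⟨algebraMap R A t, ?_⟩
  have ht' : P = Ideal.span {t} := ht
  rw [← IsLocalization.AtPrime.map_eq_maximalIdeal P]
  conv_lhs => rw [ht', Ideal.map_span, Set.image_singleton]

/-- The map is unramified, so the maximal ideal upstairs is generated by the one of the base, which
is principal. -/
lemma exists_maximalIdeal_stalk_eq_span [IsPrincipalIdealRing R] [Etale q] (d : D) :
    ∃ t, IsLocalRing.maximalIdeal (D.presheaf.stalk d) = Ideal.span {t} := by
  let : Algebra ((Spec (.of R)).presheaf.stalk (q d)) (D.presheaf.stalk d) :=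
    (q.stalkMap d).hom.toAlgebra
  have : IsLocalHom (algebraMap ((Spec (.of R)).presheaf.stalk (q d)) (D.presheaf.stalk d)) :=
    inferInstanceAs <| IsLocalHom (q.stalkMap d).hom
  have : Algebra.EssFiniteType ((Spec (.of R)).presheaf.stalk (q d)) (D.presheaf.stalk d) := by
    rw [← RingHom.essFiniteType_algebraMap, RingHom.algebraMap_toAlgebra]
    exact LocallyOfFiniteType.stalkMap q d
  have : Algebra.FormallyUnramified ((Spec (.of R)).presheaf.stalk (q d)) (D.presheaf.stalk d) := by
    rw [← RingHom.formallyUnramified_algebraMap, RingHom.algebraMap_toAlgebra]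
    exact FormallyUnramified.stalkMap q d
  rw [← Algebra.FormallyUnramified.map_maximalIdeal (R := (Spec (.of R)).presheaf.stalk (q d))]
  let : Algebra R ((Spec (.of R)).presheaf.stalk (q d)) := StructureSheaf.stalkAlgebra R _
  let s : PrimeSpectrum R := q d
  have hloc : IsLocalization.AtPrime ((Spec (.of R)).presheaf.stalk (q d)) s.asIdeal :=
    StructureSheaf.IsLocalization.to_stalk R s
  obtain ⟨t, ht⟩ := exists_maximalIdeal_eq_span_of_isLocalization
    (A := (Spec (.of R)).presheaf.stalk (q d)) s.asIdeal
  exact ⟨_, by rw [ht, Ideal.map_span, Set.image_singleton]⟩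

lemma bot_specializes [IsDomain R] (x : PrimeSpectrum R) : (⊥ : PrimeSpectrum R) ⤳ x :=
  (PrimeSpectrum.le_iff_specializes _ _).mp bot_le

/-- Generizations on a scheme étale over a principal ideal domain. -/
lemma exists_specializes_of_etale [IsDomain R] [IsPrincipalIdealRing R] [Etale q] (d : D) :
    ∃ δ : D, δ ⤳ d ∧ q δ = (⊥ : PrimeSpectrum R) ∧ ∀ d', d' ⤳ d → d' = d ∨ d' = δ := by
  -- The stalk has a principal maximal ideal, so its only primes are zero and the maximal ideal:
  -- there is at most one proper generization. If there is none, take d itself.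
  obtain ⟨δ₀, hδ₀, hd⟩ : ∃ δ : D, δ ⤳ d ∧ ∀ d', d' ⤳ d → d' = d ∨ d' = δ := by
    by_cases hex : ∃ δ : D, δ ⤳ d ∧ δ ≠ d
    swap
    · push Not at hex
      exact ⟨d, specializes_rfl, fun d' hd' => Or.inl (hex d' hd')⟩
    obtain ⟨δ, hδ, hδd⟩ := hex
    refine ⟨δ, hδ, fun d' hd' => ?_⟩
    have : IsLocallyNoetherian D := LocallyOfFiniteType.isLocallyNoetherian q
    obtain ⟨t, ht⟩ := exists_maximalIdeal_stalk_eq_span q d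
    have hcl : D.fromSpecStalk d (IsLocalRing.closedPoint _) = d :=
      Scheme.fromSpecStalk_closedPoint
    have key : ∀ e, e ⤳ d → e ≠ d → ∃ P : PrimeSpectrum (D.presheaf.stalk d),
        D.fromSpecStalk d P = e ∧ P.asIdeal = ⊥ := by
      intro e he hed
      obtain ⟨P, hP⟩ := exists_fromSpecStalk_eq he
      refine ⟨P, hP, (prime_eq_bot_or_eq_maximalIdeal ht _ P.2).resolve_right fun h0 => hed ?_⟩
      have h1 : P = IsLocalRing.closedPoint _ := PrimeSpectrum.ext h0
      rw [← hP, h1, hcl]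
    by_cases h' : d' = d
    · exact Or.inl h'
    obtain ⟨P, hP, hP0⟩ := key d' hd' h'
    obtain ⟨P', hP', hP0'⟩ := key δ hδ hδd
    have h1 : P = P' := PrimeSpectrum.ext (hP0.trans hP0'.symm)
    right
    rw [← hP, ← hP', h1]
  refine ⟨δ₀, hδ₀, ?_, hd⟩
  have hbot : (⊥ : PrimeSpectrum R) ⤳ q d := bot_specializes _
  -- Flatness supplies a generization of d over the generic point of the base. It is d or δ₀, and in
  -- both cases δ₀ lies over the generic point.
  obtain ⟨d', hd', hq⟩ := Flat.generalizingMap q hbot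
  rcases hd d' hd' with rfl | rfl
  · have h1 : q δ₀ ⤳ q d' := hδ₀.map q.continuous
    rw [hq] at h1
    exact (h1.antisymm (bot_specializes _)).eq
  · exact hq

lemma finite_preimage_bot_of_etale [IsDomain R] [Etale q] [QuasiCompact q] :
    {δ : D | q δ = (⊥ : PrimeSpectrum R)}.Finite :=
  q.finite_preimage_singleton _

end EtaleOverPID

/-! ### The order function of a discrete valuation ring -/

section Order

/-- The normalised valuation of a noetherian valuation ring that is not a field. -/
lemma exists_order {A M : Type*} [CommRing A] [IsDomain A] [ValuationRing A] [IsNoetherianRing A]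
    (hA : ¬ IsField A) [Field M] [Algebra A M] [IsFractionRing A M] :
    ∃ o : Mˣ →* Multiplicative ℤ,
      ∀ u : Mˣ, 0 ≤ (o u).toAdd ↔ (u : M) ∈ (algebraMap A M).range := by
  have hpid : IsPrincipalIdealRing A := by
    have h1 := (tfae_of_isNoetherianRing_of_isLocalRing_of_isDomain A).out 0 1
    rw [h1]
    infer_instance
  have hdvr : IsDiscreteValuationRing A :=
    { hpid with not_a_field' := fun h => hA (IsLocalRing.isField_iff_maximalIdeal_eq.mpr h) }
  let v := (IsDiscreteValuationRing.maximalIdeal A).valuation M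
  let o' : Mˣ →* Multiplicative ℤ := (WithZero.unitsWithZeroEquiv).toMonoidHom.comp
    (Units.map (v : M →* WithZero (Multiplicative ℤ)))
  have ho' : ∀ u : Mˣ, ((o' u : Multiplicative ℤ) : WithZero (Multiplicative ℤ)) = v u := fun u =>
    WithZero.coe_unzero _
  -- The inverse passes from the multiplicative convention, in which integral means v ≤ 1, to
  -- nonnegative orders.
  refine ⟨o'⁻¹, fun u => ?_⟩
  have h1 : 0 ≤ (o'⁻¹ u).toAdd ↔ v u ≤ 1 := by
    rw [← ho', ← WithZero.coe_one, WithZero.coe_le_coe, MonoidHom.inv_apply, toAdd_inv,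
      ← Multiplicative.toAdd_le, toAdd_one]
    omega
  rw [h1]
  constructor
  · intro h
    obtain ⟨a, ha⟩ := IsDiscreteValuationRing.exists_lift_of_le_one h
    exact ⟨a, ha⟩
  · rintro ⟨a, ha⟩
    rw [← ha]
    exact (IsDiscreteValuationRing.maximalIdeal A).valuation_le_one a

end Order

/-! ### Birational models: the function field and its valuation rings -/

section Birational

variable {X Xt C : Scheme.{u}}

lemma exists_isOpenImmersion_of_birational {ν : Xt ⟶ X}
    (h : ∃ U : X.Opens, (U : Set X).Nonempty ∧ IsIso (ν ∣_ U)) :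
    ∃ (U : X.Opens) (hU : IsAffineOpen U) (k : Spec Γ(X, U) ⟶ Xt),
      Nonempty U ∧ IsOpenImmersion k ∧ k ≫ ν = hU.fromSpec := by
  obtain ⟨W, ⟨x, hxW⟩, hiso⟩ := h
  obtain ⟨_, ⟨U, hU, rfl⟩, hxU, hUW⟩ := X.isBasis_affineOpens.exists_subset_of_mem_open hxW W.isOpen
  have hU' : IsAffineOpen U := hU
  let l : Spec Γ(X, U) ⟶ W := IsOpenImmersion.lift W.ι hU'.fromSpec (by
    rw [hU'.range_fromSpec, Scheme.Opens.range_ι]; exact hUW)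
  have hl : l ≫ W.ι = hU'.fromSpec := IsOpenImmersion.lift_fac _ _ _
  have hlo : IsOpenImmersion l := by
    have : IsOpenImmersion (l ≫ W.ι) := by rw [hl]; infer_instance
    exact IsOpenImmersion.of_comp l W.ι
  refine ⟨U, hU', l ≫ inv (ν ∣_ W) ≫ (ν ⁻¹ᵁ W).ι, ⟨⟨x, hxU⟩⟩, inferInstance, ?_⟩
  rw [Category.assoc, Category.assoc, ← morphismRestrict_ι, IsIso.inv_hom_id_assoc, hl]

variable {R : Type u} [CommRing R] (πC : C ⟶ Spec (.of R))

/-- The structure map of the local ring of an `R`-scheme at a point. -/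
def stalkStructureMap (y : C) : R →+* C.presheaf.stalk y :=
  (C.presheaf.germ ⊤ y trivial).hom.comp (structureMap πC ⊤)

lemma germ_structureMap {U : C.Opens} {y : C} (hy : y ∈ U) (r : R) :
    (C.presheaf.germ U y hy).hom (structureMap πC U r) = stalkStructureMap πC y r := by
  rw [← resOpen_structureMap πC (le_top : U ≤ ⊤)]
  exact C.presheaf.germ_res_apply (homOfLE le_top) _ hy _

lemma algebraMap_stalkStructureMap [IsIntegral C] (y : C) (r : R) :
    algebraMap (C.presheaf.stalk y) C.functionField (stalkStructureMap πC y r) =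
      stalkStructureMap πC (genericPoint C) r := by
  have : Nonempty (⊤ : C.Opens) := ⟨⟨y, trivial⟩⟩
  exact Scheme.algebraMap_germ_eq_germToFunctionField C (U := ⊤) (x := y) trivial _

lemma evalOn_structureMap {B : CommRingCat.{u}} (w : Spec B ⟶ C) {V : C.Opens} (h : ⊤ ≤ w ⁻¹ᵁ V)
    (ρ : R →+* B) (hw : w ≫ πC = Spec.map (CommRingCat.ofHom ρ)) (r : R) :
    evalOn w V h (structureMap πC V r) = ρ r := by
  rw [← resOpen_structureMap πC (le_top : V ≤ ⊤), evalOn_res, evalOn_top,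
    evalTop_structureMap πC w ρ hw]

lemma evalOn_opensRange_injective [IsIntegral C] {A : CommRingCat.{u}} [Nonempty (Spec A)]
    (k : Spec A ⟶ C) [IsOpenImmersion k] (h : ⊤ ≤ k ⁻¹ᵁ k.opensRange) :
    Function.Injective (evalOn k k.opensRange h) := by
  have h1 := k.isIso_app k.opensRange le_rfl
  have : IsIntegral (Spec A) := isIntegral_of_isOpenImmersion k
  have : Nonempty (⊤ : (Spec A).Opens) := ⟨⟨Nonempty.some ‹_›, trivial⟩⟩
  have h2 : Function.Injective (k.app k.opensRange).hom :=
    (asIso (k.app k.opensRange)).commRingCatIsoToRingEquiv.injective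
  have h3 : Function.Injective (resOpen h) := resOpen_injective h
  have h4 : Function.Injective (Scheme.ΓSpecIso A).hom.hom :=
    (Scheme.ΓSpecIso A).commRingCatIsoToRingEquiv.injective
  exact h4.comp (h3.comp h2)

/-- The function field of a scheme birational to a curve has transcendence degree at most one. -/
lemma trdeg_functionField_le_one [IsDomain R] [IsIntegral C] {A : Type u} [CommRing A] [Algebra R A]
    [Nonempty (Spec (.of A))] (k : Spec (.of A) ⟶ C) [IsOpenImmersion k]
    (hk : k ≫ πC = Spec.map (CommRingCat.ofHom (algebraMap R A))) (hA : Algebra.trdeg R A ≤ 1)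
    [Algebra R C.functionField]
    (hR : algebraMap R C.functionField = stalkStructureMap πC (genericPoint C)) :
    Algebra.trdeg R C.functionField ≤ 1 := by
  let W := k.opensRange
  have hW : IsAffineOpen W := isAffineOpen_opensRange k
  have hne : Nonempty W := ⟨⟨k (Nonempty.some ‹_›), ⟨_, rfl⟩⟩⟩
  have h : ⊤ ≤ k ⁻¹ᵁ W := fun x _ => ⟨x, rfl⟩
  let : Algebra R Γ(C, W) := (structureMap πC W).toAlgebra
  have h1 : Algebra.trdeg R Γ(C, W) ≤ 1 :=
    trdeg_le_one_of_injective (B := A) (evalOn k W h) (evalOn_structureMap πC k h _ hk)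
      (evalOn_opensRange_injective k h) hA
  have := functionField_isFractionRing_of_isAffineOpen C W hW
  have : IsScalarTower R Γ(C, W) C.functionField := IsScalarTower.of_algebraMap_eq fun r => by
    rw [hR]
    exact (germ_structureMap πC _ r).symm
  have : Algebra.IsAlgebraic Γ(C, W) C.functionField :=
    IsLocalization.isAlgebraic _ (nonZeroDivisors Γ(C, W))
  have : FaithfulSMul Γ(C, W) C.functionField :=
    (faithfulSMul_iff_algebraMap_injective _ _).mpr (IsFractionRing.injective _ _)
  exact trdeg_le_one_of_isAlgebraic h1

lemma valuationRing_stalk [IsDomain R] [IsIntegral C] [IsLocallyNoetherian C] [Algebra R C.functionField]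
    (hR : algebraMap R C.functionField = stalkStructureMap πC (genericPoint C))
    (htr : Algebra.trdeg R C.functionField ≤ 1) (y : C) [IsIntegrallyClosed (C.presheaf.stalk y)]
    (hy : ∀ r : R, r ≠ 0 → IsUnit (stalkStructureMap πC y r)) :
    ValuationRing (C.presheaf.stalk y) := by
  let : Algebra R (C.presheaf.stalk y) := (stalkStructureMap πC y).toAlgebra
  refine valuationRing_of_trdeg_le_one (R := R)
    (trdeg_le_one_of_injective (algebraMap (C.presheaf.stalk y) C.functionField) (fun r => ?_)
      (IsFractionRing.injective _ _) htr) hy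
  rw [hR]
  exact algebraMap_stalkStructureMap πC y r

lemma not_isField_stalk [IsIntegral C] {y : C} (hy : y ≠ genericPoint C) :
    ¬ IsField (C.presheaf.stalk y) := by
  intro h
  apply hy
  rw [← eq_genericPoint_of_fromSpecStalk_bot y]
  have h1 : (⊥ : PrimeSpectrum (C.presheaf.stalk y)) = IsLocalRing.closedPoint _ :=
    PrimeSpectrum.ext (IsLocalRing.isField_iff_maximalIdeal_eq.mp h).symm
  rw [h1, Scheme.fromSpecStalk_closedPoint]

end Birational

lemma evalOn_image_top {Xt C : Scheme.{u}} (j : Xt ⟶ C) [IsOpenImmersion j] {B : CommRingCat.{u}}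
    (w : Spec B ⟶ Xt) (h : ⊤ ≤ (w ≫ j) ⁻¹ᵁ (j ''ᵁ ⊤))
    (u : Γ(Xt, ⊤)) : evalOn (w ≫ j) (j ''ᵁ ⊤) h ((j.appIso ⊤).inv.hom u) = evalTop w u := by
  rw [evalOn_comp]
  have h1 : (j.app (j ''ᵁ ⊤)).hom ((j.appIso ⊤).inv.hom u) = resOpen le_top u :=
    congrArg (fun q => q.hom u) (j.appIso_inv_app ⊤)
  rw [h1]
  erw [evalOn_res]
  exact evalOn_top _ _ _

/-! ### Functions on a dense open subscheme as rational functions -/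

section RationalFunction

variable {Xt C : Scheme.{u}} [IsIntegral C] (j : Xt ⟶ C) [IsOpenImmersion j]

lemma stalkRange_mono {x η : C} (h : η ⤳ x) : stalkRange x ≤ stalkRange η := by
  intro t ht
  obtain ⟨V, hV, hx, g, rfl⟩ := mem_stalkRange_iff.mp ht
  exact mem_stalkRange_iff.mpr ⟨V, hV, h.mem_open V.isOpen hx, g, rfl⟩

lemma germ_mem_stalkRange {V : C.Opens} {y : C} (hy : y ∈ V) (g : Γ(C, V)) :
    (C.presheaf.germ V (genericPoint C) (genericPoint_mem hy)).hom g ∈ stalkRange y := by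
  have : Nonempty V := ⟨⟨y, hy⟩⟩
  exact ⟨C.presheaf.germ V y hy g, Scheme.algebraMap_germ_eq_germToFunctionField C hy g⟩

variable [Nonempty Xt]

lemma genericPoint_mem_image_top : genericPoint C ∈ j ''ᵁ ⊤ :=
  genericPoint_mem (y := j (Nonempty.some ‹_›)) ⟨_, trivial, rfl⟩

/-- A function on a dense open subscheme of `C`, as a rational function on `C`. -/
def ratFun : Γ(Xt, ⊤) →+* C.functionField :=
  ((j.appIso ⊤).inv ≫ C.presheaf.germ (j ''ᵁ ⊤) (genericPoint C) (genericPoint_mem_image_top j)).hom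

lemma ratFun_mem_stalkRange (u : Γ(Xt, ⊤)) {y : C} (hy : y ∈ Set.range j) :
    ratFun j u ∈ stalkRange y := by
  obtain ⟨y, rfl⟩ := hy
  exact germ_mem_stalkRange (V := j ''ᵁ ⊤) ⟨y, trivial, rfl⟩ _

lemma app_eq_of_germ_eq_ratFun {V : C.Opens} (hV : genericPoint C ∈ V) (g : Γ(C, V)) (u : Γ(Xt, ⊤))
    (h : (C.presheaf.germ V (genericPoint C) hV).hom g = ratFun j u) :
    (j.app V).hom g = (Xt.presheaf.map (homOfLE (le_top : j ⁻¹ᵁ V ≤ ⊤)).op).hom u := by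
  have : IsIntegral Xt := isIntegral_of_isOpenImmersion j
  let V' : C.Opens := V ⊓ j ''ᵁ ⊤
  have hV' : genericPoint C ∈ V' := ⟨hV, genericPoint_mem_image_top j⟩
  have h1 : resOpen (inf_le_left : V' ≤ V) g =
      resOpen (inf_le_right : V' ≤ j ''ᵁ ⊤) ((j.appIso ⊤).inv.hom u) := by
    apply germ_injective_of_isIntegral C _ hV'
    erw [C.presheaf.germ_res_apply (homOfLE inf_le_left) _ hV' g,
      C.presheaf.germ_res_apply (homOfLE inf_le_right) _ hV']
    exact h
  have hle : j ⁻¹ᵁ V' ≤ j ⁻¹ᵁ V := j.preimage_mono inf_le_left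
  have hne : Nonempty (j ⁻¹ᵁ V' : Xt.Opens) := by
    obtain ⟨y, -, hy⟩ := genericPoint_mem_image_top j
    exact ⟨⟨y, show j y ∈ V' from hy ▸ hV'⟩⟩
  apply resOpen_injective hle
  have h2 : resOpen hle ((j.app V).hom g) = (j.app V').hom (resOpen inf_le_left g) :=
    congrArg (fun q => q.hom g) (j.naturality (homOfLE (inf_le_left : V' ≤ V)).op).symm
  have h3 : (j.appIso ⊤).inv ≫ C.presheaf.map (homOfLE (inf_le_right : V' ≤ j ''ᵁ ⊤)).op ≫
      j.app V' = Xt.presheaf.map (homOfLE (le_top : j ⁻¹ᵁ V' ≤ ⊤)).op := by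
    rw [j.naturality, ← Category.assoc, j.appIso_inv_app, ← Functor.map_comp]
    rfl
  have h4 : (j.app V').hom (resOpen (inf_le_right : V' ≤ j ''ᵁ ⊤) ((j.appIso ⊤).inv.hom u)) =
      resOpen (le_top : j ⁻¹ᵁ V' ≤ ⊤) u := congrArg (fun q => q.hom u) h3
  rw [h2, h1, h4]
  have h5 : Xt.presheaf.map (homOfLE (le_top : j ⁻¹ᵁ V ≤ ⊤)).op ≫ Xt.presheaf.map (homOfLE hle).op =
      Xt.presheaf.map (homOfLE (le_top : j ⁻¹ᵁ V' ≤ ⊤)).op := by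
    rw [← Functor.map_comp]
    rfl
  exact (congrArg (fun q => q.hom u) h5).symm

/-- Evaluation of a rational function at a point of the dense open subscheme. -/
lemma evalOn_eq_evalTop_of_germ_eq_ratFun {B : CommRingCat.{u}} [Nonempty (Spec B)]
    (w : Spec B ⟶ Xt) {V : C.Opens} (h : ⊤ ≤ (w ≫ j) ⁻¹ᵁ V) (hV : genericPoint C ∈ V) (g : Γ(C, V))
    (u : Γ(Xt, ⊤)) (hg : (C.presheaf.germ V (genericPoint C) hV).hom g = ratFun j u) :
    evalOn (w ≫ j) V h g = evalTop w u := by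
  have h' : ⊤ ≤ (w ≫ j) ⁻¹ᵁ (j ''ᵁ ⊤) := fun x _ => ⟨w x, trivial, rfl⟩
  rw [← evalOn_image_top j w h']
  exact evalOn_eq_of_germ_eq _ h h' hV (genericPoint_mem_image_top j) hg

lemma notMem_divSupport {u : Γ(Xt, ⊤)ˣ} {x : C} (h : ratFun j u ∈ stalkRange x)
    (h' : ratFun j (u⁻¹ : Γ(Xt, ⊤)ˣ) ∈ stalkRange x) : x ∉ divSupport j u := by
  obtain ⟨V₁, -, hx₁, g₁, hg₁⟩ := mem_stalkRange_iff.mp h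
  obtain ⟨V₂, -, hx₂, g₂, hg₂⟩ := mem_stalkRange_iff.mp h'
  have hx : x ∈ V₁ ⊓ V₂ := ⟨hx₁, hx₂⟩
  have hη := genericPoint_mem hx
  have e₁ : (C.presheaf.germ _ _ hη).hom (resOpen inf_le_left g₁) = ratFun j u := by
    rw [← hg₁]
    exact C.presheaf.germ_res_apply (homOfLE inf_le_left) _ hη g₁
  have e₂ : (C.presheaf.germ _ _ hη).hom (resOpen inf_le_right g₂) =
      ratFun j (u⁻¹ : Γ(Xt, ⊤)ˣ) := by
    rw [← hg₂]
    exact C.presheaf.germ_res_apply (homOfLE inf_le_right) _ hη g₂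
  have h1 : resOpen inf_le_left g₁ * resOpen inf_le_right g₂ = (1 : Γ(C, V₁ ⊓ V₂)) := by
    apply germ_injective_of_isIntegral C _ hη
    change (C.presheaf.germ _ _ hη).hom _ = (C.presheaf.germ _ _ hη).hom _
    rw [map_mul, e₁, e₂, ← map_mul, Units.mul_inv, map_one, map_one]
  intro hd
  exact hd ⟨V₁ ⊓ V₂, hx, ⟨_, _, h1, (mul_comm _ _).trans h1⟩,
    app_eq_of_germ_eq_ratFun j hη _ _ e₁⟩

end RationalFunction

lemma isUnit_stalkStructureMap {C : Scheme.{u}} {R : Type u} [CommRing R] [IsDomain R]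
    (πC : C ⟶ Spec (.of R)) {y : C} (hy : πC y = (⊥ : PrimeSpectrum R)) {r : R} (hr : r ≠ 0) :
    IsUnit (stalkStructureMap πC y r) := by
  have h1 : y ∈ πC ⁻¹ᵁ ((Spec (.of R)).basicOpen ((Scheme.ΓSpecIso (.of R)).inv r)) := by
    rw [basicOpen_eq_of_affine]
    change πC y ∈ PrimeSpectrum.basicOpen r
    rw [hy]
    exact hr
  rw [Scheme.preimage_basicOpen_top] at h1
  have h2 := (C.mem_basicOpen_top _ y).mp h1
  have h3 : structureMap πC ⊤ r = πC.appTop.hom ((Scheme.ΓSpecIso (.of R)).inv.hom r) := by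
    rw [structureMap_top]
  change IsUnit ((C.presheaf.germ ⊤ y trivial).hom (structureMap πC ⊤ r))
  rw [h3]
  exact h2

/-! ### Linear forms attached to the components of the boundary -/

section BoundaryWeights

lemma monomial_neg {X : Scheme.{u}} {n : ℕ} (f : Fin n → Γ(X, ⊤)ˣ) (a : Fin n → ℤ) :
    monomial f (-a) = (monomial f a)⁻¹ := by
  simp [monomial, Finset.prod_inv_distrib]

lemma monomial_single {X : Scheme.{u}} {n : ℕ} (f : Fin n → Γ(X, ⊤)ˣ) (i : Fin n) :
    monomial f (Pi.single i 1) = f i := by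
  classical
  rw [monomial, Finset.prod_eq_single i] <;> simp +contextual

variable {Xt C : Scheme.{u}} [IsIntegral C] (j : Xt ⟶ C) [IsOpenImmersion j] [Nonempty Xt]
lemma ne_genericPoint_of_notMem_range {x : C} (hx : x ∉ Set.range j) : x ≠ genericPoint C := by
  rintro rfl
  obtain ⟨y, -, hy⟩ := genericPoint_mem_image_top j
  exact hx ⟨y, hy⟩

variable {R : Type u} [CommRing R] [IsDomain R] {πC : C ⟶ Spec (.of R)} [IsLocallyNoetherian C]
  [Algebra R C.functionField]

/-- The orders of vanishing of monomials along a codimension one point of the boundary. -/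
lemma exists_weight (hR : algebraMap R C.functionField = stalkStructureMap πC (genericPoint C))
    (htr : Algebra.trdeg R C.functionField ≤ 1) {η : C} [IsIntegrallyClosed (C.presheaf.stalk η)]
    (hη : η ∉ Set.range j) (hηR : πC η = (⊥ : PrimeSpectrum R))
    {n : ℕ} (u : Fin n → Γ(Xt, ⊤)ˣ) (hu : (Set.range j)ᶜ = ⋃ i, divSupport j (u i)) :
    ∃ w : (Fin n → ℤ) →ₗ[ℤ] ℤ, w ≠ 0 ∧
      ∀ a, 0 ≤ w a ↔ ratFun j (monomial u a : Γ(Xt, ⊤)ˣ) ∈ stalkRange η := by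
  have hval : ValuationRing (C.presheaf.stalk η) :=
    valuationRing_stalk πC hR htr η fun r hr => isUnit_stalkStructureMap πC hηR hr
  obtain ⟨o, ho⟩ := exists_order (M := C.functionField)
    (not_isField_stalk (ne_genericPoint_of_notMem_range j hη))
  let F (i : Fin n) : C.functionFieldˣ := Units.map (ratFun j : Γ(Xt, ⊤) →* _) (u i)
  let w : (Fin n → ℤ) →ₗ[ℤ] ℤ := ∑ i, (o (F i)).toAdd • LinearMap.proj i
  have hF (a : Fin n → ℤ) : Units.map (ratFun j : Γ(Xt, ⊤) →* _) (monomial u a) =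
      ∏ i, F i ^ a i := by
    rw [monomial, map_prod]
    exact Finset.prod_congr rfl fun i _ => map_zpow _ _ _
  have hw (a) : 0 ≤ w a ↔ ratFun j (monomial u a : Γ(Xt, ⊤)ˣ) ∈ stalkRange η := by
    have h1 : w a = (o (Units.map (ratFun j : Γ(Xt, ⊤) →* _) (monomial u a))).toAdd := by
      rw [hF, map_prod, toAdd_prod]
      simp only [w, LinearMap.sum_apply, LinearMap.smul_apply, LinearMap.proj_apply, map_zpow,
        toAdd_zpow, smul_eq_mul]
      exact Finset.sum_congr rfl fun i _ => mul_comm _ _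
    rw [h1]
    exact ho _
  refine ⟨w, ?_, hw⟩
  -- If w were zero, every coordinate function and its inverse would be regular at η, so η would lie
  -- on none of the divisors that make up the boundary.
  intro h0
  have hη' : η ∈ (Set.range j)ᶜ := hη
  rw [hu] at hη'
  obtain ⟨m, hm⟩ := Set.mem_iUnion.mp hη'
  refine notMem_divSupport j (u := u m) ?_ ?_ hm
  · rw [← monomial_single u m, ← hw, h0]; rfl
  · rw [← monomial_single u m, ← monomial_neg, ← hw, h0]; rfl

/-- The linear forms describing the behaviour of monomials along an étale boundary. -/
theorem exists_boundary_weights [IsPrincipalIdealRing R]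
    (hR : algebraMap R C.functionField = stalkStructureMap πC (genericPoint C))
    (htr : Algebra.trdeg R C.functionField ≤ 1)
    (hC : ∀ x : C, IsIntegrallyClosed (C.presheaf.stalk x))
    {D : Scheme.{u}} (i : D ⟶ C) [IsClosedImmersion i] [Etale (i ≫ πC)] [QuasiCompact (i ≫ πC)]
    (hi : Set.range i = (Set.range j)ᶜ)
    {n : ℕ} (u : Fin n → Γ(Xt, ⊤)ˣ) (hu : (Set.range j)ᶜ = ⋃ i, divSupport j (u i)) :
    ∃ W : Set ((Fin n → ℤ) →ₗ[ℤ] ℤ), W.Finite ∧ (∀ w ∈ W, w ≠ 0) ∧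
      ∀ x ∉ Set.range j, πC x ≠ (⊥ : PrimeSpectrum R) → ∃ w ∈ W,
        (∀ a, 0 ≤ w a → ratFun j (monomial u a : Γ(Xt, ⊤)ˣ) ∈ stalkRange x) ∧
        ∀ a, w a < 0 → ratFun j (monomial u a : Γ(Xt, ⊤)ˣ) ∉ stalkRange x := by
  have hmem (d : D) : i d ∉ Set.range j := by
    have : i d ∈ (Set.range j)ᶜ := hi ▸ ⟨d, rfl⟩
    exact this
  have hw (δ : {δ : D // (i ≫ πC) δ = (⊥ : PrimeSpectrum R)}) := 
    have := hC (i δ.1)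
    exists_weight j hR htr (hmem δ.1) δ.2 u hu
  choose w hw0 hw using hw
  have hfin : Finite {δ : D // (i ≫ πC) δ = (⊥ : PrimeSpectrum R)} :=
    (finite_preimage_bot_of_etale (i ≫ πC)).to_subtype
  refine ⟨Set.range w, Set.finite_range w, by rintro _ ⟨δ, rfl⟩; exact hw0 δ, fun x hx hxp => ?_⟩
  obtain ⟨d, rfl⟩ : x ∈ Set.range i := by rw [hi]; exact hx
  obtain ⟨δ, hδd, hδ, hd⟩ := exists_specializes_of_etale (i ≫ πC) d
  have hηx : i δ ⤳ i d := hδd.map i.continuous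
  have := hC (i d)
  refine ⟨w ⟨δ, hδ⟩, ⟨_, rfl⟩, fun a ha => ?_, fun a ha hmem => ?_⟩
  -- A proper generization of x lies either in the open part, where the monomial is regular, or in
  -- the boundary, where only η is possible. As η differs from x and from the generic point, x has
  -- codimension at least two.
  · refine mem_stalkRange_of_forall_specializes hηx ?_
      (ne_genericPoint_of_notMem_range j (hmem δ)) fun y hy hyx => ?_
    · intro h
      exact hxp (h ▸ hδ)
    by_cases hyj : y ∈ Set.range j
    · exact ratFun_mem_stalkRange j _ hyj
    obtain ⟨d', rfl⟩ : y ∈ Set.range i := by rw [hi]; exact hyj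
    have hd' : d' ⤳ d := i.isEmbedding.specializes_iff.mp hy
    rcases hd d' hd' with rfl | rfl
    · exact absurd rfl hyx
    · exact (hw ⟨d', hδ⟩ a).mp ha
  · exact ha.not_ge ((hw ⟨δ, hδ⟩ a).mpr (stalkRange_mono hηx hmem))

end BoundaryWeights

/-! ### Lifting points to the normalisation and extending them by properness -/

section LiftPoints

/-- A residue field of A at a maximal ideal is algebraic over the algebraically closed field Ω,
hence equal to it. -/
lemma exists_ringHom_comp_eq_id {Ω A : Type u} [Field Ω] [IsAlgClosed Ω] [CommRing A] [Nontrivial A]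
    (φ : Ω →+* A) (hφ : φ.IsIntegral) : ∃ ψ : A →+* Ω, ψ.comp φ = RingHom.id Ω := by
  obtain ⟨m, hm⟩ := Ideal.exists_maximal A
  let : Field (A ⧸ m) := Ideal.Quotient.field m
  let : Algebra Ω (A ⧸ m) := ((Ideal.Quotient.mk m).comp φ).toAlgebra
  have : Algebra.IsIntegral Ω (A ⧸ m) := ⟨fun x => by
    obtain ⟨x, rfl⟩ := Ideal.Quotient.mk_surjective x
    obtain ⟨P, hP, hP0⟩ := hφ x
    refine ⟨P, hP, ?_⟩
    change P.eval₂ ((Ideal.Quotient.mk m).comp φ) _ = 0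
    rw [← Polynomial.hom_eval₂, hP0, map_zero]⟩
  have hb := IsAlgClosed.algebraMap_bijective_of_isIntegral (k := Ω) (K := A ⧸ m)
  let e := RingEquiv.ofBijective (algebraMap Ω (A ⧸ m)) hb
  refine ⟨(e.symm : A ⧸ m →+* Ω).comp (Ideal.Quotient.mk m), RingHom.ext fun x => ?_⟩
  exact e.symm_apply_apply x

variable {X Xt C : Scheme.{u}}

/-- The image is closed, since ν is integral, and it contains a nonempty open subset of an
irreducible space. -/
lemma surjective_of_isNormalisation {ν : Xt ⟶ X} (h : IsNormalisation ν) [IrreducibleSpace X] :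
    Surjective ν := by
  have := h.integralHom
  have hcl : IsClosed (Set.range ν) := ν.isClosedMap.isClosed_range
  obtain ⟨U, hU, hiso⟩ := h.birational
  refine ⟨Set.range_eq_univ.mp ?_⟩
  have hsub : (U : Set X) ⊆ Set.range ν := by
    intro x hx
    obtain ⟨y, hy⟩ := (ν ∣_ U).surjective ⟨x, hx⟩
    refine ⟨(ν ⁻¹ᵁ U).ι y, ?_⟩
    rw [← Scheme.Hom.comp_apply, ← morphismRestrict_ι, Scheme.Hom.comp_apply, hy]
    rfl
  exact Set.eq_univ_of_univ_subset
    ((U.isOpen.dense hU).closure_eq ▸ hcl.closure_subset_iff.mpr hsub)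

/-- The fibre over z is a nonempty affine scheme integral over Ω, so it has an Ω-point. -/
lemma exists_lift_of_isIntegralHom (ν : Xt ⟶ X) [IsIntegralHom ν] [Surjective ν]
    {Ω : Type u} [Field Ω] [IsAlgClosed Ω] (z : Spec (.of Ω) ⟶ X) : ∃ z', z' ≫ ν = z := by
  let P := pullback ν z
  have haff : IsAffine P := isAffine_of_isAffineHom (pullback.snd ν z)
  let g : Spec Γ(P, ⊤) ⟶ Spec (.of Ω) := P.isoSpec.inv ≫ pullback.snd ν z
  obtain ⟨φ, hφ⟩ := Spec.map_surjective g
  have hint : IsIntegralHom g := inferInstance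
  have hsurj : Surjective g := inferInstance
  have hφint : φ.hom.IsIntegral := by
    rwa [← hφ, IsIntegralHom.SpecMap_iff] at hint
  have hnt : Nontrivial Γ(P, ⊤) := by
    obtain ⟨y, -⟩ := g.surjective (IsLocalRing.closedPoint Ω)
    exact PrimeSpectrum.nonempty_iff_nontrivial.mp ⟨y⟩
  obtain ⟨ψ, hψ⟩ := exists_ringHom_comp_eq_id φ.hom hφint
  refine ⟨Spec.map (CommRingCat.ofHom ψ) ≫ P.isoSpec.inv ≫ pullback.fst ν z, ?_⟩
  have h1 : Spec.map (CommRingCat.ofHom ψ) ≫ P.isoSpec.inv ≫ pullback.snd ν z = 𝟙 _ := by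
    change Spec.map (CommRingCat.ofHom ψ) ≫ g = _
    rw [← hφ, ← Spec.map_comp, ← Spec.map_id]
    congr 1
    exact CommRingCat.hom_ext hψ
  rw [Category.assoc, Category.assoc, pullback.condition, ← Category.assoc, ← Category.assoc,
    Category.assoc (Spec.map _), h1, Category.id_comp]

lemma exists_extension_of_isProper {R : Type u} [CommRing R] (πC : C ⟶ Spec (.of R)) [IsProper πC]
    {O Ω : Type u} [CommRing O] [IsDomain O] [ValuationRing O] [Field Ω] [Algebra O Ω]
    [IsFractionRing O Ω] (ρ : R →+* O) (t : Spec (.of Ω) ⟶ C)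
    (ht : t ≫ πC = Spec.map (CommRingCat.ofHom ((algebraMap O Ω).comp ρ))) :
    ∃ w : Spec (.of O) ⟶ C, Spec.map (CommRingCat.ofHom (algebraMap O Ω)) ≫ w = t ∧
      w ≫ πC = Spec.map (CommRingCat.ofHom ρ) := by
  have h1 : (ValuativeCriterion ⊓ @QuasiCompact ⊓ @QuasiSeparated ⊓ @LocallyOfFiniteType :
    MorphismProperty Scheme.{u}) πC := IsProper.eq_valuativeCriterion ▸ ‹IsProper πC›
  have h2 := h1.1.1.1.existence
  have sq : CommSq t (Spec.map (CommRingCat.ofHom (algebraMap O Ω))) πC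
      (Spec.map (CommRingCat.ofHom ρ)) := ⟨by
    rw [ht, ← Spec.map_comp, ← CommRingCat.ofHom_comp]⟩
  have := h2 ⟨O, Ω, t, Spec.map (CommRingCat.ofHom ρ), sq⟩
  exact ⟨sq.lift, sq.fac_left, sq.fac_right⟩

end LiftPoints

/-! ### Values of rational functions at points reducing to the boundary -/

section BoundaryValues

lemma le_preimage_of_closedPoint_mem {C : Scheme.{u}} {O : Type u} [CommRing O] [IsLocalRing O]
    {w : Spec (.of O) ⟶ C} {V : C.Opens} (hx : w (IsLocalRing.closedPoint O) ∈ V) :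
    ⊤ ≤ w ⁻¹ᵁ V :=
  fun y _ => range_subset_of_closedPoint_mem w V hx ⟨y, rfl⟩

variable {Xt C : Scheme.{u}} [IsIntegral C] (j : Xt ⟶ C) [IsOpenImmersion j] [Nonempty Xt]
  {O Ω : Type u} [CommRing O] [Field Ω] [Algebra O Ω]
  {z : Spec (.of Ω) ⟶ Xt} {w : Spec (.of O) ⟶ C}

lemma exists_evalOn_eq (hw : Spec.map (CommRingCat.ofHom (algebraMap O Ω)) ≫ w = z ≫ j)
    {V : C.Opens} (h : ⊤ ≤ w ⁻¹ᵁ V) (hV : genericPoint C ∈ V) (g : Γ(C, V))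
    (u : Γ(Xt, ⊤)) (hg : (C.presheaf.germ V (genericPoint C) hV).hom g = ratFun j u) :
    algebraMap O Ω (evalOn w V h g) = evalTop z u := by
  have h' : ⊤ ≤ (z ≫ j) ⁻¹ᵁ V := by
    rw [← hw]
    exact fun x _ => h (Set.mem_univ _)
  rw [← evalOn_eq_evalTop_of_germ_eq_ratFun j z h' hV g u hg]
  have h1 := evalOn_SpecMap_comp (CommRingCat.ofHom (algebraMap O Ω)) w h (hw ▸ h') g
  have key : ∀ {a b : Spec (.of Ω) ⟶ C} (e : a = b) (ha hb), evalOn a V ha g = evalOn b V hb g := by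
    rintro a _ rfl _ _
    rfl
  exact h1.symm.trans (key hw _ _)

variable [IsLocalRing O]

lemma evalTop_mem_range (hw : Spec.map (CommRingCat.ofHom (algebraMap O Ω)) ≫ w = z ≫ j)
    {u : Γ(Xt, ⊤)} (hu : ratFun j u ∈ stalkRange (w (IsLocalRing.closedPoint O))) :
    evalTop z u ∈ (algebraMap O Ω).range := by
  obtain ⟨V, -, hx, g, hg⟩ := mem_stalkRange_iff.mp hu
  exact ⟨_, exists_evalOn_eq j hw (le_preimage_of_closedPoint_mem hx) _ g u hg⟩

/-- If the value of u⁻¹ were in O, the value of u would be a unit of O. Then u would not vanish at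
the image of the closed point, and u⁻¹ would be regular there. -/
lemma evalTop_inv_notMem_range (hO : Function.Injective (algebraMap O Ω))
    (hw : Spec.map (CommRingCat.ofHom (algebraMap O Ω)) ≫ w = z ≫ j) {u : Γ(Xt, ⊤)ˣ}
    (hu : ratFun j u ∈ stalkRange (w (IsLocalRing.closedPoint O)))
    (hu' : ratFun j (u⁻¹ : Γ(Xt, ⊤)ˣ) ∉ stalkRange (w (IsLocalRing.closedPoint O))) :
    evalTop z (u⁻¹ : Γ(Xt, ⊤)ˣ) ∉ (algebraMap O Ω).range := by
  rintro ⟨v, hv⟩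
  obtain ⟨V, -, hx, g, hg⟩ := mem_stalkRange_iff.mp hu
  have h := le_preimage_of_closedPoint_mem hx
  have h1 := exists_evalOn_eq j hw h _ g u hg
  have h2 : evalOn w V h g * v = 1 := by
    apply hO
    rw [map_mul, h1, hv, ← map_mul, Units.mul_inv, map_one, map_one]
  have h3 := (isUnit_evalOn_iff w h g).mp (IsUnit.of_mul_eq_one _ h2)
  have h4 := (C.mem_basicOpen g _ hx).mp h3
  obtain ⟨t, ht⟩ := h4.exists_right_inv
  apply hu'
  have : Nonempty V := ⟨⟨_, hx⟩⟩
  refine ⟨t, ?_⟩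
  have h5 := congrArg (algebraMap _ C.functionField) ht
  have h6 := Scheme.algebraMap_germ_eq_germToFunctionField C hx g
  rw [map_mul, map_one] at h5
  have h7 : ratFun j u * algebraMap _ C.functionField t = 1 := by
    rw [← hg, ← h5]
    congr 1
    exact h6.symm
  have h8 : ratFun j u * ratFun j (u⁻¹ : Γ(Xt, ⊤)ˣ) = 1 := by
    rw [← map_mul, Units.mul_inv, map_one]
  exact mul_left_cancel₀ (left_ne_zero_of_mul_eq_one h8) (h7.trans h8.symm)

end BoundaryValues

/-! ### Integral points versus points reducing to the boundary -/

section Dichotomy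

variable {R : Type u} [CommRing R] [IsDomain R] {X Xt C : Scheme.{u}} {π : X ⟶ Spec (.of R)}
  {ν : Xt ⟶ X} {j : Xt ⟶ C} {πC : C ⟶ Spec (.of R)}

lemma trdeg_functionField_le_one_of_isNormalCompactification {F : Type u} [Field F] [Algebra R F]
    [IsFractionRing R F] (hX : IsGeomIrredCurve F π) (hC : IsNormalCompactification π ν j πC)
    [IsIntegral C] [Algebra R C.functionField]
    (hR : algebraMap R C.functionField = stalkStructureMap πC (genericPoint C)) :
    Algebra.trdeg R C.functionField ≤ 1 := by
  have := hX.isIntegral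
  have := hC.openImmersion
  obtain ⟨U, hU, k, hne, hk, hkν⟩ := exists_isOpenImmersion_of_birational hC.normalisation.birational
  let : Algebra R Γ(X, U) := (structureMap π U).toAlgebra
  have hne' : Nonempty (Spec (.of Γ(X, U))) := PrimeSpectrum.nonempty_iff_nontrivial.mpr inferInstance
  have : IsOpenImmersion (k ≫ j) := inferInstance
  refine trdeg_functionField_le_one (A := Γ(X, U)) πC (k ≫ j) ?_
    (trdeg_le_one_of_isAffineOpen hX hU rfl) hR
  rw [Category.assoc, hC.comp_eq, ← Category.assoc, hkν]
  exact fromSpec_comp_eq π hU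

lemma map_closedPoint_ne_bot {O : Type u} [CommRing O] [IsLocalRing O] (ρ : R →+* O)
    (hρ : ∃ r ≠ 0, ¬ IsUnit (ρ r)) {w : Spec (.of O) ⟶ C}
    (hw : w ≫ πC = Spec.map (CommRingCat.ofHom ρ)) :
    πC (w (IsLocalRing.closedPoint O)) ≠ (⊥ : PrimeSpectrum R) := by
  obtain ⟨r, hr0, hr⟩ := hρ
  intro h
  have h' : (w ≫ πC) (IsLocalRing.closedPoint O) = (⊥ : PrimeSpectrum R) := h
  rw [hw] at h'
  have h1 : (PrimeSpectrum.comap ρ (IsLocalRing.closedPoint O)).asIdeal = ⊥ :=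
    congrArg PrimeSpectrum.asIdeal h'
  have h2 : r ∈ (PrimeSpectrum.comap ρ (IsLocalRing.closedPoint O)).asIdeal :=
    (IsLocalRing.mem_maximalIdeal _).mpr hr
  rw [h1] at h2
  exact hr0 h2

/-- On a curve with étale boundary, a point which is not integral reduces to the boundary, where
the integrality of monomials is governed by one of finitely many linear forms. -/
theorem exists_weights [IsPrincipalIdealRing R] {F : Type u} [Field F] [Algebra R F]
    [IsFractionRing R F] (hX : IsGeomIrredCurve F π) (hC : IsNormalCompactification π ν j πC)
    {n : ℕ} {f : Fin n → Γ(X, ⊤)ˣ} (hf : BoundaryEqDivisors ν j f) (hD : BoundaryEtale j πC)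
    {O Ω : Type u} [CommRing O] [IsDomain O] [ValuationRing O] [Field Ω] [IsAlgClosed Ω]
    [Algebra O Ω] [IsFractionRing O Ω] [Algebra R Ω] (ρ : R →+* O)
    (hρ : ∃ r ≠ 0, ¬ IsUnit (ρ r)) (hρΩ : algebraMap R Ω = (algebraMap O Ω).comp ρ) :
    ∃ W : Set ((Fin n → ℤ) →ₗ[ℤ] ℤ), W.Finite ∧ (∀ w ∈ W, w ≠ 0) ∧ ∀ z : Point Ω π,
      (∃ v : Spec (.of O) ⟶ X, Spec.map (CommRingCat.ofHom (algebraMap O Ω)) ≫ v = z.1) ∨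
      ∃ w ∈ W,
        (∀ a, 0 ≤ w a → ((character a (z.coords f) : Ωˣ) : Ω) ∈ (algebraMap O Ω).range) ∧
        ∀ a, w a < 0 → ((character a (z.coords f) : Ωˣ) : Ω) ∉ (algebraMap O Ω).range := by
  have := hX.isIntegral
  have := hC.openImmersion
  have := hC.normal.isIntegral
  have := hC.normalisation.normal.isIntegral
  have := hC.proper
  have := hC.normalisation.integralHom
  have := surjective_of_isNormalisation hC.normalisation
  have : IsLocallyNoetherian C := LocallyOfFiniteType.isLocallyNoetherian πC
  obtain ⟨D, i, hi, hrange, het⟩ := hD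
  let : Algebra R C.functionField := (stalkStructureMap πC (genericPoint C)).toAlgebra
  have htr := trdeg_functionField_le_one_of_isNormalCompactification hX hC rfl
  let u (i : Fin n) : Γ(Xt, ⊤)ˣ := Units.map (ν.appTop.hom : Γ(X, ⊤) →* Γ(Xt, ⊤)) (f i)
  have hu (a : Fin n → ℤ) : (monomial u a : Γ(Xt, ⊤)) = ν.appTop.hom (monomial f a : Γ(X, ⊤)) := by
    have h : monomial u a = Units.map (ν.appTop.hom : Γ(X, ⊤) →* Γ(Xt, ⊤)) (monomial f a) := by
      rw [monomial, monomial, map_prod]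
      exact Finset.prod_congr rfl fun i _ => (map_zpow _ _ _).symm
    exact congrArg Units.val h
  obtain ⟨W, hWfin, hW0, hW⟩ := exists_boundary_weights j rfl htr hC.normal.isIntegrallyClosed i
    hrange u hf
  refine ⟨W, hWfin, hW0, fun z => ?_⟩
  obtain ⟨z', hz'⟩ := exists_lift_of_isIntegralHom ν z.1
  have hchar (a : Fin n → ℤ) : evalTop z' (monomial u a : Γ(Xt, ⊤)ˣ) =
      ((character a (z.coords f) : Ωˣ) : Ω) := by
    rw [← evalTop_monomial, hu, ← hz']
    exact (evalTop_comp z' ν _).symm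
  obtain ⟨w, hw, hwπ⟩ := exists_extension_of_isProper πC (O := O) ρ (z' ≫ j) (by
    rw [Category.assoc, hC.comp_eq, ← Category.assoc, hz', z.2, hρΩ])
  by_cases hx : w (IsLocalRing.closedPoint O) ∈ Set.range j
  · left
    have hle : Set.range w ⊆ Set.range j := range_subset_of_closedPoint_mem w j.opensRange hx
    refine ⟨IsOpenImmersion.lift j w hle ≫ ν, ?_⟩
    rw [← hz', ← Category.assoc]
    congr 1
    rw [← cancel_mono j, Category.assoc, IsOpenImmersion.lift_fac, hw]
  · right
    obtain ⟨l, hlW, hl1, hl2⟩ := hW _ hx (map_closedPoint_ne_bot ρ hρ hwπ)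
    refine ⟨l, hlW, fun a ha => ?_, fun a ha => ?_⟩
    · rw [← hchar]
      exact evalTop_mem_range j hw (hl1 a ha)
    -- For w a < 0 the monomial with exponent -a is regular at x while its inverse is not, so it
    -- takes a nonunit value there.
    · rw [← hchar, ← neg_neg a, monomial_neg]
      refine evalTop_inv_notMem_range j (IsFractionRing.injective O Ω) hw (hl1 _ ?_) ?_
      · rw [map_neg]; omega
      · rw [← monomial_neg, neg_neg]
        exact hl2 a ha

end Dichotomy

/-! ### The p-adic statement -/

section Padic

lemma evalTop_mem_unitsOf {R Ω : Type u} [CommRing R] [Field Ω] [Algebra R Ω] {X : Scheme.{u}}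
    {π : X ⟶ Spec (.of R)} {z : Point Ω π} {O : Subring Ω} (hz : z.IsIntegralOver O) {n : ℕ}
    (f : Fin n → Γ(X, ⊤)ˣ) (i : Fin n) : z.coords f i ∈ unitsOf O := by
  obtain ⟨v, hv⟩ := hz
  refine ⟨Units.map (evalTop v : Γ(X, ⊤) →* O) (f i), Units.ext ?_⟩
  rw [Point.coe_coords, ← hv]
  exact (evalTop_SpecMap_comp (CommRingCat.ofHom O.subtype) v _).symm

variable (p : ℕ) [Fact p.Prime]

/-- The inclusion of `ℤ_p^nr` into `ℤ̄_p`. -/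
def ZnrToZbar : Znr p →+* Zbar p :=
  ((algebraMap (Qnr p) (PadicAlgCl p)).comp (Znr p).val.toRingHom).codRestrict (Zbar p) fun x =>
    (mem_Zbar_iff _).mpr ((mem_Znr_iff _).mp x.2)

lemma exists_ne_zero_not_isUnit_ZnrToZbar : ∃ r ≠ 0, ¬ IsUnit (ZnrToZbar p r) := by
  have h1 : ((ZnrToZbar p p : Zbar p) : PadicAlgCl p) = p := by
    rw [map_natCast]
    rfl
  have h0 := norm_natCast_prime_pos (p := p)
  refine ⟨p, fun h => ?_, fun h => ?_⟩
  · rw [h, map_zero] at h1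
    rw [← h1] at h0
    simp at h0
  · obtain ⟨y, hy⟩ := h.exists_right_inv
    have h2 := congrArg (fun y : Zbar p => ‖(y : PadicAlgCl p)‖) hy
    have h3 : ‖(p : PadicAlgCl p)‖ * ‖(y : PadicAlgCl p)‖ = 1 := by
      rw [← norm_mul, ← h1]
      exact h2.trans norm_one
    have h4 := (mem_Zbar_iff _).mp y.2
    have h5 := norm_natCast_prime_lt_one (p := p)
    nlinarith

lemma mem_unitsOf_Zbar_iff (x : (Qnr p)ˣ) :
    Units.map (algebraMap (Qnr p) (PadicAlgCl p) : Qnr p →* PadicAlgCl p) x ∈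
      unitsOf (Zbar p).toSubring ↔ x ∈ unitsOf (Znr p).toSubring := by
  rw [mem_unitsOf_iff, mem_unitsOf_iff]
  change _ ∈ Zbar p ∧ _ ∈ Zbar p ↔ _ ∈ Znr p ∧ _ ∈ Znr p
  rw [mem_Zbar_iff, mem_Zbar_iff, mem_Znr_iff, mem_Znr_iff, ← map_inv]
  rfl

variable {p} {X : Scheme.{0}} {π : X ⟶ Spec (.of (Znr p))}

/-- The `ℚ̄_p`-point underlying a `ℚ_p^nr`-point. -/
def Point.toAlgCl (z : Point (Qnr p) π) : Point (PadicAlgCl p) π :=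
  ⟨Spec.map (CommRingCat.ofHom (algebraMap (Qnr p) (PadicAlgCl p))) ≫ z.1, by
    rw [Category.assoc, z.2, ← Spec.map_comp]
    rfl⟩

lemma Point.coords_toAlgCl (z : Point (Qnr p) π) {n : ℕ} (f : Fin n → Γ(X, ⊤)ˣ) :
    z.toAlgCl.coords f = fun i =>
      Units.map (algebraMap (Qnr p) (PadicAlgCl p) : Qnr p →* PadicAlgCl p) (z.coords f i) :=
  funext fun _ => Units.ext (evalTop_SpecMap_comp _ z.1 _)

/-- Everything is proved over ℚ̄_p. The case of ℚ_p^nr follows with the same matrices, since being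
special and having unit coordinates can both be tested after the embedding. -/
theorem padic_statement {n : ℕ} {Xt C : Scheme.{0}} {f : Fin n → Γ(X, ⊤)ˣ}
    {ν : Xt ⟶ X} {j : Xt ⟶ C} {πC : C ⟶ Spec (.of (Znr p))}
    (hX : IsGeomIrredCurve (Qnr p) π) (hC : IsNormalCompactification π ν j πC)
    (hf : BoundaryEqDivisors ν j f) (hD : BoundaryEtale j πC) :
    (∃ Θ : Finset (Matrix (Fin (n - 1)) (Fin n) ℤ),
      (∀ A ∈ Θ, Function.Surjective (torusHom (PadicAlgCl p) A)) ∧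
      (∀ z : Point (Qnr p) π, z.coords f ∈ special (Qnr p) n 2 →
        (∃ i, z.coords f i ∉ unitsOf (Znr p).toSubring) →
        ∃ A ∈ Θ, torusHom (Qnr p) A (z.coords f) ∈ special (Qnr p) (n - 1) 2 ∧
          ∀ l, torusHom (Qnr p) A (z.coords f) l ∈ unitsOf (Znr p).toSubring) ∧
      (∀ z : Point (PadicAlgCl p) π, z.coords f ∈ special (PadicAlgCl p) n 2 →
        (∃ i, z.coords f i ∉ unitsOf (Zbar p).toSubring) →
        ∃ A ∈ Θ, torusHom (PadicAlgCl p) A (z.coords f) ∈ special (PadicAlgCl p) (n - 1) 2 ∧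
          ∀ l, torusHom (PadicAlgCl p) A (z.coords f) l ∈ unitsOf (Zbar p).toSubring)) ∧
    (n = 3 → NotInTranslate (PadicAlgCl p) π f →
      {z : Point (PadicAlgCl p) π | z.coords f ∈ special (PadicAlgCl p) n 2 ∧
        ¬ z.IsIntegralOver (Zbar p).toSubring}.Finite) := by
  classical
  have := isDiscreteValuationRing_Znr p
  have := isFractionRing_Znr p
  have := isFractionRing_Zbar p
  have := valuationRing_Zbar p
  have hG : ∀ (v : (PadicAlgCl p)ˣ) (k : ℤ), k ≠ 0 → v ^ k ∈ unitsOf (Zbar p).toSubring →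
      v ∈ unitsOf (Zbar p).toSubring := zpow_mem_unitsOf fun y k hk hy => by
    have hy' : y ^ k ∈ Zbar p := hy
    rw [mem_Zbar_iff, norm_pow] at hy'
    exact (mem_Zbar_iff y).mpr ((pow_le_one_iff_of_nonneg (norm_nonneg _) hk.ne').mp hy')
  obtain ⟨W, hWfin, hW0, hW⟩ := exists_weights hX hC hf hD (Ω := PadicAlgCl p) (ZnrToZbar p)
    (exists_ne_zero_not_isUnit_ZnrToZbar p) rfl
  replace hW (z : Point (PadicAlgCl p) π) : z.IsIntegralOver (Zbar p).toSubring ∨ ∃ w ∈ W,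
      (∀ a, w a = 0 → character a (z.coords f) ∈ unitsOf (Zbar p).toSubring) ∧
      ∃ i, z.coords f i ∉ unitsOf (Zbar p).toSubring := by
    refine (hW z).imp id ?_
    rintro ⟨w, hw, hw1, hw2⟩
    refine ⟨w, hw, fun a ha => ?_, ?_⟩
    · rw [mem_unitsOf_iff, ← character_neg]
      obtain ⟨y₁, h₁⟩ := hw1 a ha.ge
      obtain ⟨y₂, h₂⟩ := hw1 (-a) (by rw [map_neg, ha]; rfl)
      exact ⟨h₁ ▸ y₁.2, h₂ ▸ y₂.2⟩
    -- If all coordinates were units, so would be all characters; then w takes no negative value on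
    -- any a or -a, and w = 0.
    · by_contra! hcon
      apply hW0 w hw
      refine LinearMap.ext fun a => ?_
      have hmem (a) : ((character a (z.coords f) : _ˣ) : PadicAlgCl p) ∈
          (algebraMap (Zbar p) (PadicAlgCl p)).range := by
        have h1 : character a (z.coords f) ∈ unitsOf (Zbar p).toSubring :=
          Subgroup.prod_mem _ fun i _ => Subgroup.zpow_mem _ (hcon i) _
        exact ⟨⟨_, (mem_unitsOf_iff.mp h1).1⟩, rfl⟩
      have h1 : ¬ w a < 0 := fun h => hw2 a h (hmem a)
      have h2 : ¬ w (-a) < 0 := fun h => hw2 (-a) h (hmem (-a))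
      rw [map_neg] at h2
      change w a = 0
      omega
  choose A hA hwA using fun w : W => exists_matrix_rows_basis_ker w.1 (hW0 w.1 w.2)
  have : Fintype W := hWfin.fintype
  have key (z : Point (PadicAlgCl p) π) (hz : z.coords f ∈ special (PadicAlgCl p) n 2)
      (hi : ∃ i, z.coords f i ∉ unitsOf (Zbar p).toSubring) :
      ∃ w, torusHom (PadicAlgCl p) (A w) (z.coords f) ∈ special (PadicAlgCl p) (n - 1) 2 ∧
        ∀ l, torusHom (PadicAlgCl p) (A w) (z.coords f) l ∈ unitsOf (Zbar p).toSubring := by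
    obtain ⟨i, hi⟩ := hi
    rcases hW z with h | ⟨w, hw, hw1, -⟩
    · exact absurd (evalTop_mem_unitsOf h f i) hi
    · exact ⟨⟨w, hw⟩, torusHom_mem_special_of_rows_basis_ker hG hz hi hw1 (hA ⟨w, hw⟩) (hwA ⟨w, hw⟩)⟩
  refine ⟨⟨Finset.univ.image A, ?_, ?_, ?_⟩, ?_⟩
  · intro B hB
    obtain ⟨w, -, rfl⟩ := Finset.mem_image.mp hB
    exact torusHom_surjective_of_linearIndependent _ (hA w)
  · rintro z hz ⟨i, hi⟩
    let φ := algebraMap (Qnr p) (PadicAlgCl p)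
    obtain ⟨w, hw1, hw2⟩ := key z.toAlgCl
      (by rw [z.coords_toAlgCl]; exact (map_mem_special_iff φ _).mpr hz)
      ⟨i, by rw [z.coords_toAlgCl]; exact fun h => hi ((mem_unitsOf_Zbar_iff p _).mp h)⟩
    rw [z.coords_toAlgCl] at hw1 hw2
    have e := torusHom_map φ (A w) (z.coords f)
    refine ⟨A w, Finset.mem_image_of_mem _ (Finset.mem_univ _), ?_, fun l => ?_⟩
    · exact (map_mem_special_iff φ _).mp
        (Eq.mp (congrArg (· ∈ special (PadicAlgCl p) (n - 1) 2) e) hw1)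
    · exact (mem_unitsOf_Zbar_iff p _).mp
        (Eq.mp (congrArg (· l ∈ unitsOf (Zbar p).toSubring) e) (hw2 l))
  · intro z hz hi
    obtain ⟨w, hw⟩ := key z hz hi
    exact ⟨A w, Finset.mem_image_of_mem _ (Finset.mem_univ _), hw⟩
  · rintro rfl hnt
    -- For n = 3 the two rows of the matrix of w are independent characters with unit values at a
    -- nonintegral point, hence torsion there. Finitely many w remain, each with finitely many
    -- points.
    have hfin (w : W) := finite_setOf_isOfFinOrder_character (F := Qnr p) hX hnt (a := A w 0)
      (b := A w 1) (by
        convert hA w using 1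
        ext i k
        fin_cases i <;> rfl)
    refine (Set.finite_iUnion hfin).subset ?_
    rintro z ⟨hz, hzi⟩
    obtain ⟨w, hw, hw1, i, hi⟩ := (hW z).resolve_left hzi
    have htor (l : Fin 2) : IsOfFinOrder (character (A ⟨w, hw⟩ l) (z.coords f)) := by
      refine isOfFinOrder_character_of_mem_special hG hz hi (hw1 _ ?_)
      refine (hwA ⟨w, hw⟩ _).mpr ⟨Pi.single l 1, ?_⟩
      rw [Finset.sum_eq_single l] <;> simp +contextual
    exact Set.mem_iUnion.mpr ⟨⟨w, hw⟩, htor 0, htor 1⟩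

end Padic

/-! ### Morphisms to finitely presented schemes and finitely generated subalgebras -/

section SpreadingOut

variable (R B : Type u) [CommRing R] [CommRing B] [Algebra R B]

/-- The filtered diagram of the finitely generated subalgebras of an algebra. -/
def fgDiagram : Finset B ⥤ CommRingCat.{u} where
  obj s := .of (Algebra.adjoin R (s : Set B))
  map {s t} h := CommRingCat.ofHom (Subalgebra.inclusion
    (Algebra.adjoin_mono (Finset.coe_subset.mpr h.le))).toRingHom

/-- An algebra, as a cocone over its finitely generated subalgebras. -/
def fgCocone : Cocone (fgDiagram R B) where
  pt := .of B
  ι := { app := fun s => CommRingCat.ofHom (Algebra.adjoin R (s : Set B)).val.toRingHom }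

/-- The image of b under a cocone does not depend on the subalgebra in which b is viewed: two of
them are compared inside the one generated by s ∪ {b}. This makes the universal map well defined. -/
lemma fgCocone_desc_aux (c : Cocone (fgDiagram R B)) {s : Finset B} {b : B}
    (hb : b ∈ Algebra.adjoin R (s : Set B)) :
    (c.ι.app s).hom ⟨b, hb⟩ =
      (c.ι.app {b}).hom ⟨b, Algebra.subset_adjoin (by simp)⟩ := by
  classical
  have h1 := congrArg (fun q => q.hom ⟨b, hb⟩)
    (c.w (homOfLE (Finset.subset_union_left : s ⊆ s ∪ {b})))
  have h2 := congrArg (fun q => q.hom ⟨b, Algebra.subset_adjoin (by simp)⟩)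
    (c.w (homOfLE (Finset.subset_union_right : {b} ⊆ s ∪ {b})))
  exact h1.symm.trans h2

/-- An algebra is the filtered colimit of its finitely generated subalgebras. -/
def fgCoconeIsColimit : IsColimit (fgCocone R B) := by
  classical
  exact
  { desc := fun c => CommRingCat.ofHom
      { toFun := fun b => (c.ι.app {b}).hom ⟨b, Algebra.subset_adjoin (by simp)⟩
        map_one' := by
          exact map_one _
        map_zero' := by
          exact map_zero _
        map_add' := fun a b => by
          rw [← fgCocone_desc_aux R B c (s := {a, b})
              (add_mem (Algebra.subset_adjoin (by simp)) (Algebra.subset_adjoin (by simp))),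
            ← fgCocone_desc_aux R B c (s := {a, b}) (Algebra.subset_adjoin (by simp) : a ∈ _),
            ← fgCocone_desc_aux R B c (s := {a, b}) (Algebra.subset_adjoin (by simp) : b ∈ _)]
          exact map_add (c.ι.app ({a, b} : Finset B)).hom ⟨a, _⟩ ⟨b, _⟩
        map_mul' := fun a b => by
          rw [← fgCocone_desc_aux R B c (s := {a, b})
              (mul_mem (Algebra.subset_adjoin (by simp)) (Algebra.subset_adjoin (by simp))),
            ← fgCocone_desc_aux R B c (s := {a, b}) (Algebra.subset_adjoin (by simp) : a ∈ _),
            ← fgCocone_desc_aux R B c (s := {a, b}) (Algebra.subset_adjoin (by simp) : b ∈ _)]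
          exact map_mul (c.ι.app ({a, b} : Finset B)).hom ⟨a, _⟩ ⟨b, _⟩ }
    fac := fun c s => CommRingCat.hom_ext (RingHom.ext fun b => (fgCocone_desc_aux R B c b.2).symm)
    uniq := fun c m hm => CommRingCat.hom_ext (RingHom.ext fun (b : B) =>
      congrArg (fun q => q.hom ⟨b, Algebra.subset_adjoin (Finset.mem_singleton_self b)⟩)
        (hm ({b} : Finset B))) }

variable {R B}

/-- A morphism from an affine scheme to a scheme of finite presentation is defined over a finitely
generated subalgebra. -/
theorem exists_finset_adjoin_factor {X : Scheme.{u}} (π : X ⟶ Spec (.of R))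
    [LocallyOfFinitePresentation π] (a : Spec (.of B) ⟶ X)
    (ha : a ≫ π = Spec.map (CommRingCat.ofHom (algebraMap R B))) :
    ∃ (s : Finset B) (g : Spec (.of (Algebra.adjoin R (s : Set B))) ⟶ X),
      Spec.map (CommRingCat.ofHom (Algebra.adjoin R (s : Set B)).val.toRingHom) ≫ g = a := by
  classical
  let D : (Finset B)ᵒᵖ ⥤ Scheme.{u} := (fgDiagram R B).op ⋙ Scheme.Spec
  let c : Cone D := Scheme.Spec.mapCone (fgCocone R B).op
  have hc : IsLimit c := isLimitOfPreserves Scheme.Spec (fgCoconeIsColimit R B).op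
  let t : D ⟶ (Functor.const _).obj (Spec (.of R)) :=
    { app := fun s => Spec.map (CommRingCat.ofHom (algebraMap R (Algebra.adjoin R (s.unop : Set B))))
      naturality := fun s s' h => by
        exact (Spec.map_comp _ _).symm.trans (Category.comp_id _).symm }
  have haff : ∀ {i j} (h : i ⟶ j), IsAffineHom (D.map h) := fun {i j} h =>
    inferInstanceAs (IsAffineHom (Spec.map ((fgDiagram R B).map h.unop)))
  have h1 (i) : CompactSpace (D.obj i) :=
    inferInstanceAs (CompactSpace (Spec ((fgDiagram R B).obj i.unop)))
  have h2 (i) : QuasiSeparatedSpace (D.obj i) :=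
    inferInstanceAs (QuasiSeparatedSpace (Spec ((fgDiagram R B).obj i.unop)))
  obtain ⟨s, g, hg, -⟩ := Scheme.exists_π_app_comp_eq_of_locallyOfFinitePresentation D t π c hc
    (a : c.pt ⟶ X) (by
      ext s
      exact (Spec.map_comp _ _).symm.trans ha.symm)
  exact ⟨s.unop, g, hg⟩

end SpreadingOut

/-! ### Noetherian overrings, finite presentation and spreading out integrality -/

section Noetherian

open scoped nonZeroDivisors

/-- An overring of a Dedekind domain inside its fraction field is Noetherian. -/
lemma isNoetherianRing_of_isDedekindDomain {D K : Type*} [CommRing D] [IsDedekindDomain D] [Field K]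
    [Algebra D K] [IsFractionRing D K] (R : Subring K) (hR : ∀ d : D, algebraMap D K d ∈ R) :
    IsNoetherianRing R := by
  let ρ : D →+* R := (algebraMap D K).codRestrict R hR
  refine (isNoetherianRing_iff_ideal_fg R).mpr fun J => ?_
  suffices h : J = (J.comap ρ).map ρ by
    rw [h]
    exact Ideal.FG.map (IsNoetherian.noetherian (J.comap ρ)) ρ
  refine le_antisymm (fun x hx => ?_) Ideal.map_comap_le
  -- Every ideal J of R is extended from D. For x ∈ J the fractional ideal (1, x) is invertible, so
  -- 1 = s + xt with s, t in its inverse. Then xs and xt lie in D and in J, and x = xs + (xt)x.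
  let I : FractionalIdeal D⁰ K :=
    FractionalIdeal.spanSingleton D⁰ 1 + FractionalIdeal.spanSingleton D⁰ (x : K)
  have hI : I ≠ 0 := fun h0 => by
    have h1 : (1 : K) ∈ I := FractionalIdeal.mem_add _ _ _ |>.mpr
      ⟨1, FractionalIdeal.mem_spanSingleton_self _ _, 0, FractionalIdeal.zero_mem _, by simp⟩
    rw [h0, FractionalIdeal.mem_zero_iff] at h1
    exact one_ne_zero h1
  have h1 : (1 : K) ∈ I * I⁻¹ := by
    rw [mul_inv_cancel₀ hI]
    exact FractionalIdeal.one_mem_one _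
  have h2 : I * I⁻¹ = FractionalIdeal.spanSingleton D⁰ 1 * I⁻¹ +
    FractionalIdeal.spanSingleton D⁰ (x : K) * I⁻¹ := add_mul _ _ _
  rw [h2] at h1
  obtain ⟨y₁, hy₁, y₂, hy₂, hy⟩ := (FractionalIdeal.mem_add _ _ _).mp h1
  obtain ⟨s, hs, rfl⟩ := FractionalIdeal.mem_singleton_mul.mp hy₁
  obtain ⟨t, ht, rfl⟩ := FractionalIdeal.mem_singleton_mul.mp hy₂
  have key (s : K) (hs : s ∈ I⁻¹) : ∃ d : D, algebraMap D K d = x * s ∧ ρ d ∈ J := by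
    have h4 := (FractionalIdeal.mem_inv_iff hI).mp hs 1 ((FractionalIdeal.mem_add _ _ _).mpr
      ⟨1, FractionalIdeal.mem_spanSingleton_self _ _, 0, FractionalIdeal.zero_mem _, by simp⟩)
    obtain ⟨c, hc⟩ := (FractionalIdeal.mem_one_iff _).mp h4
    have h3 := (FractionalIdeal.mem_inv_iff hI).mp hs x ((FractionalIdeal.mem_add _ _ _).mpr
      ⟨0, FractionalIdeal.zero_mem _, x, FractionalIdeal.mem_spanSingleton_self _ _, by simp⟩)
    obtain ⟨d, hd⟩ := (FractionalIdeal.mem_one_iff _).mp h3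
    refine ⟨d, hd.trans (mul_comm _ _), ?_⟩
    have h5 : ρ d = ρ c * x := Subtype.ext (hd.trans (by rw [← hc.trans (mul_one s)]; rfl))
    rw [h5]
    exact J.mul_mem_left _ hx
  obtain ⟨d, hd, hdJ⟩ := key s hs
  obtain ⟨c, hc, hcJ⟩ := key t ht
  have hx' : x = ρ d + ρ c * x := Subtype.ext <| by
    change (x : K) = algebraMap D K d + algebraMap D K c * x
    rw [hd, hc]
    linear_combination -(x : K) * hy
  rw [hx']
  exact add_mem (Ideal.mem_map_of_mem ρ hdJ) (Ideal.mul_mem_right _ _ (Ideal.mem_map_of_mem ρ hcJ))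

end Noetherian

lemma locallyOfFinitePresentation_of_isNoetherianRing {R : Type u} [CommRing R] [IsNoetherianRing R]
    {X : Scheme.{u}} (π : X ⟶ Spec (.of R)) [LocallyOfFiniteType π] :
    LocallyOfFinitePresentation π := by
  refine (HasRingHomProperty.iff_appLE (P := @LocallyOfFinitePresentation)).mpr fun U V e => ?_
  have : IsNoetherianRing Γ(Spec (.of R), U.1) := IsLocallyNoetherian.component_noetherian U
  exact RingHom.FinitePresentation.of_finiteType.mp
    (LocallyOfFiniteType.finiteType_appLE (f := π) U.2 V.2 e)

/-- The coefficients of an integral equation of b are polynomials in elements of s with finitely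
many constants from K. Once ψ maps these constants and s into O, the value ψ b is integral over O.
-/
lemma exists_finset_forall_mem_of_isIntegral {K B : Type*} [Field K] [CommRing B] [Algebra K B]
    {s : Set B} {b : B} (hb : IsIntegral (Algebra.adjoin K s) b) :
    ∃ E : Finset K, ∀ (Ω : Type u) [Field Ω] (O : Subring Ω) [IsIntegrallyClosedIn O Ω]
      (ψ : B →+* Ω), (∀ e ∈ E, ψ (algebraMap K B e) ∈ O) → (∀ x ∈ s, ψ x ∈ O) → ψ b ∈ O := by
  classical
  have hA (a : B) (ha : a ∈ Algebra.adjoin K s) : ∃ E : Finset K,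
      ∀ (Ω : Type u) [Field Ω] (O : Subring Ω) [IsIntegrallyClosedIn O Ω]
      (ψ : B →+* Ω), (∀ e ∈ E, ψ (algebraMap K B e) ∈ O) → (∀ x ∈ s, ψ x ∈ O) → ψ a ∈ O := by
    induction ha using Algebra.adjoin_induction with
    | mem x hx => exact ⟨∅, fun _ _ _ _ _ _ h => h x hx⟩
    | algebraMap e => exact ⟨{e}, fun _ _ _ _ _ h _ => h e (Finset.mem_singleton_self e)⟩
    | add x y _ _ hx hy =>
      obtain ⟨E₁, h₁⟩ := hx
      obtain ⟨E₂, h₂⟩ := hy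
      refine ⟨E₁ ∪ E₂, fun Ω _ O _ ψ h hs => ?_⟩
      rw [map_add]
      exact add_mem (h₁ Ω O ψ (fun e he => h e (Finset.mem_union_left _ he)) hs)
        (h₂ Ω O ψ (fun e he => h e (Finset.mem_union_right _ he)) hs)
    | mul x y _ _ hx hy =>
      obtain ⟨E₁, h₁⟩ := hx
      obtain ⟨E₂, h₂⟩ := hy
      refine ⟨E₁ ∪ E₂, fun Ω _ O _ ψ h hs => ?_⟩
      rw [map_mul]
      exact mul_mem (h₁ Ω O ψ (fun e he => h e (Finset.mem_union_left _ he)) hs)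
        (h₂ Ω O ψ (fun e he => h e (Finset.mem_union_right _ he)) hs)
  obtain ⟨P, hP, hP0⟩ := hb
  choose E hE using fun i => hA _ (P.coeff i).2
  refine ⟨(Finset.range (P.natDegree + 1)).biUnion E, fun Ω _ O _ ψ h hs => ?_⟩
  have hc (i : ℕ) : ψ (P.coeff i) ∈ O := by
    by_cases hi : i < P.natDegree + 1
    · exact hE i Ω O ψ (fun e he =>
        h e (Finset.mem_biUnion.mpr ⟨i, Finset.mem_range.mpr hi, he⟩)) hs
    · rw [P.coeff_eq_zero_of_natDegree_lt (by omega)]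
      simp
  let ψ' := ψ.comp (Algebra.adjoin K s).val.toRingHom
  have hint : IsIntegral O (ψ b) := by
    have hl : P.map ψ' ∈ Polynomial.lifts (algebraMap O Ω) := by
      rw [Polynomial.lifts_iff_coeff_lifts]
      intro i
      rw [Polynomial.coeff_map]
      exact ⟨⟨_, hc i⟩, rfl⟩
    obtain ⟨Q, hQ, -, hQm⟩ := Polynomial.lifts_and_natDegree_eq_and_monic hl (hP.map ψ')
    refine ⟨Q, hQm, ?_⟩
    rw [← Polynomial.eval_map, hQ, Polynomial.eval_map]
    exact (Polynomial.hom_eval₂ P (algebraMap _ B) ψ b).symm.trans (by rw [hP0, map_zero])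
  obtain ⟨y, hy⟩ := IsIntegrallyClosedIn.isIntegral_iff.mp hint
  exact hy ▸ y.2

/-! ### Curves over a field: finiteness of zero sets -/

section CurveOverField

open Polynomial

/-- The quotient by h is algebraic and of finite type over K, so it is Artinian and has finitely
many primes. -/
lemma finite_zeroLocus_of_trdeg_le_one {K B : Type*} [Field K] [CommRing B] [IsDomain B]
    [Algebra K B] [Algebra.FiniteType K B] (hB : Algebra.trdeg K B ≤ 1) {h : B} (h0 : h ≠ 0) :
    (PrimeSpectrum.zeroLocus {h}).Finite := by
  let Q := B ⧸ Ideal.span {h}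
  have hint : Algebra.IsIntegral K Q := ⟨fun x => by
    obtain ⟨x, rfl⟩ := Ideal.Quotient.mk_surjective x
    obtain ⟨q, hq, hdvd⟩ := exists_dvd_aeval hB h0 x
    refine IsAlgebraic.isIntegral ⟨q, hq, ?_⟩
    have h1 : aeval (Ideal.Quotient.mk (Ideal.span {h}) x) q =
        Ideal.Quotient.mk (Ideal.span {h}) (aeval x q) :=
      aeval_algHom_apply (Ideal.Quotient.mkₐ K (Ideal.span {h})) x q
    rw [h1, Ideal.Quotient.eq_zero_iff_mem]
    exact Ideal.mem_span_singleton.mpr hdvd⟩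
  have hft : Algebra.FiniteType K Q := inferInstance
  have hfin : Module.Finite K Q := Algebra.IsIntegral.finite
  have hart : IsArtinianRing Q := IsArtinianRing.of_finite K Q
  have hps : Finite (PrimeSpectrum Q) := inferInstance
  rw [← PrimeSpectrum.zeroLocus_span, ← Ideal.mk_ker (I := Ideal.span {h}),
    ← range_comap_of_surjective _ _ Ideal.Quotient.mk_surjective]
  exact Set.finite_range _

variable {K : Type u} [Field K]

lemma trdeg_le_one_of_topologicalKrullDim_le_one {Y : Scheme.{u}} (πY : Y ⟶ Spec (.of K))
    [LocallyOfFiniteType πY] (hdim : topologicalKrullDim Y ≤ 1) {U : Y.Opens} (hU : IsAffineOpen U)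
    [IsDomain Γ(Y, U)] [Algebra K Γ(Y, U)] (he : algebraMap K Γ(Y, U) = structureMap πY U) :
    Algebra.trdeg K Γ(Y, U) ≤ 1 := by
  have : Algebra.FiniteType K Γ(Y, U) := by
    have := finiteType_structureMap πY hU
    rwa [← he, RingHom.finiteType_algebraMap] at this
  refine trdeg_le_one_of_krullDimLE_one ?_
  have h1 := hU.fromSpec.isOpenEmbedding.isInducing.topologicalKrullDim_le
  rw [Ring.krullDimLE_iff, ← PrimeSpectrum.topologicalKrullDim_eq_ringKrullDim]
  exact h1.trans hdim

lemma trdeg_functionField_le_one_of_birational {Y Xt : Scheme.{u}} (πY : Y ⟶ Spec (.of K))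
    [LocallyOfFiniteType πY] (hdim : topologicalKrullDim Y ≤ 1) {ν : Xt ⟶ Y} [IsIntegral Xt]
    (h : ∃ U : Y.Opens, (U : Set Y).Nonempty ∧ IsIso (ν ∣_ U))
    {C : Scheme.{u}} [IsIntegral C] (j : Xt ⟶ C) [IsOpenImmersion j]
    (πC : C ⟶ Spec (.of K)) (hj : j ≫ πC = ν ≫ πY) [Algebra K C.functionField]
    (hK : algebraMap K C.functionField = stalkStructureMap πC (genericPoint C)) :
    Algebra.trdeg K C.functionField ≤ 1 := by
  obtain ⟨U, hU, k, hne, hk, hkν⟩ := exists_isOpenImmersion_of_birational h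
  let : Algebra K Γ(Y, U) := (structureMap πY U).toAlgebra
  have hne' : Nonempty (Spec Γ(Y, U)) := by
    obtain ⟨x, hx⟩ := hne
    have : x ∈ Set.range hU.fromSpec := by rw [hU.range_fromSpec]; exact hx
    exact ⟨this.choose⟩
  have hint : IsIntegral (Spec Γ(Y, U)) := isIntegral_of_isOpenImmersion k
  have hdom : IsDomain Γ(Y, U) := (affine_isIntegral_iff _).mp hint
  have : IsOpenImmersion (k ≫ j) := inferInstance
  refine trdeg_functionField_le_one (A := Γ(Y, U)) πC (k ≫ j) ?_
    (trdeg_le_one_of_topologicalKrullDim_le_one πY hdim hU rfl) hK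
  rw [Category.assoc, hj, ← Category.assoc, hkν]
  exact fromSpec_comp_eq πY hU

lemma notMem_basicOpen_fromSpec_iff {Z : Scheme.{u}} {U : Z.Opens} (hU : IsAffineOpen U) (h : Γ(Z, ⊤))
    (q : PrimeSpectrum Γ(Z, U)) :
    hU.fromSpec q ∉ Z.basicOpen h ↔ resOpen (le_top : U ≤ ⊤) h ∈ q.asIdeal := by
  have h1 := hU.fromSpec_preimage_basicOpen (resOpen (le_top : U ≤ ⊤) h)
  have h2 : Z.basicOpen (resOpen (le_top : U ≤ ⊤) h) = U ⊓ Z.basicOpen h :=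
    Z.basicOpen_res h (homOfLE le_top).op
  have h3 : hU.fromSpec q ∈ U := by
    have : hU.fromSpec q ∈ Set.range hU.fromSpec := ⟨q, rfl⟩
    rwa [hU.range_fromSpec] at this
  have h4 : hU.fromSpec q ∈ Z.basicOpen (resOpen (le_top : U ≤ ⊤) h) ↔
      q ∈ PrimeSpectrum.basicOpen (resOpen (le_top : U ≤ ⊤) h) := by
    rw [← h1]; rfl
  rw [h2] at h4
  have h5 : hU.fromSpec q ∈ Z.basicOpen h ↔ resOpen (le_top : U ≤ ⊤) h ∉ q.asIdeal :=
    ⟨fun h => h4.mp ⟨h3, h⟩, fun h => (h4.mpr h).2⟩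
  rw [h5, not_not]

variable {Z : Scheme.{u}} [IsIntegral Z] (πZ : Z ⟶ Spec (.of K))

lemma trdeg_section_le_one [Algebra K Z.functionField]
    (hK : algebraMap K Z.functionField = stalkStructureMap πZ (genericPoint Z))
    (htr : Algebra.trdeg K Z.functionField ≤ 1) {U : Z.Opens} [Nonempty U] [Algebra K Γ(Z, U)]
    (he : algebraMap K Γ(Z, U) = structureMap πZ U) : Algebra.trdeg K Γ(Z, U) ≤ 1 := by
  have hη : genericPoint Z ∈ U := genericPoint_mem (Nonempty.some ‹Nonempty U›).2
  refine trdeg_le_one_of_injective (Z.presheaf.germ U _ hη).hom (fun r => ?_)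
    (germ_injective_of_isIntegral Z _ hη) htr
  rw [he, hK]
  exact germ_structureMap πZ hη r

/-- A nonzero function on a curve over a field vanishes at finitely many points. -/
lemma finite_compl_basicOpen [LocallyOfFiniteType πZ] [CompactSpace Z] [Algebra K Z.functionField]
    (hK : algebraMap K Z.functionField = stalkStructureMap πZ (genericPoint Z))
    (htr : Algebra.trdeg K Z.functionField ≤ 1) {h : Γ(Z, ⊤)} (h0 : h ≠ 0) :
    {x | x ∉ Z.basicOpen h}.Finite := by
  obtain ⟨s, hs⟩ := exists_finset_affineOpens_cover Z
  have hfin : ∀ U ∈ s, {x | x ∉ Z.basicOpen h ∧ x ∈ U.1}.Finite := by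
    rintro ⟨U, hU'⟩ -
    have hU : IsAffineOpen U := hU'
    by_cases hne : Nonempty U
    swap
    · exact Set.Finite.subset Set.finite_empty fun x hx => hne ⟨⟨_, hx.2⟩⟩
    let : Algebra K Γ(Z, U) := (structureMap πZ U).toAlgebra
    have : Algebra.FiniteType K Γ(Z, U) := finiteType_structureMap πZ hU
    have h0' : resOpen (le_top : U ≤ ⊤) h ≠ 0 := by
      rw [← map_zero (resOpen (le_top : U ≤ ⊤))]
      exact fun h => h0 (resOpen_injective le_top h)
    refine ((finite_zeroLocus_of_trdeg_le_one (trdeg_section_le_one πZ hK htr rfl) h0').image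
      hU.fromSpec).subset ?_
    rintro x ⟨hx, hxU⟩
    have : x ∈ Set.range hU.fromSpec := by rw [hU.range_fromSpec]; exact hxU
    obtain ⟨q, rfl⟩ := this
    exact ⟨q, Set.singleton_subset_iff.mpr ((notMem_basicOpen_fromSpec_iff hU h q).mp hx), rfl⟩
  refine (s.finite_toSet.biUnion (fun U hU => hfin U hU)).subset fun x hx => ?_
  obtain ⟨U, hU, hxU⟩ := hs x
  exact Set.mem_biUnion hU ⟨hx, hxU⟩

/-- A point other than the generic one corresponds to a nonzero prime. Any nonzero h in it divides
some P(v), which therefore vanishes at the point. -/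
lemma exists_notMem_basicOpen_eval₂ [Algebra K Z.functionField]
    (hK : algebraMap K Z.functionField = stalkStructureMap πZ (genericPoint Z))
    (htr : Algebra.trdeg K Z.functionField ≤ 1) (v : Γ(Z, ⊤)) {x : Z} (hx : x ≠ genericPoint Z) :
    ∃ P : K[X], P ≠ 0 ∧ x ∉ Z.basicOpen (P.eval₂ (structureMap πZ ⊤) v) := by
  obtain ⟨U, hU, hxU⟩ := exists_isAffineOpen_mem x
  have hne : Nonempty U := ⟨⟨x, hxU⟩⟩
  let : Algebra K Γ(Z, U) := (structureMap πZ U).toAlgebra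
  have : x ∈ Set.range hU.fromSpec := by rw [hU.range_fromSpec]; exact hxU
  obtain ⟨q, rfl⟩ := this
  have hq : q.asIdeal ≠ ⊥ := by
    intro h0
    apply hx
    have h1 : q = (⊥ : PrimeSpectrum Γ(Z, U)) := PrimeSpectrum.ext h0
    have h2 : genericPoint Z ∈ U := genericPoint_mem hxU
    have : genericPoint Z ∈ Set.range hU.fromSpec := by rw [hU.range_fromSpec]; exact h2
    obtain ⟨q', hq'⟩ := this
    have h3 : q ⤳ q' := by
      rw [h1]
      exact bot_specializes (R := Γ(Z, U)) q'
    have h4 := h3.map hU.fromSpec.continuous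
    rw [hq'] at h4
    exact (h4.antisymm ((genericPoint_spec Z).specializes (Set.mem_univ _))).eq
  obtain ⟨h, hhq, h0⟩ := Submodule.exists_mem_ne_zero_of_ne_bot hq
  obtain ⟨P, hP, hdvd⟩ := exists_dvd_aeval (trdeg_section_le_one πZ hK htr (U := U) rfl) h0
    (resOpen (le_top : U ≤ ⊤) v)
  refine ⟨P, hP, (notMem_basicOpen_fromSpec_iff hU _ q).mpr ?_⟩
  have h1 : resOpen (le_top : U ≤ ⊤) (P.eval₂ (structureMap πZ ⊤) v) =
      aeval (resOpen (le_top : U ≤ ⊤) v) P := by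
    rw [hom_eval₂, aeval_def]
    congr 1
    exact RingHom.ext fun r => resOpen_structureMap πZ le_top r
  rw [h1]
  exact q.asIdeal.mem_of_dvd hdvd hhq

end CurveOverField

/-! ### The morphism to an affine scheme given by functions -/

section ToSpecAdjoin

lemma comp_toSpecΓ {Y : Scheme.{u}} {B : CommRingCat.{u}} (w : Spec B ⟶ Y) :
    w ≫ Y.toSpecΓ = Spec.map (CommRingCat.ofHom (evalTop w)) := by
  rw [Scheme.toSpecΓ_naturality, ← SpecMap_ΓSpecIso_hom, ← Spec.map_comp]
  rfl

lemma toSpecΓ_comp_structureMap {R : Type u} [CommRing R] {Y : Scheme.{u}} (π : Y ⟶ Spec (.of R)) :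
    Y.toSpecΓ ≫ Spec.map (CommRingCat.ofHom (structureMap π ⊤)) = π := by
  have h1 : CommRingCat.ofHom (structureMap π ⊤) = (Scheme.ΓSpecIso (.of R)).inv ≫ π.appTop :=
    CommRingCat.hom_ext (RingHom.ext fun r => structureMap_top π r)
  rw [h1, Spec.map_comp, ← Category.assoc, ← Scheme.toSpecΓ_naturality, Category.assoc,
    ← SpecMap_ΓSpecIso_hom, ← Spec.map_comp, Iso.inv_hom_id, Spec.map_id, Category.comp_id]

variable {K : Type u} [Field K] {Y : Scheme.{u}} (πY : Y ⟶ Spec (.of K)) [Algebra K Γ(Y, ⊤)]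

/-- The morphism to an affine scheme given by a set of functions. -/
def toSpecAdjoin (K : Type u) [Field K] [Algebra K Γ(Y, ⊤)] (s : Set Γ(Y, ⊤)) :
    Y ⟶ Spec (.of (Algebra.adjoin K s)) :=
  Y.toSpecΓ ≫ Spec.map (CommRingCat.ofHom (Algebra.adjoin K s).val.toRingHom)

lemma toSpecAdjoin_comp (he : algebraMap K Γ(Y, ⊤) = structureMap πY ⊤) (s : Set Γ(Y, ⊤)) :
    toSpecAdjoin K s ≫ Spec.map (CommRingCat.ofHom (algebraMap K (Algebra.adjoin K s))) = πY := by
  refine (Category.assoc _ _ _).trans ?_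
  rw [← Spec.map_comp]
  refine Eq.trans ?_ (toSpecΓ_comp_structureMap πY)
  rw [← he]
  rfl

lemma comp_toSpecAdjoin {B : Type u} [CommRing B] (w : Spec (.of B) ⟶ Y) (s : Set Γ(Y, ⊤)) :
    w ≫ toSpecAdjoin K s = Spec.map (CommRingCat.ofHom
      ((evalTop w).comp (Algebra.adjoin K s).val.toRingHom : _ →+* B)) := by
  rw [toSpecAdjoin, ← Category.assoc, comp_toSpecΓ, ← Spec.map_comp]
  rfl

lemma notMem_asIdeal_toSpecAdjoin_iff (s : Set Γ(Y, ⊤)) (a : Algebra.adjoin K s) (x : Y) :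
    a ∉ PrimeSpectrum.asIdeal (toSpecAdjoin K s x) ↔ x ∈ Y.basicOpen (a : Γ(Y, ⊤)) := by
  rw [← Scheme.toSpecΓ_preimage_basicOpen]
  rfl

variable {Xt C : Scheme.{u}} {ν : Xt ⟶ Y} {j : Xt ⟶ C} {πC : C ⟶ Spec (.of K)}

/-- Properness of C extends the point over O. Its closed point cannot reach the boundary: there some
v_m is not invertible, whereas v_m and its inverse both belong to s and so have values in O. -/
theorem existence_comp_toSpecAdjoin [LocallyOfFiniteType πY] (hdim : topologicalKrullDim Y ≤ 1)
    (he : algebraMap K Γ(Y, ⊤) = structureMap πY ⊤)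
    (hC : IsNormalCompactification πY ν j πC) {n : ℕ} {v : Fin n → Γ(Y, ⊤)ˣ}
    (hv : BoundaryEqDivisors ν j v) {s : Set Γ(Y, ⊤)}
    (hs : ∀ i, (v i : Γ(Y, ⊤)) ∈ s ∧ (((v i)⁻¹ : Γ(Y, ⊤)ˣ) : Γ(Y, ⊤)) ∈ s) :
    ValuativeCriterion.Existence (ν ≫ toSpecAdjoin K s) := by
  have := hC.openImmersion
  have := hC.normal.isIntegral
  have := hC.normalisation.normal.isIntegral
  have := hC.proper
  have : IsLocallyNoetherian C := LocallyOfFiniteType.isLocallyNoetherian πC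
  rintro ⟨O, L, i₁, i₂, ⟨hsq⟩⟩
  obtain ⟨φ, rfl⟩ := Spec.map_surjective i₂
  let ρ : K →+* O := φ.hom.comp (algebraMap K (Algebra.adjoin K s))
  have hev (a : Algebra.adjoin K s) :
      evalTop i₁ (ν.appTop.hom (a : Γ(Y, ⊤))) = algebraMap O L (φ.hom a) := by
    rw [← Category.assoc, comp_toSpecAdjoin, ← Spec.map_comp] at hsq
    have h1 := congrArg (fun q => q.hom a) (Spec.map_injective hsq)
    rw [← evalTop_comp]
    exact h1
  obtain ⟨w, hw, hwπ⟩ := exists_extension_of_isProper πC (O := O) (Ω := L) ρ (i₁ ≫ j) (by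
    rw [Category.assoc, hC.comp_eq, ← toSpecAdjoin_comp πY he s, ← Category.assoc ν,
      ← Category.assoc, hsq, ← Spec.map_comp, ← Spec.map_comp]
    rfl)
  by_cases hx : w (IsLocalRing.closedPoint O) ∈ Set.range j
  · have hle : Set.range w ⊆ Set.range j := range_subset_of_closedPoint_mem w j.opensRange hx
    have hl : Spec.map (CommRingCat.ofHom (algebraMap O L)) ≫ IsOpenImmersion.lift j w hle = i₁ := by
      rw [← cancel_mono j, Category.assoc, IsOpenImmersion.lift_fac, hw]
    refine CommSq.HasLift.mk' ⟨IsOpenImmersion.lift j w hle, hl, ?_⟩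
    obtain ⟨ψ, hψ⟩ := Spec.map_surjective (IsOpenImmersion.lift j w hle ≫ ν ≫ toSpecAdjoin K s)
    change IsOpenImmersion.lift j w hle ≫ ν ≫ toSpecAdjoin K s = Spec.map φ
    rw [← hl, Category.assoc, ← hψ, ← Spec.map_comp, ← Spec.map_comp] at hsq
    rw [← hψ]
    congr 1
    refine CommRingCat.hom_ext (RingHom.ext fun a => IsFractionRing.injective O L ?_)
    exact congrArg (fun q => q.hom a) (Spec.map_injective hsq)
  · exfalso
    let : Algebra K C.functionField := (stalkStructureMap πC (genericPoint C)).toAlgebra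
    have htr := trdeg_functionField_le_one_of_birational πY hdim hC.normalisation.birational j πC
      hC.comp_eq rfl
    have := hC.normal.isIntegrallyClosed (w (IsLocalRing.closedPoint O))
    have hval := valuationRing_stalk πC rfl htr (w (IsLocalRing.closedPoint O)) fun r hr =>
      (isUnit_iff_ne_zero.mpr hr).map _
    have hx' : w (IsLocalRing.closedPoint O) ∈ (Set.range j)ᶜ := hx
    rw [hv] at hx'
    obtain ⟨m, hm⟩ := Set.mem_iUnion.mp hx'
    set u := Units.map (ν.appTop.hom : Γ(Y, ⊤) →* Γ(Xt, ⊤)) (v m) with hu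
    have hu1 : evalTop i₁ (u : Γ(Xt, ⊤)) ∈ (algebraMap O L).range :=
      ⟨_, (hev ⟨_, Algebra.subset_adjoin (hs m).1⟩).symm⟩
    have hu2 : evalTop i₁ ((u⁻¹ : Γ(Xt, ⊤)ˣ) : Γ(Xt, ⊤)) ∈ (algebraMap O L).range :=
      ⟨_, (hev ⟨_, Algebra.subset_adjoin (hs m).2⟩).symm⟩
    have hinv : ratFun j (u⁻¹ : Γ(Xt, ⊤)ˣ) = (ratFun j u)⁻¹ := by
      refine eq_inv_of_mul_eq_one_left ?_
      rw [← map_mul, Units.inv_mul, map_one]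
    have hO := IsFractionRing.injective O L
    -- Over a field the local rings of the normal curve C are valuation rings, so u or u⁻¹ is
    -- regular at x. The other is not regular there, since x lies on the divisor, and its value
    -- cannot be in O.
    rcases ValuationRing.isInteger_or_isInteger (C.presheaf.stalk (w (IsLocalRing.closedPoint O)))
      (ratFun j (u : Γ(Xt, ⊤))) with h | h
    · refine evalTop_inv_notMem_range j hO hw h (fun h' => notMem_divSupport j h h' hm) hu2
    · rw [← hinv] at h
      refine evalTop_inv_notMem_range j hO hw (u := u⁻¹) h (fun h' => ?_) ?_
      · rw [inv_inv] at h'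
        exact notMem_divSupport j h' h hm
      · rw [inv_inv]
        exact hu1

end ToSpecAdjoin

/-! ### Finiteness of the morphism given by the coordinate functions -/

section FiniteMorphism

open Polynomial

variable {K : Type u} [Field K] {Y Xt C : Scheme.{u}} {πY : Y ⟶ Spec (.of K)} [Algebra K Γ(Y, ⊤)]
  {ν : Xt ⟶ Y} {j : Xt ⟶ C} {πC : C ⟶ Spec (.of K)}

/-- If the prime y contains P(v) for some P ≠ 0, the fibre lies in the zero set of P(v), which is
finite as v is transcendental. If it contains none, only the generic point can lie over y. -/
lemma finite_preimage_singleton_comp_toSpecAdjoin [IsIntegral Xt] [CompactSpace Xt]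
    [LocallyOfFiniteType (ν ≫ πY)] (he : algebraMap K Γ(Y, ⊤) = structureMap πY ⊤)
    [Algebra K Xt.functionField]
    (hK : algebraMap K Xt.functionField = stalkStructureMap (ν ≫ πY) (genericPoint Xt))
    (htr : Algebra.trdeg K Xt.functionField ≤ 1) {s : Set Γ(Y, ⊤)} {v : Γ(Y, ⊤)} (hvs : v ∈ s)
    (hv : ∀ P : K[X], P ≠ 0 → P.eval₂ (structureMap (ν ≫ πY) ⊤) (ν.appTop.hom v) ≠ 0)
    (y : Spec (.of (Algebra.adjoin K s))) : ((ν ≫ toSpecAdjoin K s) ⁻¹' {y}).Finite := by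
  let a : Algebra.adjoin K s := ⟨v, Algebra.subset_adjoin hvs⟩
  have hmem (P : K[X]) (x : Xt) : aeval a P ∉ PrimeSpectrum.asIdeal ((ν ≫ toSpecAdjoin K s) x) ↔
      x ∈ Xt.basicOpen (P.eval₂ (structureMap (ν ≫ πY) ⊤) (ν.appTop.hom v)) := by
    have h1 := notMem_asIdeal_toSpecAdjoin_iff s (aeval a P) (ν x)
    have h2 : ν.appTop.hom ((aeval a P : Algebra.adjoin K s) : Γ(Y, ⊤)) =
        P.eval₂ (structureMap (ν ≫ πY) ⊤) (ν.appTop.hom v) := by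
      have h3 : ((aeval a P : Algebra.adjoin K s) : Γ(Y, ⊤)) = aeval v P :=
        (aeval_algHom_apply (Algebra.adjoin K s).val a P).symm
      rw [h3, aeval_def, hom_eval₂]
      congr 1
      refine RingHom.ext fun r => ?_
      rw [RingHom.comp_apply, he]
      refine appTop_structureMap_of_comp_eq πY (RingHom.id K) ν (ν ≫ πY) ?_ r
      rw [CommRingCat.ofHom_id, Spec.map_id, Category.comp_id]
    rw [← h2]
    refine h1.trans ?_
    exact iff_of_eq (congrArg (fun U : Xt.Opens => x ∈ U) (Scheme.preimage_basicOpen_top ν _))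
  by_cases hy : ∃ P : K[X], P ≠ 0 ∧ aeval a P ∈ PrimeSpectrum.asIdeal y
  · obtain ⟨P, hP, hPy⟩ := hy
    refine (finite_compl_basicOpen (ν ≫ πY) hK htr (hv P hP)).subset fun x hx hxP => ?_
    refine (hmem P x).mpr hxP ?_
    have hx' : (ν ≫ toSpecAdjoin K s) x = y := hx
    rwa [hx']
  · refine (Set.finite_singleton (genericPoint Xt)).subset fun x hx => ?_
    by_contra hne
    obtain ⟨P, hP, hxP⟩ := exists_notMem_basicOpen_eval₂ (ν ≫ πY) hK htr (ν.appTop.hom v) hne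
    rw [← hmem, not_not] at hxP
    have hx' : (ν ≫ toSpecAdjoin K s) x = y := hx
    rw [hx'] at hxP
    exact hy ⟨P, hP, hxP⟩

/-- Functions that have poles or zeros along the whole boundary of a curve define a finite morphism
to an affine scheme. -/
theorem isFinite_toSpecAdjoin [LocallyOfFiniteType πY] [IsSeparated πY] [QuasiCompact πY]
    [IrreducibleSpace Y] (hdim : topologicalKrullDim Y ≤ 1)
    (he : algebraMap K Γ(Y, ⊤) = structureMap πY ⊤)
    (hC : IsNormalCompactification πY ν j πC) {n : ℕ} {v : Fin n → Γ(Y, ⊤)ˣ}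
    (hv : BoundaryEqDivisors ν j v) {s : Set Γ(Y, ⊤)}
    (hs : ∀ i, (v i : Γ(Y, ⊤)) ∈ s ∧ (((v i)⁻¹ : Γ(Y, ⊤)ˣ) : Γ(Y, ⊤)) ∈ s) {i : Fin n}
    (hi : ∀ P : K[X], P ≠ 0 →
      P.eval₂ (structureMap (ν ≫ πY) ⊤) (ν.appTop.hom (v i : Γ(Y, ⊤))) ≠ 0) :
    IsFinite (toSpecAdjoin K s) := by
  have := hC.openImmersion
  have := hC.normal.isIntegral
  have := hC.normalisation.normal.isIntegral
  have := hC.proper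
  have := hC.normalisation.integralHom
  have : IsLocallyNoetherian C := LocallyOfFiniteType.isLocallyNoetherian πC
  have : CompactSpace C := QuasiCompact.compactSpace_of_compactSpace πC
  have : IsNoetherian C := {}
  have : TopologicalSpace.NoetherianSpace Xt := j.isOpenEmbedding.isInducing.noetherianSpace
  have : CompactSpace Y := QuasiCompact.compactSpace_of_compactSpace πY
  have hft : LocallyOfFiniteType (ν ≫ πY) := by
    rw [← hC.comp_eq]
    infer_instance
  let : Algebra K Xt.functionField := (stalkStructureMap (ν ≫ πY) (genericPoint Xt)).toAlgebra
  have htr := trdeg_functionField_le_one_of_birational πY hdim hC.normalisation.birational (𝟙 Xt)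
    (ν ≫ πY) (Category.id_comp _) rfl
  have hsurj := surjective_of_isNormalisation hC.normalisation
  have hcl : UniversallyClosed (ν ≫ toSpecAdjoin K s) :=
    UniversallyClosed.of_valuativeCriterion _ (existence_comp_toSpecAdjoin πY hdim he hC hv hs)
  -- The valuative criterion is checked on the normalisation, and universal closedness descends
  -- along the surjection ν.
  have hcl' : UniversallyClosed (toSpecAdjoin K s) := .of_comp_surjective ν _
  have hsep : IsSeparated (toSpecAdjoin K s) := by
    have : IsSeparated (toSpecAdjoin K s ≫
        Spec.map (CommRingCat.ofHom (algebraMap K (Algebra.adjoin K s)))) := by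
      rwa [toSpecAdjoin_comp πY he]
    exact IsSeparated.of_comp _ (Spec.map (CommRingCat.ofHom (algebraMap K (Algebra.adjoin K s))))
  have hft' : LocallyOfFiniteType (toSpecAdjoin K s) := by
    have : LocallyOfFiniteType (toSpecAdjoin K s ≫
        Spec.map (CommRingCat.ofHom (algebraMap K (Algebra.adjoin K s)))) := by
      rwa [toSpecAdjoin_comp πY he]
    exact locallyOfFiniteType_of_comp _ (Spec.map (CommRingCat.ofHom (algebraMap K (Algebra.adjoin K s))))
  have hprop : IsProper (toSpecAdjoin K s) := {}
  have hqf : LocallyQuasiFinite (toSpecAdjoin K s) := by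
    refine .of_finite_preimage_singleton _ fun y => ?_
    refine ((finite_preimage_singleton_comp_toSpecAdjoin he rfl htr (hs i).1 hi y).image
      ν).subset fun x hx => ?_
    obtain ⟨x', rfl⟩ := ν.surjective x
    exact ⟨x', hx, rfl⟩
  -- Zariski's main theorem: proper and quasi-finite implies finite.
  exact IsFinite.of_isProper_of_locallyQuasiFinite _

lemma isIntegral_adjoin_of_isFinite_toSpecAdjoin (s : Set Γ(Y, ⊤)) [IsAffine Y]
    [IsFinite (toSpecAdjoin K s)] (b : Γ(Y, ⊤)) : IsIntegral (Algebra.adjoin K s) b := by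
  have h1 : IsIntegralHom (Spec.map (CommRingCat.ofHom (Algebra.adjoin K s).val.toRingHom)) := by
    have h2 : Spec.map (CommRingCat.ofHom (Algebra.adjoin K s).val.toRingHom) =
        inv Y.toSpecΓ ≫ toSpecAdjoin K s := (IsIso.eq_inv_comp _).mpr rfl
    rw [h2]
    infer_instance
  rw [IsIntegralHom.SpecMap_iff] at h1
  exact h1 b

end FiniteMorphism

/-! ### From unit coordinates to integral points -/

section SpreadOutIntegrality

open NumberField IsDedekindDomain Polynomial

section Domain

variable {R K : Type u} [CommRing R] [IsDomain R] [Field K] [Algebra R K] {X Xt : Scheme.{u}}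
  {π : X ⟶ Spec (.of R)}

/-- Some point of X lies over the generic point of the base. The generic point of X specializes to
it, so it lies over the generic point of the base too. -/
lemma genericPoint_mem_range_genericFibreProj [IsFractionRing R K] [IsIntegral X]
    [Nonempty (genericFibre K π)] : genericPoint X ∈ Set.range (genericFibreProj K π) := by
  have hr : Set.range (genericFibreProj K π) =
      π ⁻¹' Set.range (Spec.map (CommRingCat.ofHom (algebraMap R K))) :=
    Scheme.Pullback.range_fst _ _
  obtain ⟨y⟩ := ‹Nonempty (genericFibre K π)›
  have hy : genericFibreProj K π y ∈ Set.range (genericFibreProj K π) := ⟨y, rfl⟩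
  rw [hr] at hy ⊢
  obtain ⟨q, hq⟩ := hy
  have hq0 : Spec.map (CommRingCat.ofHom (algebraMap R K)) q = (⊥ : PrimeSpectrum R) := by
    refine PrimeSpectrum.ext ?_
    change Ideal.comap (algebraMap R K) (PrimeSpectrum.asIdeal q) = ⊥
    have hp : (PrimeSpectrum.asIdeal (R := K) q).IsPrime := PrimeSpectrum.isPrime (R := K) q
    rw [Ideal.eq_bot_of_prime (PrimeSpectrum.asIdeal (R := K) q)]
    exact Ideal.comap_bot_of_injective _ (IsFractionRing.injective R K)
  have h1 : π (genericPoint X) ⤳ π (genericFibreProj K π y) :=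
    ((genericPoint_spec X).specializes (Set.mem_univ _)).map π.continuous
  rw [← hq, hq0] at h1
  refine ⟨q, ?_⟩
  rw [hq0]
  exact ((bot_specializes (R := R) (π (genericPoint X))).antisymm h1).eq

lemma eq_zero_of_appTop_eq_zero [IsIntegral X] {t : Xt ⟶ X} (ht : genericPoint X ∈ Set.range t)
    {h : Γ(X, ⊤)} (h0 : t.appTop.hom h = 0) : h = 0 := by
  by_contra hne
  obtain ⟨x, hx⟩ := ht
  have h1 : X.basicOpen h ≠ ⊥ := fun hb => hne ((basicOpen_eq_bot_iff h).mp hb)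
  obtain ⟨y, hy⟩ := (TopologicalSpace.Opens.ne_bot_iff_nonempty _).mp h1
  have h2 : x ∈ t ⁻¹ᵁ X.basicOpen h := by
    change t x ∈ X.basicOpen h
    rw [hx]
    exact genericPoint_mem hy
  rw [Scheme.preimage_basicOpen_top] at h2
  have h3 : Xt.basicOpen (t.appTop.hom h) = ⊥ := by
    rw [h0]
    exact Xt.basicOpen_zero ⊤
  have h4 : x ∈ Xt.basicOpen (t.appTop.hom h) := h2
  rw [h3] at h4
  exact h4

/-- The coordinate functions on a curve which is not contained in a translate of a proper subgroup
are transcendental. -/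
lemma eval₂_structureMap_ne_zero [IsFractionRing R K] (hX : IsGeomIrredCurve K π) {Ω : Type u}
    [Field Ω] [IsAlgClosed Ω] [Algebra R Ω] [Algebra K Ω] [IsScalarTower R K Ω] {n : ℕ}
    {f : Fin n → Γ(X, ⊤)ˣ} (h : NotInTranslate Ω π f) {ν : Xt ⟶ genericFibre K π} [Surjective ν]
    [Nonempty (genericFibre K π)] (i : Fin n) {P : K[X]} (hP : P ≠ 0) :
    P.eval₂ (structureMap (ν ≫ genericFibreMap K π) ⊤)
      ((ν ≫ genericFibreProj K π).appTop.hom (f i : Γ(X, ⊤))) ≠ 0 := by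
  have := hX.isIntegral
  intro h0
  -- Clearing denominators gives an equation for f i over R, valid on X because the fibre reaches
  -- its generic point. Then f i is constant on Ω-points, so X lies in a translate of a proper
  -- subgroup.
  obtain ⟨b, hbM, hb⟩ := IsLocalization.integerNormalization_spec (nonZeroDivisors R) P
  set Q := IsLocalization.integerNormalization (nonZeroDivisors R) P with hQ
  have hRK := IsFractionRing.injective R K
  have hQ0 : Q ≠ 0 := by
    intro h1
    rw [h1, Polynomial.map_zero] at hb
    have h2 : (algebraMap R K b) • P = 0 := by rw [algebraMap_smul]; exact hb.symm
    rcases smul_eq_zero.mp h2 with h3 | h3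
    · exact nonZeroDivisors.ne_zero hbM (hRK (h3.trans (map_zero _).symm))
    · exact hP h3
  have ht : genericPoint X ∈ Set.range (ν ≫ genericFibreProj K π) := by
    obtain ⟨y, hy⟩ := genericPoint_mem_range_genericFibreProj (K := K) (π := π)
    obtain ⟨x, rfl⟩ := ν.surjective y
    exact ⟨x, hy⟩
  have hQf : Q.eval₂ (structureMap π ⊤) (f i : Γ(X, ⊤)) = 0 := by
    refine eq_zero_of_appTop_eq_zero ht ?_
    have h1 : (Q.map (algebraMap R K)).eval₂ (structureMap (ν ≫ genericFibreMap K π) ⊤)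
        ((ν ≫ genericFibreProj K π).appTop.hom (f i : Γ(X, ⊤))) = 0 := by
      rw [hb, ← algebraMap_smul K, Polynomial.smul_eq_C_mul, eval₂_mul, h0, mul_zero]
    rw [eval₂_map] at h1
    rw [hom_eval₂, ← h1]
    congr 1
    refine RingHom.ext fun r => ?_
    refine appTop_structureMap_of_comp_eq π (algebraMap R K) (ν ≫ genericFibreProj K π)
      (ν ≫ genericFibreMap K π) ?_ r
    rw [Category.assoc, Category.assoc, pullback.condition]
  have hRΩ : Function.Injective (algebraMap R Ω) := by
    rw [IsScalarTower.algebraMap_eq R K Ω]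
    exact (algebraMap K Ω).injective.comp hRK
  obtain ⟨c, hc⟩ := exists_forall_evalTop_eq_of_aeval_eq_zero hX hRΩ _ hQ0 hQf
  have ha : (Pi.single i 1 : Fin n → ℤ) ≠ 0 := by simp
  obtain ⟨z₀, -⟩ := h.exists_character_ne ha 1
  obtain ⟨z, hz⟩ := h.exists_character_ne ha (z₀.coords f i)
  rw [character_single] at hz
  exact hz (Units.ext (by rw [Point.coe_coords, Point.coe_coords, hc, hc]))

end Domain

variable {K : Type u} [Field K] [NumberField K]

/-- If the boundary of a curve is the union of the divisors of the coordinate functions, then points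
with integral coordinates are integral, away from finitely many primes. -/
theorem exists_finite_setOf_primes_isIntegralOver {S : Set (HeightOneSpectrum (𝓞 K))}
    {X : Scheme.{u}} {π : X ⟶ Spec (.of (S.integer K))} {n : ℕ} [NeZero n] {f : Fin n → Γ(X, ⊤)ˣ}
    (hX : IsGeomIrredCurve K π) (h : NotInTranslate (AlgebraicClosure K) π f)
    {Xt C : Scheme.{u}} {ν : Xt ⟶ genericFibre K π} {j : Xt ⟶ C} {πC : C ⟶ Spec (.of K)}
    (hC : IsNormalCompactification (genericFibreMap K π) ν j πC)
    (hf : BoundaryEqDivisors (ν ≫ genericFibreProj K π) j f) :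
    ∃ T₂ : Set (HeightOneSpectrum (𝓞 K)), T₂.Finite ∧ ∀ T, T₂ ⊆ T → S ⊆ T →
      ∀ z : Point (AlgebraicClosure K) π, (∀ i, z.coords f i ∈ unitsOf (Tbar T).toSubring) →
        z.IsIntegralOver (Tbar T).toSubring := by
  classical
  have := isFractionRing_integer S
  have := hX.isIntegral
  have := hX.locallyOfFiniteType
  have := hX.quasiCompact
  have := hX.isSeparated
  have := hX.geometricallyIrreducible
  have : IsNoetherianRing (S.integer K) :=
    isNoetherianRing_of_isDedekindDomain (D := 𝓞 K) (S.integer K).toSubring fun d =>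
      (algebraMap (𝓞 K) (S.integer K) d).2
  have := locallyOfFinitePresentation_of_isNoetherianRing π
  let Y := genericFibre K π
  let πY : Y ⟶ Spec (.of K) := genericFibreMap K π
  let pr : Y ⟶ X := genericFibreProj K π
  have hirr : IrreducibleSpace Y :=
    GeometricallyIrreducible.irreducibleSpace_of_subsingleton (f := genericFibreMap K π)
  have := hC.normalisation.integralHom
  have hsurj := surjective_of_isNormalisation hC.normalisation
  let : Algebra K Γ(Y, ⊤) := (structureMap πY ⊤).toAlgebra
  let v (i : Fin n) : Γ(Y, ⊤)ˣ := Units.map (pr.appTop.hom : Γ(X, ⊤) →* Γ(Y, ⊤)) (f i)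
  have hv : BoundaryEqDivisors ν j v := by
    have h1 (i : Fin n) : Units.map ((ν ≫ genericFibreProj K π).appTop.hom : Γ(X, ⊤) →* Γ(Xt, ⊤)) (f i) =
        Units.map (ν.appTop.hom : Γ(Y, ⊤) →* Γ(Xt, ⊤)) (v i) :=
      Units.ext (congrArg (fun q => q.hom (f i : Γ(X, ⊤))) (Scheme.Hom.comp_appTop ν pr))
    rw [BoundaryEqDivisors] at hf ⊢
    rw [hf]
    exact Set.iUnion_congr fun i => by rw [h1]
  let s : Set Γ(Y, ⊤) := Set.range (fun i => (v i : Γ(Y, ⊤))) ∪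
    Set.range (fun i => (((v i)⁻¹ : Γ(Y, ⊤)ˣ) : Γ(Y, ⊤)))
  have hfin : IsFinite (toSpecAdjoin K s) := by
    refine isFinite_toSpecAdjoin (πY := πY) hX.dim_eq_one.le rfl hC hv
      (fun i => ⟨Or.inl ⟨i, rfl⟩, Or.inr ⟨i, rfl⟩⟩) (i := 0) fun P hP => ?_
    have h1 := eval₂_structureMap_ne_zero hX h (ν := ν) 0 hP
    rwa [Scheme.Hom.comp_appTop] at h1
  have haff : IsAffine Y := isAffine_of_isAffineHom (toSpecAdjoin K s)
  let : Algebra (S.integer K) Γ(Y, ⊤) :=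
    ((structureMap πY ⊤).comp (algebraMap (S.integer K) K)).toAlgebra
  let a : Spec (.of Γ(Y, ⊤)) ⟶ X := Y.isoSpec.inv ≫ pr
  have ha : a ≫ π = Spec.map (CommRingCat.ofHom (algebraMap (S.integer K) Γ(Y, ⊤))) := by
    have h1 : pr ≫ π = πY ≫ Spec.map (CommRingCat.ofHom (algebraMap (S.integer K) K)) :=
      pullback.condition
    have h2 : Y.isoSpec.inv ≫ πY = Spec.map (CommRingCat.ofHom (structureMap πY ⊤)) := by
      rw [Iso.inv_comp_eq]
      exact (toSpecΓ_comp_structureMap πY).symm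
    change (Y.isoSpec.inv ≫ pr) ≫ π = _
    rw [Category.assoc, h1, ← Category.assoc, h2, ← Spec.map_comp]
    rfl
  -- The generic fibre has turned out to be affine, and R is noetherian, so X has finite
  -- presentation. Hence the map from the fibre to X needs only finitely many functions s' over R.
  obtain ⟨s', g, hg⟩ := exists_finset_adjoin_factor π a ha
  choose E hE using fun b : Γ(Y, ⊤) => exists_finset_forall_mem_of_isIntegral.{u}
    (isIntegral_adjoin_of_isFinite_toSpecAdjoin (K := K) s b)
  -- T₂ consists of the primes in the denominators of the constants occurring in the integral
  -- equations of the generators s'.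
  refine ⟨⋃ e ∈ s'.biUnion E, HeightOneSpectrum.Support (𝓞 K) e,
    (s'.biUnion E).finite_toSet.biUnion fun e _ => HeightOneSpectrum.Support.finite _ e,
    fun T hT hST z hz => ?_⟩
  have hzK : z.1 ≫ π = Spec.map (CommRingCat.ofHom (algebraMap K (AlgebraicClosure K))) ≫
      Spec.map (CommRingCat.ofHom (algebraMap (S.integer K) K)) := by
    rw [z.2, ← Spec.map_comp]
    rfl
  let zK : Spec (.of (AlgebraicClosure K)) ⟶ Y := pullback.lift _ _ hzK
  have hzpr : zK ≫ pr = z.1 := pullback.lift_fst _ _ _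
  have hzY : zK ≫ πY = Spec.map (CommRingCat.ofHom (algebraMap K (AlgebraicClosure K))) :=
    pullback.lift_snd _ _ _
  let ψ : Γ(Y, ⊤) →+* AlgebraicClosure K := evalTop zK
  have hψK (e : K) : ψ (structureMap πY ⊤ e) = algebraMap K (AlgebraicClosure K) e :=
    evalTop_structureMap πY zK _ hzY e
  have hψf (i : Fin n) : Units.map (ψ : Γ(Y, ⊤) →* AlgebraicClosure K) (v i) = z.coords f i := by
    refine Units.ext ?_
    rw [Point.coe_coords, ← hzpr]
    exact (evalTop_comp zK pr _).symm
  -- If the coordinates of z are T-units, then z sends every generator to an element integral over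
  -- the T-integers, hence into `Tbar T`. The restricted map composed with g is the required
  -- extension.
  have hψ (b) (hb : b ∈ Algebra.adjoin (S.integer K) (s' : Set Γ(Y, ⊤))) :
      ψ b ∈ (Tbar T).toSubring := by
    induction hb using Algebra.adjoin_induction with
    | mem b hb =>
      refine hE b _ (Tbar T).toSubring ψ (fun e he => ?_) ?_
      · refine (hψK e).symm ▸ algebraMap_mem_Tbar fun p hp => not_lt.mp fun hlt => hp (hT ?_)
        exact Set.mem_biUnion (Finset.mem_biUnion.mpr ⟨b, hb, he⟩) hlt
      · have hzi (i) := mem_unitsOf_iff.mp (hz i)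
        rintro _ (⟨i, rfl⟩ | ⟨i, rfl⟩)
        · change ((Units.map (ψ : Γ(Y, ⊤) →* AlgebraicClosure K) (v i) : _ˣ) : AlgebraicClosure K) ∈ _
          rw [hψf]
          exact (hzi i).1
        · change ((Units.map (ψ : Γ(Y, ⊤) →* AlgebraicClosure K) (v i)⁻¹ : _ˣ) :
            AlgebraicClosure K) ∈ _
          rw [map_inv, hψf]
          exact (hzi i).2
    | algebraMap r =>
      exact (hψK r).symm ▸ algebraMap_mem_Tbar fun p hp => r.2 p fun hpS => hp (hST hpS)
    | add x y _ _ hx hy => rw [map_add]; exact add_mem hx hy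
    | mul x y _ _ hx hy => rw [map_mul]; exact mul_mem hx hy
  let κ : Algebra.adjoin (S.integer K) (s' : Set Γ(Y, ⊤)) →+* (Tbar T).toSubring :=
    (ψ.comp (Algebra.adjoin (S.integer K) (s' : Set Γ(Y, ⊤))).val.toRingHom).codRestrict
      (Tbar T).toSubring fun b => hψ b b.2
  refine ⟨Spec.map (CommRingCat.ofHom κ) ≫ g, ?_⟩
  have h1 : Spec.map (CommRingCat.ofHom (Tbar T).toSubring.subtype) ≫ Spec.map (CommRingCat.ofHom κ) =
      Spec.map (CommRingCat.ofHom ψ) ≫ Spec.map (CommRingCat.ofHom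
        (Algebra.adjoin (S.integer K) (s' : Set Γ(Y, ⊤))).val.toRingHom) := by
    rw [← Spec.map_comp, ← Spec.map_comp]
    rfl
  have h2 : Spec.map (CommRingCat.ofHom ψ) ≫ Y.isoSpec.inv = zK := by
    rw [Iso.comp_inv_eq]
    exact (comp_toSpecΓ zK).symm
  rw [← Category.assoc, h1, Category.assoc, hg, ← hzpr, ← h2]
  exact (Category.assoc _ _ _).symm

end SpreadOutIntegrality

end TorusCurve

end

/-! ### Assembly of both parts -/

open TorusCurve NumberField IsDedekindDomain in
theorem lemma3p3 :
    (∀ (p : ℕ) [Fact p.Prime] (n : ℕ) (_ : 1 ≤ n)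
      (X Xt C : Scheme.{0}) (π : X ⟶ Spec (.of (Znr p))) (f : Fin n → Γ(X, ⊤)ˣ)
      (ν : Xt ⟶ X) (j : Xt ⟶ C) (πC : C ⟶ Spec (.of (Znr p))),
      IsGeomIrredCurve (Qnr p) π →
      IsNormalCompactification π ν j πC →
      BoundaryEqDivisors ν j f →
      BoundaryEtale j πC →
      (∃ Θ : Finset (Matrix (Fin (n - 1)) (Fin n) ℤ),
        (∀ A ∈ Θ, Function.Surjective (torusHom (PadicAlgCl p) A)) ∧
        (∀ z : Point (Qnr p) π, z.coords f ∈ special (Qnr p) n 2 →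
          (∃ i, z.coords f i ∉ unitsOf (Znr p).toSubring) →
          ∃ A ∈ Θ, torusHom (Qnr p) A (z.coords f) ∈ special (Qnr p) (n - 1) 2 ∧
            ∀ l, torusHom (Qnr p) A (z.coords f) l ∈ unitsOf (Znr p).toSubring) ∧
        (∀ z : Point (PadicAlgCl p) π, z.coords f ∈ special (PadicAlgCl p) n 2 →
          (∃ i, z.coords f i ∉ unitsOf (Zbar p).toSubring) →
          ∃ A ∈ Θ, torusHom (PadicAlgCl p) A (z.coords f) ∈ special (PadicAlgCl p) (n - 1) 2 ∧
            ∀ l, torusHom (PadicAlgCl p) A (z.coords f) l ∈ unitsOf (Zbar p).toSubring)) ∧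
      (n = 3 → NotInTranslate (PadicAlgCl p) π f →
        {z : Point (PadicAlgCl p) π | z.coords f ∈ special (PadicAlgCl p) n 2 ∧
          ¬ z.IsIntegralOver (Zbar p).toSubring}.Finite)) ∧
    (∀ (K : Type u) [Field K] [NumberField K] (S : Set (HeightOneSpectrum (𝓞 K)))
      (_ : S.Finite) (X : Scheme.{u}) (π : X ⟶ Spec (.of (S.integer K)))
      (f : Fin 3 → Γ(X, ⊤)ˣ),
      IsGeomIrredCurve K π →
      NotInTranslate (AlgebraicClosure K) π f →
      ∃ T : Set (HeightOneSpectrum (𝓞 K)), T.Finite ∧ S ⊆ T ∧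
        {z : Point (AlgebraicClosure K) π | z.coords f ∈ special (AlgebraicClosure K) 3 2 ∧
          ∃ i, z.coords f i ∉ unitsOf (Tbar T).toSubring}.Finite ∧
        (∀ (Xt C : Scheme.{u}) (ν : Xt ⟶ genericFibre K π) (j : Xt ⟶ C) (πC : C ⟶ Spec (.of K)),
          IsNormalCompactification (genericFibreMap K π) ν j πC →
          BoundaryEqDivisors (ν ≫ genericFibreProj K π) j f →
          {z : Point (AlgebraicClosure K) π | z.coords f ∈ special (AlgebraicClosure K) 3 2 ∧
            ¬ z.IsIntegralOver (Tbar T).toSubring}.Finite)) := by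
  classical
  refine ⟨fun p _ n _ X Xt C π f ν j πC hX hC hf hD => padic_statement hX hC hf hD,
    fun K _ _ S hS X π f hX h => ?_⟩
  obtain ⟨T₁, hT₁, hST₁, Z, hZ, hT₁Z⟩ := exists_finite_setOf_primes hS hX h
  have hnotint (T : Set (HeightOneSpectrum (𝓞 K))) (hT : T₁ ⊆ T) :
      {z : Point (AlgebraicClosure K) π | z.coords f ∈ special (AlgebraicClosure K) 3 2 ∧
        ∃ i, z.coords f i ∉ unitsOf (Tbar T).toSubring}.Finite :=
    hZ.subset fun z hz => hT₁Z T hT z hz.1 hz.2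
  -- T has to be chosen before the compactification. Being an integral point of X does not depend on
  -- a compactification, so the primes obtained from one suitable choice serve for all; if there is
  -- none, the last claim is vacuous.
  by_cases hex : ∃ (Xt C : Scheme.{u}) (ν : Xt ⟶ genericFibre K π) (j : Xt ⟶ C)
      (πC : C ⟶ Spec (.of K)), IsNormalCompactification (genericFibreMap K π) ν j πC ∧
        BoundaryEqDivisors (ν ≫ genericFibreProj K π) j f
  · obtain ⟨Xt, C, ν, j, πC, hC, hf⟩ := hex
    obtain ⟨T₂, hT₂, hT₂z⟩ := exists_finite_setOf_primes_isIntegralOver hX h hC hf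
    refine ⟨T₁ ∪ T₂, hT₁.union hT₂, hST₁.trans Set.subset_union_left,
      hnotint _ Set.subset_union_left, fun _ _ _ _ _ _ _ => ?_⟩
    refine (hnotint (T₁ ∪ T₂) Set.subset_union_left).subset fun z hz => ⟨hz.1, ?_⟩
    by_contra! hcon
    exact hz.2 (hT₂z _ Set.subset_union_right (hST₁.trans Set.subset_union_left) z hcon)
  · exact ⟨T₁, hT₁, hST₁, hnotint _ subset_rfl,
      fun Xt C ν j πC hC hf => absurd ⟨Xt, C, ν, j, πC, hC, hf⟩ hex⟩
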